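/- Let $I=[0,1]$ and let $C(I)$ be the space of continuous real functions on $I$ with the supremum norm. For $F\in C(I)$ and $a<b$ put $\omega(F,a,b)=\sup_{x,y\in(a,b)}|F(x)-F(y)|$, and $\omega(F,a,a)=0$. For $E\subseteq I$, $F$ is $AC$ (respectively $AC_*$) on $E$ if for every $\varepsilon>0$ there is $\delta>0$ such that for all non-decreasing finite sequences $a_0\le b_0\le a_1\le\dots\le a_k\le b_k$ of points of $E$ with $\sum_i|b_i-a_i|<\delta$ one has $\sum_i|F(b_i)-F(a_i)|<\varepsilon$ (respectively $\sum_i\omega(F,a_i,b_i)<\varepsilon$). For $X\in\{AC,AC_*\}$ let $P^0_{F,X}=I$, $$P^{\alpha+1}_{F,X}=P^{\alpha}_{F,X}\setminus\bigcup\{(a,b): a<b \text{ real},\ F\text{ is }X\text{ on }[a,b]\cap P^\alpha_{F,X}\},\qquad P^\lambda_{F,X}=\bigcap_{\alpha<\lambda}P^\alpha_{F,X}\ \ (\lambda\text{ limit}),$$ let $|F|_X$ be the least $\alpha$ with $P^\alpha_{F,X}=\emptyset$ if there is one and $\infty$ otherwise, and let $ACG_\alpha=\{F\in C(I):|F|_{AC}\le\alpha\}$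 and $ACG_{*\alpha}=\{F\in C(I):|F|_{AC_*}\le\alpha\}$. For an oracle $Z$ let $\mathcal O^Z$ be Kleene's system of ordinal notations relative to $Z$, let $|a|^Z$ be the ordinal denoted by $a\in\mathcal O^Z$, let $\omega_1^Z=\sup\{|a|^Z:a\in\mathcal O^Z\}$, and let $H_a^Z$ ($a\in\mathcal O^Z$) be the sets obtained from $Z$ by iterating the Turing jump along $\mathcal O^Z$. For $Y\in2^\omega$ and an ordinal $\beta$, a set $B\subseteq\omega^\omega$ is $\Sigma^0_\beta(Y)$ if there are $e_0,a\in\omega$ such that for every $X\in\omega^\omega$, $a\in\mathcal O^{Y\oplus X}$, $|a|^{Y\oplus X}=\beta$, and $X\in B\iff e_0\in H^{Y\oplus X}_{2^a}$, where $H_{2^a}$ is replaced by $H_a$ if $\beta<\omega$. A name of $F\in C(I)$ is an $X\in\omega^\omega$ such that $X(k)$ codes a piecewise linear function with rational break points and values within $2^{-k}$ of $F$ in the supremum norm, for every $k$. A set $A\subseteq C(I)$ is $\Sigma^0_\beta(Y)$ if there is a $\Sigma^0_\beta(Y)$ set $B\subseteq\omega^\omega$ such that $F\in A\iff X\in B$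 whenever $X$ is a name of $F$. Corollary. Let $Y\in2^\omega$ and $\alpha<\omega_1^Y$. Then $ACG_{*\alpha}$ and $ACG_\alpha$ are $\Sigma^0_{4\alpha}(Y)$, where $4\alpha$ is the ordinal product (so $4(\alpha+1)=4\alpha+4$, and $4\lambda=\lambda$ for limit $\lambda$). -/

import Mathlib

/-! ## Computation relative to an oracle -/

namespace OracleComp

/-- Programs for partial recursive functions with one oracle `g : ℕ → ℕ`. -/
inductive Code : Type
  | zero : Code
  | succ : Code
  | left : Code
  | right : Code
  | oracle : Code
  | pair : Code → Code → Code
  | comp : Code → Code → Code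
  | prec : Code → Code → Code
  | rfind : Code → Code

/-- The partial function computed by a program with oracle `g`. Apart from the oracle
instruction this is the semantics of `Nat.Partrec.Code`. -/
def Code.eval (g : ℕ → ℕ) : Code → ℕ →. ℕ
  | .zero => fun _ => Part.some 0
  | .succ => fun n => Part.some (n + 1)
  | .left => fun n => Part.some n.unpair.1
  | .right => fun n => Part.some n.unpair.2
  | .oracle => fun n => Part.some (g n)
  | .pair c d => fun n => Nat.pair <$> c.eval g n <*> d.eval g n
  | .comp c d => fun n => d.eval g n >>= c.eval g
  | .prec c d =>
    Nat.unpaired fun a n =>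
      n.rec (c.eval g a) fun y IH => do
        let i ← IH
        d.eval g (Nat.pair a (Nat.pair y i))
  | .rfind c => fun a =>
      Nat.rfind fun n => (fun m => decide (m = 0)) <$> c.eval g (Nat.pair a n)

/-- The (standard, bijective) Gödel numbering of programs: the program with a given number. -/
def Code.ofNat : ℕ → Code
  | 0 => .zero
  | 1 => .succ
  | 2 => .left
  | 3 => .right
  | 4 => .oracle
  | n + 5 =>
    have h : n / 4 < n + 5 := lt_of_le_of_lt (Nat.div_le_self n 4) (by omega)
    have _h1 : (n / 4).unpair.1 < n + 5 := lt_of_le_of_lt (Nat.unpair_left_le _) h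
    have _h2 : (n / 4).unpair.2 < n + 5 := lt_of_le_of_lt (Nat.unpair_right_le _) h
    if n % 4 = 0 then .pair (ofNat (n / 4).unpair.1) (ofNat (n / 4).unpair.2)
    else if n % 4 = 1 then .comp (ofNat (n / 4).unpair.1) (ofNat (n / 4).unpair.2)
    else if n % 4 = 2 then .prec (ofNat (n / 4).unpair.1) (ofNat (n / 4).unpair.2)
    else .rfind (ofNat (n / 4))

/-- `phi g e` is the `e`-th partial function computable with oracle `g`. -/
def phi (g : ℕ → ℕ) (e : ℕ) : ℕ →. ℕ := (Code.ofNat e).eval g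

open Classical in
/-- The characteristic function of a set of natural numbers. -/
noncomputable def charFun (A : Set ℕ) (n : ℕ) : ℕ := if n ∈ A then 1 else 0

/-- The Turing jump `A' = {e : φ_e^A(e) halts}`. -/
def jump (A : Set ℕ) : Set ℕ := {e | (phi (charFun A) e e).Dom}

/-- `Y ⊕ X` for `Y ∈ 2^ω` and `X ∈ ω^ω`. -/
noncomputable def join (Y : Set ℕ) (X : ℕ → ℕ) (n : ℕ) : ℕ :=
  if n % 2 = 0 then charFun Y (n / 2) else X (n / 2)

/-! ## Kleene's `O` and the sets `H_a`, relative to an oracle -/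

/-- The relation `<_O` of Kleene's `O^g`, in its recursively enumerable form: the transitive
relation generated by `a < 2^a` (`a ≠ 0`) and `φ_e^g(n) < 3·5^e`. Below an element of `O^g`
it is Kleene's relation. -/
inductive NotationLT (g : ℕ → ℕ) : ℕ → ℕ → Prop
  | succ (a : ℕ) : a ≠ 0 → NotationLT g a (2 ^ a)
  | lim (e n b : ℕ) : b ∈ phi g e n → NotationLT g b (3 * 5 ^ e)
  | trans (a b c : ℕ) : NotationLT g a b → NotationLT g b c → NotationLT g a c

/-- `IsNotation g a α` says that `a ∈ O^g` and `|a|^g = α`. -/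
inductive IsNotation (g : ℕ → ℕ) : ℕ → Ordinal.{0} → Prop
  | one : IsNotation g 1 0
  | succ (a : ℕ) (α : Ordinal.{0}) : IsNotation g a α → IsNotation g (2 ^ a) (α + 1)
  | lim (e : ℕ) (f : ℕ → ℕ) (β : ℕ → Ordinal.{0}) :
      (∀ n, f n ∈ phi g e n) → (∀ n, NotationLT g (f n) (f (n + 1))) →
      (∀ n, IsNotation g (f n) (β n)) → IsNotation g (3 * 5 ^ e) (⨆ n, β n)

/-- `ω_1^Y`, the supremum of the ordinals with a notation in `O^Y`. -/
noncomputable def omegaOne (Y : Set ℕ) : Ordinal.{0} :=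
  sSup {α | ∃ a, IsNotation (charFun Y) a α}

/-- `IsHSet g a A` says that `a ∈ O^g` and `A = H_a^g`. At the bottom stands the oracle itself
(its graph), at successors the jump, at limits the effective join along the fundamental
sequence. -/
inductive IsHSet (g : ℕ → ℕ) : ℕ → Set ℕ → Prop
  | one : IsHSet g 1 {x | g x.unpair.1 = x.unpair.2}
  | succ (a : ℕ) (A : Set ℕ) : IsHSet g a A → IsHSet g (2 ^ a) (jump A)
  | lim (e : ℕ) (f : ℕ → ℕ) (A : ℕ → Set ℕ) :
      (∀ n, f n ∈ phi g e n) → (∀ n, NotationLT g (f n) (f (n + 1))) →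
      (∀ n, IsHSet g (f n) (A n)) → IsHSet g (3 * 5 ^ e) {x | x.unpair.2 ∈ A x.unpair.1}

/-- The set `H_a^g`, for `a ∈ O^g`. -/
def HSet (g : ℕ → ℕ) (a : ℕ) : Set ℕ := {x | ∃ A, IsHSet g a A ∧ x ∈ A}

/-! ## The classes `Σ^0_β(Y)` -/

open Classical in
/-- `B ⊆ ω^ω` is `Σ^0_β(Y)`: there are an index `e₀` and a number `a` that is a notation for `β`
in every `O^{Y ⊕ X}` such that `X ∈ B ↔ e₀ ∈ H_{2^a}^{Y ⊕ X}`, with `H_a` in place of `H_{2^a}`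
for finite `β`. -/
def IsSigmaZero (Y : Set ℕ) (β : Ordinal.{0}) (B : Set (ℕ → ℕ)) : Prop :=
  ∃ e₀ a : ℕ, ∀ X : ℕ → ℕ, IsNotation (join Y X) a β ∧
    (X ∈ B ↔ e₀ ∈ HSet (join Y X) (if β < Ordinal.omega0 then a else 2 ^ a))

/-- A numbering of the rational numbers (with repetitions). -/
def ratOfNat (n : ℕ) : ℚ :=
  ((n.unpair.1.unpair.1 : ℚ) - (n.unpair.1.unpair.2 : ℚ)) / ((n.unpair.2 : ℚ) + 1)

/-- The ideal points of `C(I)`, the piecewise linear functions with rational break points and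
values. If `s` codes the list `v_0, …, v_N` of rationals, then `idealPoint s` takes the value
`v_k` at `k / N` and is linear on each `[k / N, (k + 1) / N]` (for `N = 0` it is the constant
`v_0`, and `0` for the empty list); it is written as a sum of hat functions. -/
noncomputable def idealPoint (s : ℕ) : C(unitInterval, ℝ) :=
  let v : List ℕ := Denumerable.ofNat (List ℕ) s
  { toFun := fun x => ∑ k : Fin v.length,
      (ratOfNat (v.get k) : ℝ) * max 0 (1 - |((v.length - 1 : ℕ) : ℝ) * (x : ℝ) - (k : ℕ)|)
    continuous_toFun := by fun_prop }

/-- `X ∈ ω^ω` is a name of `F ∈ C(I)`: it provides, for each `k`, a rational piecewise linear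
function within `2^{-k}` of `F` in the supremum norm. -/
def IsName (X : ℕ → ℕ) (F : C(unitInterval, ℝ)) : Prop :=
  ∀ k : ℕ, dist (idealPoint (X k)) F ≤ (1 / 2 : ℝ) ^ k

/-- `A ⊆ C(I)` is `Σ^0_β(Y)`: membership of `F` in `A` is a `Σ^0_β(Y)` property of the names
of `F`. -/
def IsSigmaZeroCI (Y : Set ℕ) (β : Ordinal.{0}) (A : Set C(unitInterval, ℝ)) : Prop :=
  ∃ B : Set (ℕ → ℕ), IsSigmaZero Y β B ∧
    ∀ (X : ℕ → ℕ) (F : C(unitInterval, ℝ)), IsName X F → (F ∈ A ↔ X ∈ B)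

end OracleComp

/-! ## Absolute continuity on a set and the derivation process -/

namespace Denjoy

/-- The oscillation `ω(F, a, b) = sup_{x, y ∈ (a, b)} |F x - F y|` (`0` if `(a, b)` is empty). -/
noncomputable def osc (F : C(unitInterval, ℝ)) (a b : unitInterval) : ℝ :=
  sSup {r : ℝ | ∃ x ∈ Set.Ioo a b, ∃ y ∈ Set.Ioo a b, r = |F x - F y|}

/-- `a_0, b_0, …, a_k, b_k` is a non-decreasing sequence of points of `E`. -/
def IsIntervalSeq (E : Set unitInterval) {k : ℕ} (a b : Fin (k + 1) → unitInterval) : Prop :=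
  (∀ i, a i ∈ E ∧ b i ∈ E) ∧ (∀ i, a i ≤ b i) ∧ ∀ i j, i < j → b i ≤ a j

/-- `F` is `AC` on `E`. -/
def IsAC (F : C(unitInterval, ℝ)) (E : Set unitInterval) : Prop :=
  ∀ ε : ℝ, 0 < ε → ∃ δ : ℝ, 0 < δ ∧
    ∀ (k : ℕ) (a b : Fin (k + 1) → unitInterval), IsIntervalSeq E a b →
      ∑ i, |(b i : ℝ) - (a i : ℝ)| < δ → ∑ i, |F (b i) - F (a i)| < ε

/-- `F` is `AC_*` on `E`. -/
def IsACStar (F : C(unitInterval, ℝ)) (E : Set unitInterval) : Prop :=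
  ∀ ε : ℝ, 0 < ε → ∃ δ : ℝ, 0 < δ ∧
    ∀ (k : ℕ) (a b : Fin (k + 1) → unitInterval), IsIntervalSeq E a b →
      ∑ i, |(b i : ℝ) - (a i : ℝ)| < δ → ∑ i, osc F (a i) (b i) < ε

/-- One step of the derivation: remove from `P` every open interval `(a, b)` such that the
property `Q` (of subsets of `I`) holds for `[a, b] ∩ P`. The end points are arbitrary reals, so
that the `(a, b) ∩ I` are the relatively open intervals of `I`. -/
def derive (Q : Set unitInterval → Prop) (P : Set unitInterval) : Set unitInterval :=
  P \ {x | ∃ a b : ℝ, a < x ∧ x < b ∧ Q {y | y ∈ P ∧ a ≤ y ∧ y ≤ b}}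

/-- The derivation process `P^0 = I`, `P^{α+1} = derive P^α`, `P^λ = ⋂_{α<λ} P^α`. -/
noncomputable def derived (Q : Set unitInterval → Prop) (α : Ordinal.{0}) : Set unitInterval :=
  Ordinal.limitRecOn α Set.univ (fun _ P => derive Q P)
    (fun o _ P => ⋂ (β : Ordinal.{0}) (h : β < o), P β h)

open Classical in
/-- The least `α` such that `P^α = ∅`, and `⊤` if there is none. -/
noncomputable def rank (Q : Set unitInterval → Prop) : WithTop Ordinal.{0} :=
  if ∃ α, derived Q α = ∅ then ((sInf {α | derived Q α = ∅} : Ordinal.{0}) : WithTop Ordinal.{0})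
  else ⊤

/-- `ACG_α = {F ∈ C(I) : |F|_{AC} ≤ α}`. -/
def ACG (α : Ordinal.{0}) : Set C(unitInterval, ℝ) := {F | rank (IsAC F) ≤ (α : WithTop Ordinal)}

/-- `ACG_{*α} = {F ∈ C(I) : |F|_{AC_*} ≤ α}`. -/
def ACGStar (α : Ordinal.{0}) : Set C(unitInterval, ℝ) :=
  {F | rank (IsACStar F) ≤ (α : WithTop Ordinal)}

end Denjoy

/-! Code a closed set `P` by the cells it misses. The cells of resolution `n` are the closed
intervals of radius `1 / (n + 1)` in `I` about the grid points `i / (n + 1)`. Let `T_α` be the set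
of the codes of the cells disjoint from `P^α`, joined with the graph of `Y ⊕ X`, where `X` is a name
of `F`. The cell `0` at resolution `0` is all of `I`, so `F` has rank at most `α` iff this one cell
is listed in `T_α`. It remains to locate `T_α` among the sets `H_a`.

Successors: by compactness, a cell misses `P^(α+1)` iff for some resolution `M` the function is
absolutely continuous on `P^α ∩ c` for every cell `c` of resolution `M` near it
(`derive_disjoint_cell_iff`). Absolute continuity there can be tested on finite data: for every `e`
there is `d` such that no finite grid sequence, with end cells meeting `P^α`, has length below `1 /
(d + 1)` while an approximating polygon varies along it by more than `2 / (e + 1)`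
(`not_obstruction_of_isVar`, `isVar_of_not_obstruction`). This has the form `∃ M, ∀ c e, ∃ d, ∀ t`
with a matrix decidable in `T_α`, so `T_(α+1)` reduces uniformly to the fourth jump of `T_α`
(`exists_step_reduction`). That is the factor 4.

Limits: by compactness, a cell misses a decreasing intersection iff it misses one of the sets. Hence
a limit stage costs one existential quantifier over the join of the earlier stages.

The steps are iterated along notations with the recursion theorem. `exists_isNotationMap` supplies
notations for `4α` valid in every `O^(Y ⊕ X)`, and `exists_uniform_reduction` reduces `T_α` to the
jump of the corresponding `H`-set. For infinite `α` this is the required class. For finite `α` the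
additional jump is not available, and `exists_finite_reduction` reduces to the `H`-set itself. `AC`
and `AC_*` are treated together as `IsVar`. -/

/-! ## Gödel numbers of programs -/

namespace OracleComp

namespace Code

/-- The Gödel number of a program. -/
def num : Code → ℕ
  | zero => 0
  | succ => 1
  | left => 2
  | right => 3
  | oracle => 4
  | pair c d => 4 * Nat.pair c.num d.num + 5
  | comp c d => 4 * Nat.pair c.num d.num + 6
  | prec c d => 4 * Nat.pair c.num d.num + 7
  | rfind c => 4 * c.num + 8

end Code

/-- The Gödel number of a composition. -/
def compNum (a b : ℕ) : ℕ := 4 * Nat.pair a b + 6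

/-- The Gödel number of a pairing. -/
def pairNum (a b : ℕ) : ℕ := 4 * Nat.pair a b + 5

/-- The Gödel number of a primitive recursion. -/
def precNum (a b : ℕ) : ℕ := 4 * Nat.pair a b + 7

/-- The Gödel number of an unbounded search. -/
def rfindNum (a : ℕ) : ℕ := 4 * a + 8

theorem ofNat_pairNum (a b : ℕ) :
    Code.ofNat (pairNum a b) = .pair (Code.ofNat a) (Code.ofNat b) := by
  have h2 : 4 * Nat.pair a b / 4 = Nat.pair a b := by omega
  rw [pairNum, Code.ofNat]
  simp [h2]

theorem ofNat_compNum (a b : ℕ) :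
    Code.ofNat (compNum a b) = .comp (Code.ofNat a) (Code.ofNat b) := by
  have h1 : (4 * Nat.pair a b + 1) % 4 = 1 := by omega
  have h2 : (4 * Nat.pair a b + 1) / 4 = Nat.pair a b := by omega
  rw [compNum, show 4 * Nat.pair a b + 6 = (4 * Nat.pair a b + 1) + 5 by rfl, Code.ofNat]
  simp [h1, h2]

theorem ofNat_precNum (a b : ℕ) :
    Code.ofNat (precNum a b) = .prec (Code.ofNat a) (Code.ofNat b) := by
  have h1 : (4 * Nat.pair a b + 2) % 4 = 2 := by omega
  have h2 : (4 * Nat.pair a b + 2) / 4 = Nat.pair a b := by omega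
  rw [precNum, show 4 * Nat.pair a b + 7 = (4 * Nat.pair a b + 2) + 5 by rfl, Code.ofNat]
  simp [h1, h2]

theorem ofNat_rfindNum (a : ℕ) : Code.ofNat (rfindNum a) = .rfind (Code.ofNat a) := by
  have h1 : (4 * a + 3) % 4 = 3 := by omega
  have h2 : (4 * a + 3) / 4 = a := by omega
  rw [rfindNum, show 4 * a + 8 = (4 * a + 3) + 5 by rfl, Code.ofNat]
  simp [h1, h2]

theorem ofNat_num (c : Code) : Code.ofNat c.num = c := by
  induction c with
  | zero | succ | left | right | oracle => rw [Code.num, Code.ofNat]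
  | pair c d hc hd => exact (ofNat_pairNum _ _).trans (by rw [hc, hd])
  | comp c d hc hd => exact (ofNat_compNum _ _).trans (by rw [hc, hd])
  | prec c d hc hd => exact (ofNat_precNum _ _).trans (by rw [hc, hd])
  | rfind c hc => exact (ofNat_rfindNum _).trans (by rw [hc])

/-- Case analysis on Gödel numbers. -/
theorem num_cases (n : ℕ) : n ≤ 4 ∨
    ∃ a b, a < n ∧ b < n ∧
      (n = pairNum a b ∨ n = compNum a b ∨ n = precNum a b ∨ n = rfindNum a) := by
  rcases Nat.lt_or_ge 4 n with h | h
  · right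
    obtain ⟨m, rfl⟩ : ∃ m, n = m + 5 := ⟨n - 5, by omega⟩
    have h1 := Nat.unpair_left_le (m / 4)
    have h2 := Nat.unpair_right_le (m / 4)
    by_cases h3 : m % 4 = 3
    · refine ⟨m / 4, m / 4, by omega, by omega, ?_⟩
      simp only [rfindNum]
      omega
    · refine ⟨(m / 4).unpair.1, (m / 4).unpair.2, by omega, by omega, ?_⟩
      simp only [pairNum, compNum, precNum, Nat.pair_unpair]
      omega
  · exact Or.inl h

theorem num_ofNat (n : ℕ) : (Code.ofNat n).num = n := by
  induction n using Nat.strong_induction_on with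
  | _ n ih =>
    rcases num_cases n with h | ⟨a, b, ha, hb, rfl | rfl | rfl | rfl⟩
    · interval_cases n <;> rw [Code.ofNat, Code.num]
    · rw [ofNat_pairNum, Code.num, ih _ ha, ih _ hb, pairNum]
    · rw [ofNat_compNum, Code.num, ih _ ha, ih _ hb, compNum]
    · rw [ofNat_precNum, Code.num, ih _ ha, ih _ hb, precNum]
    · rw [ofNat_rfindNum, Code.num, ih _ ha, rfindNum]

theorem primrec_pairNum : Primrec₂ pairNum :=
  Primrec.nat_add.comp₂ (Primrec.nat_mul.comp₂ (Primrec₂.const 4) Primrec₂.natPair)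
    (Primrec₂.const 5)

theorem primrec_compNum : Primrec₂ compNum :=
  Primrec.nat_add.comp₂ (Primrec.nat_mul.comp₂ (Primrec₂.const 4) Primrec₂.natPair)
    (Primrec₂.const 6)

theorem primrec_precNum : Primrec₂ precNum :=
  Primrec.nat_add.comp₂ (Primrec.nat_mul.comp₂ (Primrec₂.const 4) Primrec₂.natPair)
    (Primrec₂.const 7)

theorem primrec_rfindNum : Primrec rfindNum :=
  Primrec.nat_add.comp (Primrec.nat_mul.comp (Primrec.const 4) Primrec.id) (Primrec.const 8)

namespace Code

/-- A program for the constant function `n`. -/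
def const : ℕ → Code
  | 0 => zero
  | n + 1 => comp succ (const n)

/-- Replace the oracle instruction by the program `d`. -/
def substOracle : Code → Code → Code
  | zero, _ => zero
  | succ, _ => succ
  | left, _ => left
  | right, _ => right
  | oracle, d => d
  | pair a b, d => pair (a.substOracle d) (b.substOracle d)
  | comp a b, d => comp (a.substOracle d) (b.substOracle d)
  | prec a b, d => prec (a.substOracle d) (b.substOracle d)
  | rfind a, d => rfind (a.substOracle d)

variable {g : ℕ → ℕ}

@[simp] theorem eval_const (n x : ℕ) : (const n).eval g x = Part.some n := by
  induction n with
  | zero => rfl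
  | succ n ih => simp [const, eval, ih]

theorem eval_comp_of {c d : Code} {n m : ℕ} (h : d.eval g n = Part.some m) :
    (comp c d).eval g n = c.eval g m := by
  change d.eval g n >>= c.eval g = _
  rw [h]
  exact Part.bind_some _ _

theorem eval_pair_of {c d : Code} {n a b : ℕ} (hc : c.eval g n = Part.some a)
    (hd : d.eval g n = Part.some b) : (pair c d).eval g n = Part.some (Nat.pair a b) := by
  simp [eval, hc, hd, Seq.seq]

/-- Only the oracle instruction sees the oracle, so a program for a total `u` relative to `g` can
stand in for it. All later changes of oracle go through this. -/
theorem eval_substOracle {d : Code} {u : ℕ → ℕ} (hd : ∀ n, d.eval g n = Part.some (u n))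
    (c : Code) : (c.substOracle d).eval g = c.eval u := by
  induction c with
  | zero | succ | left | right => rfl
  | oracle => funext n; exact hd n
  | pair a b ha hb => simp only [substOracle, eval, ha, hb]; rfl
  | comp a b ha hb => simp only [substOracle, eval, ha, hb]; rfl
  | prec a b ha hb => simp only [substOracle, eval, ha, hb]; rfl
  | rfind a ha => simp only [substOracle, eval, ha]; rfl

/-- The link to Mathlib's computability: the program avoids the oracle instruction and is therefore
the same for all `g`. -/
theorem exists_of_partrec {f : ℕ →. ℕ} (hf : Nat.Partrec f) :
    ∃ c : Code, ∀ g, c.eval g = f := by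
  induction hf with
  | zero => exact ⟨zero, fun g => rfl⟩
  | succ => exact ⟨succ, fun g => rfl⟩
  | left => exact ⟨left, fun g => rfl⟩
  | right => exact ⟨right, fun g => rfl⟩
  | pair _ _ h1 h2 =>
    obtain ⟨c, hc⟩ := h1
    obtain ⟨d, hd⟩ := h2
    exact ⟨pair c d, fun g => by simp only [eval, hc, hd]; rfl⟩
  | comp _ _ h1 h2 =>
    obtain ⟨c, hc⟩ := h1
    obtain ⟨d, hd⟩ := h2
    exact ⟨comp c d, fun g => by simp only [eval, hc, hd]; rfl⟩
  | prec _ _ h1 h2 =>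
    obtain ⟨c, hc⟩ := h1
    obtain ⟨d, hd⟩ := h2
    exact ⟨prec c d, fun g => by simp only [eval, hc, hd]; rfl⟩
  | rfind _ h1 =>
    obtain ⟨c, hc⟩ := h1
    exact ⟨rfind c, fun g => by simp only [eval, hc]; rfl⟩

end Code

/-! ### Indices uniform in the oracle: parameters, the recursion theorem, change of oracle -/

theorem phi_num (g : ℕ → ℕ) (c : Code) : phi g c.num = c.eval g := by
  rw [phi, ofNat_num]

/-- `j` is an index of the total function `u` relative to `g`. -/
def IsIndex (g : ℕ → ℕ) (j : ℕ) (u : ℕ → ℕ) : Prop := ∀ n, phi g j n = Part.some (u n)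

theorem exists_index {f : ℕ → ℕ} (hf : Computable f) : ∃ j, ∀ g, IsIndex g j f := by
  obtain ⟨c, hc⟩ := Code.exists_of_partrec (Partrec.nat_iff.1 hf.partrec)
  exact ⟨c.num, fun g n => by rw [phi_num, hc]; rfl⟩

/-- The Gödel number of the constant program. -/
def constNum (n : ℕ) : ℕ := (Code.const n).num

theorem constNum_succ (n : ℕ) : constNum (n + 1) = compNum 1 (constNum n) := rfl

theorem primrec_constNum : Primrec constNum :=
  (Primrec.nat_rec₁ (f := fun _ m => compNum 1 m) 0
    (primrec_compNum.comp₂ (Primrec₂.const 1) Primrec₂.right)).of_eq fun n => by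
    induction n with
    | zero => rfl
    | succ n ih => rw [constNum_succ, ← ih]

theorem isIndex_constNum (g : ℕ → ℕ) (a : ℕ) : IsIndex g (constNum a) fun _ => a := fun n => by
  rw [constNum, phi_num, Code.eval_const]

theorem isIndex_succ (g : ℕ → ℕ) : IsIndex g 1 Nat.succ := fun n => by
  rw [phi, Code.ofNat]; rfl

theorem isIndex_left (g : ℕ → ℕ) : IsIndex g 2 fun n => n.unpair.1 := fun n => by
  rw [phi, Code.ofNat]; rfl

theorem isIndex_right (g : ℕ → ℕ) : IsIndex g 3 fun n => n.unpair.2 := fun n => by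
  rw [phi, Code.ofNat]; rfl

theorem isIndex_oracle (g : ℕ → ℕ) : IsIndex g 4 g := fun n => by
  rw [phi, Code.ofNat]; rfl

theorem phi_compNum (g : ℕ → ℕ) {i j n m : ℕ} (h : phi g j n = Part.some m) :
    phi g (compNum i j) n = phi g i m := by
  rw [phi, ofNat_compNum, Code.eval_comp_of h, phi]

theorem IsIndex.comp {g : ℕ → ℕ} {i j : ℕ} {u v : ℕ → ℕ} (hi : IsIndex g i u)
    (hj : IsIndex g j v) : IsIndex g (compNum i j) fun n => u (v n) := fun n => by
  rw [phi_compNum g (hj n), hi]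

theorem IsIndex.pair {g : ℕ → ℕ} {i j : ℕ} {u v : ℕ → ℕ} (hi : IsIndex g i u)
    (hj : IsIndex g j v) : IsIndex g (pairNum i j) fun n => Nat.pair (u n) (v n) := fun n => by
  rw [phi, ofNat_pairNum, Code.eval_pair_of (hi n) (hj n)]

/-- The index of the function `x ↦ φ_i(⟨a, x⟩)`. -/
def curryNum (i a : ℕ) : ℕ := compNum i (pairNum (constNum a) (pairNum 2 3))

theorem primrec_curryNum : Primrec₂ curryNum :=
  primrec_compNum.comp₂ Primrec₂.left
    (primrec_pairNum.comp₂ (primrec_constNum.comp₂ Primrec₂.right) (Primrec₂.const _))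

theorem phi_curryNum (g : ℕ → ℕ) (i a x : ℕ) :
    phi g (curryNum i a) x = phi g i (Nat.pair a x) := by
  refine phi_compNum g ?_
  have := ((isIndex_constNum g a).pair ((isIndex_left g).pair (isIndex_right g))) x
  simpa using this

theorem IsIndex.curry {g : ℕ → ℕ} {i : ℕ} {u : ℕ → ℕ} (hi : IsIndex g i u) (a : ℕ) :
    IsIndex g (curryNum i a) fun x => u (Nat.pair a x) := fun x => by
  rw [phi_curryNum, hi]

/-- Kleene's recursion theorem for total functions. -/
theorem exists_fixed_index {F : ℕ → ℕ → ℕ} (hF : Computable₂ F) :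
    ∃ i, ∀ g, IsIndex g i (F i) := by
  -- Diagonalization: `d` expects an index as parameter and applies `F` to that index specialized to
  -- itself. Specializing `d` to `d` gives the fixed point.
  obtain ⟨d, hd⟩ := exists_index (f := fun p => F (curryNum p.unpair.1 p.unpair.1) p.unpair.2)
    (hF.comp (primrec_curryNum.to_comp.comp
        (Computable.fst.comp Computable.unpair) (Computable.fst.comp Computable.unpair))
      (Computable.snd.comp Computable.unpair))
  refine ⟨curryNum d d, fun g x => ?_⟩
  rw [phi_curryNum, hd]
  simp

/-- The index obtained by replacing the oracle instruction by the program with index `j`. -/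
def substNum (j e : ℕ) : ℕ := ((Code.ofNat e).substOracle (Code.ofNat j)).num

theorem phi_substNum {g u : ℕ → ℕ} {j : ℕ} (hj : IsIndex g j u) (e : ℕ) :
    phi g (substNum j e) = phi u e := by
  rw [substNum, phi_num, Code.eval_substOracle hj, phi]

theorem substNum_pairNum (j a b : ℕ) :
    substNum j (pairNum a b) = pairNum (substNum j a) (substNum j b) := by
  rw [substNum, ofNat_pairNum]; rfl

theorem substNum_compNum (j a b : ℕ) :
    substNum j (compNum a b) = compNum (substNum j a) (substNum j b) := by
  rw [substNum, ofNat_compNum]; rfl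

theorem substNum_precNum (j a b : ℕ) :
    substNum j (precNum a b) = precNum (substNum j a) (substNum j b) := by
  rw [substNum, ofNat_precNum]; rfl

theorem substNum_rfindNum (j a : ℕ) :
    substNum j (rfindNum a) = rfindNum (substNum j a) := by
  rw [substNum, ofNat_rfindNum]; rfl

theorem substNum_four (j : ℕ) : substNum j 4 = j := by
  rw [substNum, Code.ofNat, Code.substOracle, num_ofNat]

theorem substNum_lt_four (j : ℕ) {e : ℕ} (he : e < 4) : substNum j e = e := by
  interval_cases e <;> (rw [substNum, Code.ofNat]; rfl)

theorem primrec_substNum : Primrec₂ substNum := by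
  -- Course-of-values recursion: `l` lists the values at all smaller arguments, so the current
  -- argument is `l.length`.
  let step : ℕ → List ℕ → ℕ := fun j l =>
    if l.length < 4 then l.length
    else if l.length = 4 then j
    else if (l.length - 5) % 4 = 0 then
      pairNum (l.getD ((l.length - 5) / 4).unpair.1 0) (l.getD ((l.length - 5) / 4).unpair.2 0)
    else if (l.length - 5) % 4 = 1 then
      compNum (l.getD ((l.length - 5) / 4).unpair.1 0) (l.getD ((l.length - 5) / 4).unpair.2 0)
    else if (l.length - 5) % 4 = 2 then
      precNum (l.getD ((l.length - 5) / 4).unpair.1 0) (l.getD ((l.length - 5) / 4).unpair.2 0)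
    else rfindNum (l.getD ((l.length - 5) / 4) 0)
  have hlen : Primrec fun p : ℕ × List ℕ => p.2.length := Primrec.list_length.comp Primrec.snd
  have hm : Primrec fun p : ℕ × List ℕ => (p.2.length - 5) % 4 :=
    Primrec.nat_mod.comp (Primrec.nat_sub.comp hlen (Primrec.const 5)) (Primrec.const 4)
  have hd : Primrec fun p : ℕ × List ℕ => (p.2.length - 5) / 4 :=
    Primrec.nat_div.comp (Primrec.nat_sub.comp hlen (Primrec.const 5)) (Primrec.const 4)
  have hl : Primrec fun p : ℕ × List ℕ => p.2.getD ((p.2.length - 5) / 4).unpair.1 0 :=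
    (Primrec.list_getD 0).comp Primrec.snd (Primrec.fst.comp (Primrec.unpair.comp hd))
  have hr : Primrec fun p : ℕ × List ℕ => p.2.getD ((p.2.length - 5) / 4).unpair.2 0 :=
    (Primrec.list_getD 0).comp Primrec.snd (Primrec.snd.comp (Primrec.unpair.comp hd))
  have hs : Primrec₂ step :=
    Primrec.ite (Primrec.nat_lt.comp hlen (Primrec.const 4)) hlen <|
    Primrec.ite (Primrec.eq.comp hlen (Primrec.const 4)) Primrec.fst <|
    Primrec.ite (Primrec.eq.comp hm (Primrec.const 0)) (primrec_pairNum.comp hl hr) <|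
    Primrec.ite (Primrec.eq.comp hm (Primrec.const 1)) (primrec_compNum.comp hl hr) <|
    Primrec.ite (Primrec.eq.comp hm (Primrec.const 2)) (primrec_precNum.comp hl hr) <|
    primrec_rfindNum.comp ((Primrec.list_getD 0).comp Primrec.snd hd)
  refine Primrec.nat_strong_rec substNum (g := fun j l => some (step j l))
    (Primrec.option_some.comp₂ hs) fun j n => ?_
  have hget : ∀ m < n, ((List.range n).map (substNum j)).getD m 0 = substNum j m := by
    intro m hmn
    simp [List.getD, hmn]
  simp only [step, List.length_map, List.length_range, Option.some.injEq]
  rcases num_cases n with h | ⟨a, b, ha, hb, h⟩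
  · rcases Nat.lt_or_ge n 4 with h4 | h4
    · rw [if_pos h4, substNum_lt_four j h4]
    · obtain rfl : n = 4 := by omega
      rw [if_neg (by omega), if_pos rfl, substNum_four]
  · have hn : 4 < n := by
      rcases h with h | h | h | h <;> rw [h] <;> simp only [pairNum, compNum, precNum, rfindNum] <;>
        omega
    rw [if_neg (by omega), if_neg (by omega)]
    rcases h with h | h | h | h
    · have h1 : (n - 5) % 4 = 0 := by rw [h, pairNum]; omega
      have h2 : (n - 5) / 4 = Nat.pair a b := by rw [h, pairNum]; omega
      rw [if_pos h1, h2, Nat.unpair_pair, hget _ ha, hget _ hb, h, substNum_pairNum]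
    · have h1 : (n - 5) % 4 = 1 := by rw [h, compNum]; omega
      have h2 : (n - 5) / 4 = Nat.pair a b := by rw [h, compNum]; omega
      rw [if_neg (by omega), if_pos h1, h2, Nat.unpair_pair, hget _ ha, hget _ hb, h,
        substNum_compNum]
    · have h1 : (n - 5) % 4 = 2 := by rw [h, precNum]; omega
      have h2 : (n - 5) / 4 = Nat.pair a b := by rw [h, precNum]; omega
      rw [if_neg (by omega), if_neg (by omega), if_pos h1, h2, Nat.unpair_pair, hget _ ha,
        hget _ hb, h, substNum_precNum]
    · have h1 : (n - 5) % 4 = 3 := by rw [h, rfindNum]; omega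
      have h2 : (n - 5) / 4 = a := by rw [h, rfindNum]; omega
      rw [if_neg (by omega), if_neg (by omega), if_neg (by omega), h2, hget _ ha, h,
        substNum_rfindNum]

/-! ## Functionals computed by one program for all oracles -/

/-- `Φ` is a total functional computed by a single program. -/
def OComp (Φ : (ℕ → ℕ) → ℕ → ℕ) : Prop := ∃ j, ∀ g, IsIndex g j (Φ g)

namespace OComp

theorem of_computable {f : ℕ → ℕ} (hf : Computable f) : OComp fun _ => f := exists_index hf

theorem oracle : OComp fun g n => g n := ⟨4, fun g => isIndex_oracle g⟩

theorem comp {Φ Ψ : (ℕ → ℕ) → ℕ → ℕ} (hΦ : OComp Φ) (hΨ : OComp Ψ) :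
    OComp fun g n => Φ g (Ψ g n) := by
  obtain ⟨i, hi⟩ := hΦ
  obtain ⟨j, hj⟩ := hΨ
  exact ⟨compNum i j, fun g => (hi g).comp (hj g)⟩

theorem map₂ {f : ℕ → ℕ → ℕ} (hf : Computable₂ f) {Φ Ψ : (ℕ → ℕ) → ℕ → ℕ} (hΦ : OComp Φ)
    (hΨ : OComp Ψ) : OComp fun g n => f (Φ g n) (Ψ g n) := by
  obtain ⟨i, hi⟩ := hΦ
  obtain ⟨j, hj⟩ := hΨ
  obtain ⟨k, hk⟩ := exists_index (f := fun p => f p.unpair.1 p.unpair.2)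
    (hf.comp (Computable.fst.comp Computable.unpair) (Computable.snd.comp Computable.unpair))
  refine ⟨compNum k (pairNum i j), fun g n => ?_⟩
  rw [(hk g).comp ((hi g).pair (hj g)) n]
  simp

/-- A primitive recursion inside the oracle language. It is needed because the matrix asks an
unbounded, but computable, number of oracle questions about the entries of a list. -/
theorem sum_range {Φ L : (ℕ → ℕ) → ℕ → ℕ} (hΦ : OComp Φ) (hL : OComp L) :
    OComp fun g n => ∑ l ∈ Finset.range (L g n), Φ g (Nat.pair n l) := by
  obtain ⟨i, hi⟩ := hΦ
  obtain ⟨k, hk⟩ := hL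
  -- the step of the recursion, at `⟨n, ⟨l, s⟩⟩`
  have hstep : OComp fun g p => p.unpair.2.unpair.2 +
      Φ g (Nat.pair p.unpair.1 p.unpair.2.unpair.1) := by
    have h1 : Computable fun p : ℕ => p.unpair.2.unpair.2 :=
      (Primrec.snd.comp (Primrec.unpair.comp (Primrec.snd.comp Primrec.unpair))).to_comp
    have h2 : Computable fun p : ℕ => Nat.pair p.unpair.1 p.unpair.2.unpair.1 :=
      (Primrec₂.natPair.comp (Primrec.fst.comp Primrec.unpair)
        (Primrec.fst.comp (Primrec.unpair.comp (Primrec.snd.comp Primrec.unpair)))).to_comp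
    exact map₂ Primrec.nat_add.to_comp (of_computable h1)
      (comp ⟨i, hi⟩ (of_computable h2))
  obtain ⟨d, hd⟩ := hstep
  refine ⟨compNum (precNum 0 d) (pairNum (pairNum 2 3) k), fun g n => ?_⟩
  have h := (((isIndex_left g).pair (isIndex_right g)).pair (hk g)) n
  simp only [Nat.pair_unpair] at h
  rw [phi_compNum g h]
  change _ = Part.some (∑ l ∈ Finset.range (L g n), Φ g (Nat.pair n l))
  clear h
  generalize L g n = m
  induction m with
  | zero =>
    rw [phi, ofNat_precNum, Code.ofNat]
    simp [Code.eval, Nat.unpaired]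
  | succ m ih =>
    rw [phi, ofNat_precNum] at ih ⊢
    simp only [Code.eval, Nat.unpaired, Nat.unpair_pair] at ih ⊢
    rw [ih]
    refine (Part.bind_some _ _).trans ((hd g _).trans ?_)
    simp [Finset.sum_range_succ]

end OComp

/-! ## The jump -/

theorem mem_jump {A : Set ℕ} {e : ℕ} : e ∈ jump A ↔ (phi (charFun A) e e).Dom := Iff.rfl

/-- A uniformly `Σ_1` property relative to `A` is reducible to the jump of `A`, uniformly. -/
theorem jump_search_iff {g : ℕ → ℕ} {j : ℕ} {u : ℕ → ℕ} (hj : IsIndex g j u) (w x : ℕ) :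
    (phi g (compNum (rfindNum j) (constNum w)) x).Dom ↔ ∃ m, u (Nat.pair w m) = 0 := by
  rw [phi_compNum g (isIndex_constNum g w x), phi, ofNat_rfindNum, Code.eval]
  have : ∀ n, (Code.ofNat j).eval g n = Part.some (u n) := hj
  simp only [this]
  refine Nat.rfind_dom.trans ?_
  simp

/-- The search program ignores its input, so the diagonal in the definition of the jump is harmless.
Its index depends on `w` but not on `A`. -/
theorem OComp.exists_jump {Φ : (ℕ → ℕ) → ℕ → ℕ} (hΦ : OComp Φ) :
    ∃ v : ℕ → ℕ, Computable v ∧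
      ∀ A w, v w ∈ jump A ↔ ∃ m, Φ (charFun A) (Nat.pair w m) = 0 := by
  obtain ⟨j, hj⟩ := hΦ
  refine ⟨fun w => compNum (rfindNum j) (constNum w),
    (primrec_compNum.comp (Primrec.const _) primrec_constNum).to_comp, fun A w => ?_⟩
  rw [mem_jump, jump_search_iff (hj _)]

/-- If `j` is an index of a many-one reduction, `jumpMap j` is a many-one reduction of the
jumps. -/
def jumpMap (j e : ℕ) : ℕ := compNum (substNum (compNum 4 j) e) (constNum e)

theorem primrec_jumpMap : Primrec₂ jumpMap :=
  primrec_compNum.comp₂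
    (primrec_substNum.comp₂ (primrec_compNum.comp₂ (Primrec₂.const 4) Primrec₂.left)
      Primrec₂.right)
    (primrec_constNum.comp₂ Primrec₂.right)

theorem charFun_eq_comp {A T : Set ℕ} {u : ℕ → ℕ} (h : ∀ z, z ∈ T ↔ u z ∈ A) :
    charFun T = fun z => charFun A (u z) := by
  funext z
  by_cases hz : z ∈ T
  · simp [charFun, hz, (h z).1 hz]
  · simp [charFun, hz, (h z).not.1 hz]

/-- Program `e` with oracle `T` is simulated with oracle `A` by sending each query through `u`. The
input is frozen to `e`, since the diagonal would otherwise supply the new index. -/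
theorem mem_jump_iff_jumpMap {A T : Set ℕ} {u : ℕ → ℕ} {j : ℕ} (hj : ∀ g, IsIndex g j u)
    (h : ∀ z, z ∈ T ↔ u z ∈ A) (e : ℕ) : e ∈ jump T ↔ jumpMap j e ∈ jump A := by
  rw [mem_jump, mem_jump, jumpMap, phi_compNum _ (isIndex_constNum _ e _),
    phi_substNum ((isIndex_oracle (charFun A)).comp (hj _)), ← charFun_eq_comp h]

theorem exists_jumpIdx : ∃ I : ℕ → ℕ, Computable I ∧ ∀ j g, IsIndex g (I j) (jumpMap j) := by
  obtain ⟨k, hk⟩ := exists_index (f := fun p => jumpMap p.unpair.1 p.unpair.2)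
    (primrec_jumpMap.comp (Primrec.fst.comp Primrec.unpair)
      (Primrec.snd.comp Primrec.unpair)).to_comp
  refine ⟨fun j => curryNum k j, (primrec_curryNum.comp (Primrec.const k) Primrec.id).to_comp,
    fun j g x => ?_⟩
  rw [(hk g).curry j x]
  simp

/-- The fourfold jump on indices of many-one reductions. -/
theorem exists_jumpMap_four : ∃ J : ℕ → ℕ → ℕ, Computable₂ J ∧
    ∀ {A T : Set ℕ} {u : ℕ → ℕ} {j : ℕ}, (∀ g, IsIndex g j u) → (∀ z, z ∈ T ↔ u z ∈ A) →
      ∀ e, e ∈ jump (jump (jump (jump T))) ↔ J j e ∈ jump (jump (jump (jump A))) := by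
  obtain ⟨I, hI, hI'⟩ := exists_jumpIdx
  refine ⟨fun j e => jumpMap (I (I (I j))) e,
    primrec_jumpMap.to_comp.comp
      (hI.comp (hI.comp (hI.comp Computable.fst))) Computable.snd, ?_⟩
  intro A T u j hj h
  exact mem_jump_iff_jumpMap (hI' _) (mem_jump_iff_jumpMap (hI' _)
    (mem_jump_iff_jumpMap (hI' _) (mem_jump_iff_jumpMap hj h)))

/-- A uniformly `Σ_4` property relative to `T` is reducible to the fourth jump of `T`,
uniformly. -/
theorem OComp.exists_jump_four {Φ : (ℕ → ℕ) → ℕ → ℕ} (hΦ : OComp Φ) :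
    ∃ v : ℕ → ℕ, Computable v ∧ ∀ T z, v z ∈ jump (jump (jump (jump T))) ↔
      ∃ a, ∀ b, ∃ c, ∀ d,
        Φ (charFun T) (Nat.pair (Nat.pair (Nat.pair (Nat.pair z a) b) c) d) ≠ 0 := by
  -- Each further jump adds an existential quantifier in front of the complement of the previous
  -- level, so the quantifiers alternate.
  have key : ∀ {v : ℕ → ℕ}, Computable v → ∃ v' : ℕ → ℕ, Computable v' ∧
      ∀ T w, v' w ∈ jump T ↔ ∃ m, v (Nat.pair w m) ∉ T := by
    intro v hv
    obtain ⟨v', hv', h⟩ := (OComp.oracle.comp (of_computable hv)).exists_jump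
    refine ⟨v', hv', fun T w => (h T w).trans ?_⟩
    simp [charFun]
  obtain ⟨v₁, hv₁, h₁⟩ := hΦ.exists_jump
  obtain ⟨v₂, hv₂, h₂⟩ := key hv₁
  obtain ⟨v₃, hv₃, h₃⟩ := key hv₂
  obtain ⟨v₄, hv₄, h₄⟩ := key hv₃
  refine ⟨v₄, hv₄, fun T z => ?_⟩
  simp only [h₄, h₃, h₂, h₁, not_exists, not_not, not_forall, ne_eq]

end OracleComp

/-! ## Kleene's `O` -/

namespace OracleComp

theorem three_mul_five_pow_ne_two_pow (e a : ℕ) : 3 * 5 ^ e ≠ 2 ^ a := by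
  intro h
  have h1 : (3 * 5 ^ e) % 2 = 1 := by
    rw [Nat.mul_mod, Nat.pow_mod]; simp
  rcases a with _ | a
  · have : 0 < 5 ^ e := by positivity
    simp at h
  · rw [h, pow_succ] at h1
    omega

theorem two_pow_inj {a b : ℕ} (h : 2 ^ a = 2 ^ b) : a = b := Nat.pow_right_injective le_rfl h

theorem three_mul_five_pow_inj {a b : ℕ} (h : 3 * 5 ^ a = 3 * 5 ^ b) : a = b :=
  Nat.pow_right_injective (by norm_num : 2 ≤ 5) (Nat.eq_of_mul_eq_mul_left (by norm_num) h)

theorem one_ne_three_mul_five_pow (e : ℕ) : 1 ≠ 3 * 5 ^ e := by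
  have : 0 < 5 ^ e := by positivity
  omega

variable {g : ℕ → ℕ}

theorem IsNotation.ne_zero {a : ℕ} {α : Ordinal.{0}} (h : IsNotation g a α) : a ≠ 0 := by
  cases h <;> positivity

theorem IsNotation.of_one {α : Ordinal.{0}} (h : IsNotation g 1 α) : α = 0 := by
  generalize hb : 1 = b at h
  cases h with
  | one => rfl
  | succ a α h => exact absurd (two_pow_inj (a := 0) hb).symm h.ne_zero
  | lim e f β => exact absurd hb (one_ne_three_mul_five_pow e)

theorem IsNotation.of_two_pow {a : ℕ} {β : Ordinal.{0}} (ha : a ≠ 0)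
    (h : IsNotation g (2 ^ a) β) : ∃ α, IsNotation g a α ∧ β = α + 1 := by
  generalize hb : 2 ^ a = b at h
  cases h with
  | one => exact absurd (two_pow_inj (b := 0) hb) ha
  | succ c α h => exact ⟨α, two_pow_inj hb ▸ h, rfl⟩
  | lim e f β => exact absurd hb.symm (three_mul_five_pow_ne_two_pow _ _)

theorem IsNotation.of_lim {e : ℕ} {α : Ordinal.{0}} (h : IsNotation g (3 * 5 ^ e) α) :
    ∃ (f : ℕ → ℕ) (β : ℕ → Ordinal.{0}), (∀ n, f n ∈ phi g e n) ∧
      (∀ n, NotationLT g (f n) (f (n + 1))) ∧ (∀ n, IsNotation g (f n) (β n)) ∧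
      α = ⨆ n, β n := by
  generalize hb : 3 * 5 ^ e = b at h
  cases h with
  | one => exact absurd hb.symm (one_ne_three_mul_five_pow e)
  | succ c α h => exact absurd hb (three_mul_five_pow_ne_two_pow _ _)
  | lim e' f β h1 h2 h3 =>
    obtain rfl := three_mul_five_pow_inj hb
    exact ⟨f, β, h1, h2, h3, rfl⟩

theorem IsNotation.unique {a : ℕ} {α β : Ordinal.{0}} (h : IsNotation g a α)
    (h' : IsNotation g a β) : α = β := by
  induction h generalizing β with
  | one => exact h'.of_one.symm
  | succ a α h ih =>
    obtain ⟨γ, hγ, rfl⟩ := h'.of_two_pow h.ne_zero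
    rw [ih hγ]
  | lim e f b h1 h2 h3 ih =>
    obtain ⟨f', b', h1', h2', h3', rfl⟩ := h'.of_lim
    congr 1
    funext n
    have : f n = f' n := Part.mem_unique (h1 n) (h1' n)
    exact ih n (this ▸ h3' n)

/-- The immediate predecessors of `b` in the generation of `<_O`. -/
inductive NotationStep (g : ℕ → ℕ) : ℕ → ℕ → Prop
  | succ (a : ℕ) : a ≠ 0 → NotationStep g a (2 ^ a)
  | lim (e n b : ℕ) : b ∈ phi g e n → NotationStep g b (3 * 5 ^ e)

/-- Splitting off the last generating step turns the transitive closure into something that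
induction on the larger notation can use. -/
theorem NotationLT.exists_last {a b : ℕ} (h : NotationLT g a b) :
    ∃ c, NotationStep g c b ∧ (a = c ∨ NotationLT g a c) := by
  induction h with
  | succ a ha => exact ⟨a, .succ a ha, Or.inl rfl⟩
  | lim e n b hb => exact ⟨b, .lim e n b hb, Or.inl rfl⟩
  | trans a b c h1 h2 _ ih =>
    obtain ⟨d, hd, rfl | h⟩ := ih
    · exact ⟨b, hd, Or.inr h1⟩
    · exact ⟨d, hd, Or.inr (h1.trans _ _ _ h)⟩

/-- By induction on `b`: whatever lies below a notation lies below, or equals, an immediate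
predecessor. At limits the predecessors are the members of the fundamental sequence, whose ordinals
stay below the supremum because the sequence increases. -/
theorem IsNotation.exists_lt {b : ℕ} {β : Ordinal.{0}} (hb : IsNotation g b β) :
    ∀ {a : ℕ}, NotationLT g a b → ∃ α < β, IsNotation g a α := by
  induction hb with
  | one =>
    intro a h
    obtain ⟨c, hc, -⟩ := h.exists_last
    generalize hb : 1 = b at hc
    cases hc with
    | succ _ ha => exact absurd (two_pow_inj (a := 0) hb).symm ha
    | lim e => exact absurd hb (one_ne_three_mul_five_pow e)
  | succ b β h ih =>
    intro a hab
    obtain ⟨c, hc, hac⟩ := hab.exists_last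
    have hcb : c = b := by
      generalize hd : 2 ^ b = d at hc
      cases hc with
      | succ _ _ => exact (two_pow_inj hd).symm
      | lim e => exact absurd hd.symm (three_mul_five_pow_ne_two_pow _ _)
    subst hcb
    have hlt : β < β + 1 := by simp
    rcases hac with rfl | hac
    · exact ⟨β, hlt, h⟩
    · obtain ⟨α, hα, h'⟩ := ih hac
      exact ⟨α, hα.trans hlt, h'⟩
  | lim e f β h1 h2 h3 ih =>
    intro a hab
    obtain ⟨c, hc, hac⟩ := hab.exists_last
    obtain ⟨n, rfl⟩ : ∃ n, c = f n := by
      generalize hd : 3 * 5 ^ e = d at hc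
      cases hc with
      | succ _ _ => exact absurd hd (three_mul_five_pow_ne_two_pow _ _)
      | lim e' n b hb =>
        obtain rfl := three_mul_five_pow_inj hd
        exact ⟨n, Part.mem_unique hb (h1 n)⟩
    have hlt : β n < ⨆ n, β n := by
      obtain ⟨α, hα, h'⟩ := ih (n + 1) (h2 n)
      rw [h'.unique (h3 n)] at hα
      exact hα.trans_le (Ordinal.le_iSup β (n + 1))
    rcases hac with rfl | hac
    · exact ⟨β n, hlt, h3 n⟩
    · obtain ⟨α, hα, h'⟩ := ih n hac
      exact ⟨α, hα.trans hlt, h'⟩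

theorem IsNotation.lt {a b : ℕ} {α β : Ordinal.{0}} (ha : IsNotation g a α)
    (hb : IsNotation g b β) (h : NotationLT g a b) : α < β := by
  obtain ⟨γ, hγ, h'⟩ := hb.exists_lt h
  rwa [ha.unique h']

theorem IsNotation.one_le {b : ℕ} {β : Ordinal.{0}} (hb : IsNotation g b β) :
    b = 1 ∨ NotationLT g 1 b := by
  induction hb with
  | one => exact Or.inl rfl
  | succ a α h ih =>
    right
    rcases ih with rfl | ih
    · exact .succ 1 one_ne_zero
    · exact ih.trans _ _ _ (.succ a h.ne_zero)
  | lim e f β h1 h2 h3 ih =>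
    right
    have h := NotationLT.lim e 0 (f 0) (h1 0)
    rcases ih 0 with h0 | h0
    · rwa [h0] at h
    · exact h0.trans _ _ _ h

/-- The ordinals with a notation form an initial segment. -/
theorem IsNotation.exists_of_le {b : ℕ} {β : Ordinal.{0}} (hb : IsNotation g b β) :
    ∀ {α : Ordinal.{0}}, α ≤ β → ∃ a, IsNotation g a α := by
  induction hb with
  | one => intro α h; exact ⟨1, by rw [nonpos_iff_eq_zero.1 h]; exact .one⟩
  | succ a β h ih =>
    intro α hα
    rcases hα.eq_or_lt with rfl | hα
    · exact ⟨_, h.succ a β⟩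
    · exact ih (Order.lt_add_one_iff.1 hα)
  | lim e f β h1 h2 h3 ih =>
    intro α hα
    rcases hα.eq_or_lt with rfl | hα
    · exact ⟨_, .lim e f β h1 h2 h3⟩
    · obtain ⟨n, hn⟩ := (Ordinal.lt_iSup_iff).1 hα
      exact ih n hn.le

theorem exists_isNotation_of_lt_omegaOne {Y : Set ℕ} {α : Ordinal.{0}} (h : α < omegaOne Y) :
    ∃ a, IsNotation (charFun Y) a α := by
  obtain ⟨β, ⟨b, hb⟩, hβ⟩ := exists_lt_of_lt_csSup
    (s := {α | ∃ a, IsNotation (charFun Y) a α}) ⟨0, 1, .one⟩ h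
  exact hb.exists_of_le hβ.le

/-! ## The sets `H_a` -/

theorem IsHSet.ne_zero {a : ℕ} {A : Set ℕ} (h : IsHSet g a A) : a ≠ 0 := by
  cases h <;> positivity

theorem IsHSet.unique {a : ℕ} {A B : Set ℕ} (h : IsHSet g a A) (h' : IsHSet g a B) : A = B := by
  induction h generalizing B with
  | one =>
    generalize hb : 1 = b at h'
    cases h' with
    | one => rfl
    | succ a A h => exact absurd (two_pow_inj (a := 0) hb).symm h.ne_zero
    | lim e => exact absurd hb (one_ne_three_mul_five_pow e)
  | succ a A h ih =>
    generalize hb : 2 ^ a = b at h'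
    cases h' with
    | one => exact absurd (two_pow_inj (b := 0) hb) h.ne_zero
    | succ c C hC =>
      obtain rfl := two_pow_inj hb
      rw [ih hC]
    | lim e => exact absurd hb.symm (three_mul_five_pow_ne_two_pow _ _)
  | lim e f A h1 h2 h3 ih =>
    generalize hb : 3 * 5 ^ e = b at h'
    cases h' with
    | one => exact absurd hb.symm (one_ne_three_mul_five_pow e)
    | succ c C hC => exact absurd hb (three_mul_five_pow_ne_two_pow _ _)
    | lim e' f' A' h1' h2' h3' =>
      obtain rfl := three_mul_five_pow_inj hb
      have : A = A' := by
        funext n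
        have hf : f n = f' n := Part.mem_unique (h1 n) (h1' n)
        exact ih n (hf ▸ h3' n)
      rw [this]

theorem IsHSet.hSet_eq {a : ℕ} {A : Set ℕ} (h : IsHSet g a A) : HSet g a = A := by
  ext x
  constructor
  · rintro ⟨B, hB, hx⟩
    rwa [h.unique hB]
  · exact fun hx => ⟨A, h, hx⟩

end OracleComp

/-! ## Recursion along notations -/

namespace OracleComp

/-- The exponent `b` if `a = 2 ^ b`, otherwise `0`. -/
def predExp (a : ℕ) : ℕ := Nat.findGreatest (fun b => 2 ^ b = a) a

/-- The exponent `e` if `a = 3 * 5 ^ e`, otherwise `0`. -/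
def limExp (a : ℕ) : ℕ := Nat.findGreatest (fun e => 3 * 5 ^ e = a) a

theorem two_pow_predExp {a : ℕ} (h : predExp a ≠ 0) : 2 ^ predExp a = a :=
  Nat.findGreatest_of_ne_zero (P := fun b => 2 ^ b = a) rfl h

theorem predExp_lt {a : ℕ} (h : predExp a ≠ 0) : predExp a < a :=
  calc predExp a < 2 ^ predExp a := Nat.lt_two_pow_self
    _ = a := two_pow_predExp h

theorem predExp_two_pow (b : ℕ) : predExp (2 ^ b) = b :=
  two_pow_inj (Nat.findGreatest_spec (P := fun c => 2 ^ c = 2 ^ b) Nat.lt_two_pow_self.le rfl)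

theorem predExp_lim (e : ℕ) : predExp (3 * 5 ^ e) = 0 := by
  by_contra h
  exact three_mul_five_pow_ne_two_pow _ _ (two_pow_predExp h).symm

theorem limExp_lim (e : ℕ) : limExp (3 * 5 ^ e) = e := by
  have h : e ≤ 3 * 5 ^ e := by
    have := (Nat.lt_pow_self (n := e) (by norm_num : 1 < 5)).le
    omega
  exact three_mul_five_pow_inj
    (Nat.findGreatest_spec (P := fun c => 3 * 5 ^ c = 3 * 5 ^ e) h rfl)

theorem primrec_pow (b : ℕ) : Primrec fun n : ℕ => b ^ n :=
  (Primrec.nat_rec₁ (f := fun _ m => m * b) 1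
    (Primrec.nat_mul.comp₂ Primrec₂.right (Primrec₂.const b))).of_eq fun n => by
    induction n with
    | zero => rfl
    | succ n ih => rw [pow_succ, ← ih]

theorem primrec_predExp : Primrec predExp :=
  Primrec.nat_findGreatest Primrec.id
    (Primrec.eq.comp₂ ((primrec_pow 2).comp₂ Primrec₂.right) Primrec₂.left)

theorem primrec_lim : Primrec fun e : ℕ => 3 * 5 ^ e :=
  Primrec.nat_mul.comp (Primrec.const 3) (primrec_pow 5)

theorem primrec_limExp : Primrec limExp :=
  Primrec.nat_findGreatest Primrec.id
    (Primrec.eq.comp₂ (primrec_lim.comp₂ Primrec₂.right) Primrec₂.left)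

theorem one_sub_charFun {A : Set ℕ} {x : ℕ} : 1 - charFun A x = 0 ↔ x ∈ A := by
  by_cases h : x ∈ A <;> simp [charFun, h]

theorem computable_ite {α σ : Type*} [Primcodable α] [Primcodable σ] {c : α → Prop}
    [DecidablePred c] {f k : α → σ} (hc : PrimrecPred c) (hf : Computable f)
    (hk : Computable k) : Computable fun a => if c a then f a else k a :=
  (Computable.cond hc.decide.to_comp hf hk).of_eq fun a => by by_cases h : c a <;> simp [h]

/-- The function on notations with `a ↦ 2^2^2^2^a` at successors and with the index function `L`
at limits. -/
def towerMap (L : ℕ → ℕ → ℕ) (i a : ℕ) : ℕ :=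
  if h : predExp a ≠ 0 then
    have := predExp_lt h
    2 ^ 2 ^ 2 ^ 2 ^ towerMap L i (predExp a)
  else if 3 * 5 ^ limExp a = a then 3 * 5 ^ L i (limExp a) else 1

theorem primrec_towerMap {L : ℕ → ℕ → ℕ} (hL : Primrec₂ L) : Primrec₂ (towerMap L) := by
  let step : ℕ → List ℕ → ℕ := fun i l =>
    if predExp l.length ≠ 0 then 2 ^ 2 ^ 2 ^ 2 ^ l.getD (predExp l.length) 0
    else if 3 * 5 ^ limExp l.length = l.length then 3 * 5 ^ L i (limExp l.length) else 1
  have hlen : Primrec fun p : ℕ × List ℕ => p.2.length := Primrec.list_length.comp Primrec.snd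
  have hpow := primrec_pow 2
  have hs : Primrec₂ step :=
    Primrec.ite (Primrec.eq.comp (primrec_predExp.comp hlen) (Primrec.const 0)).not
      (hpow.comp <| hpow.comp <| hpow.comp <| hpow.comp <|
        (Primrec.list_getD 0).comp Primrec.snd (primrec_predExp.comp hlen)) <|
    Primrec.ite (Primrec.eq.comp (primrec_lim.comp (primrec_limExp.comp hlen)) hlen)
      (primrec_lim.comp (hL.comp Primrec.fst (primrec_limExp.comp hlen))) (Primrec.const 1)
  refine Primrec.nat_strong_rec (towerMap L) (g := fun j l => some (step j l))
    (Primrec.option_some.comp₂ hs) fun i n => ?_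
  simp only [step, List.length_map, List.length_range, Option.some.injEq]
  rw [towerMap]
  by_cases h : predExp n ≠ 0
  · rw [if_pos h, dif_pos h]
    simp [List.getD, predExp_lt h]
  · rw [if_neg h, dif_neg h]

theorem join_two_mul (Y : Set ℕ) (X : ℕ → ℕ) (n : ℕ) : join Y X (2 * n) = charFun Y n := by
  simp [join]

theorem join_two_mul_add_one (Y : Set ℕ) (X : ℕ → ℕ) (n : ℕ) : join Y X (2 * n + 1) = X n := by
  have : (2 * n + 1) / 2 = n := by omega
  simp [join, this]

/-- `h` maps the notations in `O^Y` to notations in all `O^{Y ⊕ X}`, multiplying ordinals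
by `4`; the fundamental sequences of limit notations begin with `1` and then have values
`2 ^ h b`. -/
structure IsNotationMap (h L : ℕ → ℕ) : Prop where
  one : h 1 = 1
  succ : ∀ a ≠ 0, h (2 ^ a) = 2 ^ 2 ^ 2 ^ 2 ^ h a
  lim : ∀ e, h (3 * 5 ^ e) = 3 * 5 ^ L e
  ne_zero : ∀ a, h a ≠ 0
  phi_zero : ∀ (Y : Set ℕ) (X : ℕ → ℕ) (e m : ℕ), m ∈ phi (charFun Y) e 0 →
    phi (join Y X) (L e) 0 = Part.some 1
  phi_succ : ∀ (Y : Set ℕ) (X : ℕ → ℕ) (e n m : ℕ), m ∈ phi (charFun Y) e n →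
    phi (join Y X) (L e) (n + 1) = Part.some (2 ^ h m)

/-- The map has to know an index of itself in order to write down fundamental sequences of limit
notations; the recursion theorem provides it. The indices do not mention `X`, because `Y` is
recovered from `Y ⊕ X` by one fixed program. -/
theorem exists_isNotationMap : ∃ h L, IsNotationMap h L := by
  obtain ⟨k, hk⟩ := OComp.oracle.comp (OComp.of_computable Primrec.nat_double.to_comp)
  obtain ⟨p, hp⟩ := OComp.of_computable Primrec.pred.to_comp
  have hq' : Computable fun w : ℕ => if w.unpair.1 = 0 then 1 else 2 ^ w.unpair.2 :=
    (Primrec.ite (Primrec.eq.comp (Primrec.fst.comp Primrec.unpair) (Primrec.const 0))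
      (Primrec.const 1) ((primrec_pow 2).comp (Primrec.snd.comp Primrec.unpair))).to_comp
  obtain ⟨q, hq⟩ := OComp.of_computable hq'
  -- The program sends `0` to `1`, and `n + 1` to `2 ^ h (φ_e^Y(n))`, where `i` is to be an index of
  -- `h` and `k` computes `Y` from the oracle.
  let L : ℕ → ℕ → ℕ := fun i e =>
    compNum q (pairNum (pairNum 2 3) (compNum i (compNum (substNum k e) p)))
  have hL : Primrec₂ L :=
    primrec_compNum.comp₂ (Primrec₂.const q) <| primrec_pairNum.comp₂ (Primrec₂.const _) <|
    primrec_compNum.comp₂ Primrec₂.left <| primrec_compNum.comp₂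
      (primrec_substNum.comp₂ (Primrec₂.const k) Primrec₂.right) (Primrec₂.const p)
  obtain ⟨i, hi⟩ := exists_fixed_index (primrec_towerMap hL).to_comp
  have key : ∀ (Y : Set ℕ) (X : ℕ → ℕ) (e n m : ℕ), m ∈ phi (charFun Y) e n.pred →
      phi (join Y X) (L i e) n = Part.some (if n = 0 then 1 else 2 ^ towerMap L i m) := by
    intro Y X e n m hm
    have h0 : IsIndex (join Y X) k (charFun Y) := by
      have := hk (join Y X)
      simp only [join_two_mul] at this
      exact this
    have h1 : phi (join Y X) (compNum (substNum k e) p) n = Part.some m := by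
      rw [phi_compNum _ (hp _ n), phi_substNum h0]
      exact Part.eq_some_iff.2 hm
    have h2 : phi (join Y X) (compNum i (compNum (substNum k e) p)) n
        = Part.some (towerMap L i m) := by
      rw [phi_compNum _ h1, hi]
    have h3 : phi (join Y X)
        (pairNum (pairNum 2 3) (compNum i (compNum (substNum k e) p))) n
        = Part.some (Nat.pair n (towerMap L i m)) := by
      have h4 : phi (join Y X) (pairNum 2 3) n = Part.some n := by
        simpa using (isIndex_left (join Y X)).pair (isIndex_right _) n
      rw [phi, ofNat_pairNum]
      exact Code.eval_pair_of h4 h2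
    rw [phi_compNum _ h3, hq]
    simp
  refine ⟨towerMap L i, L i, ⟨?_, ?_, ?_, ?_, ?_, ?_⟩⟩
  · rw [towerMap, dif_neg (by rw [show (1 : ℕ) = 2 ^ 0 from rfl, predExp_two_pow]; simp),
      if_neg (one_ne_three_mul_five_pow _).symm]
  · intro a ha
    rw [towerMap, dif_pos (by rwa [predExp_two_pow])]
    change 2 ^ 2 ^ 2 ^ 2 ^ towerMap L i (predExp (2 ^ a)) = _
    rw [predExp_two_pow]
  · intro e
    rw [towerMap, dif_neg (by simp [predExp_lim]), limExp_lim, if_pos rfl]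
  · intro a
    rw [towerMap]
    split_ifs <;> positivity
  · intro Y X e m hm
    rw [key Y X e 0 m hm, if_pos rfl]
  · intro Y X e n m hm
    rw [key Y X e (n + 1) m hm, if_neg (Nat.succ_ne_zero n)]

theorem IsNotation.four_succ {g : ℕ → ℕ} {a : ℕ} {α : Ordinal.{0}}
    (h : IsNotation g a (4 * α)) : IsNotation g (2 ^ 2 ^ 2 ^ 2 ^ a) (4 * (α + 1)) := by
  have : (4 : Ordinal.{0}) * (α + 1) = 4 * α + 1 + 1 + 1 + 1 := by
    rw [mul_add, mul_one, add_assoc, add_assoc, add_assoc]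
    congr 1
    norm_num
  rw [this]
  exact .succ _ _ (.succ _ _ (.succ _ _ (.succ _ _ h)))

namespace IsNotationMap

variable {h L : ℕ → ℕ} {Y : Set ℕ} {X : ℕ → ℕ}

/-- A step of `<_O` becomes four successors or a limit, so there is room for the extra exponential
that the fundamental sequences of the image carry. -/
theorem notationLT (hh : IsNotationMap h L) {a b : ℕ} (hab : NotationLT (charFun Y) a b) :
    2 ^ h a = h b ∨ NotationLT (join Y X) (2 ^ h a) (h b) := by
  have hpos : ∀ a, (2 : ℕ) ^ a ≠ 0 := fun a => by positivity
  induction hab with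
  | succ a ha =>
    right
    rw [hh.succ a ha]
    exact (NotationLT.succ _ (hpos _)).trans _ _ _
      ((NotationLT.succ _ (hpos _)).trans _ _ _ (.succ _ (hpos _)))
  | lim e n b hb =>
    right
    rw [hh.lim]
    exact .lim _ (n + 1) _ (by rw [hh.phi_succ Y X e n b hb]; exact Part.mem_some _)
  | trans a b c _ _ h1 h2 =>
    right
    have h3 := NotationLT.succ (g := join Y X) _ (hh.ne_zero b)
    have h4 : NotationLT (join Y X) (2 ^ h a) (2 ^ h b) := by
      rcases h1 with h1 | h1
      · rwa [h1]
      · exact h1.trans _ _ _ h3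
    rcases h2 with h2 | h2
    · rwa [← h2]
    · exact h4.trans _ _ _ h2

/-- The fundamental sequence of the image of a limit notation. -/
def seq (h f : ℕ → ℕ) : ℕ → ℕ
  | 0 => 1
  | n + 1 => 2 ^ h (f n)

theorem seq_mem (hh : IsNotationMap h L) {e : ℕ} {f : ℕ → ℕ}
    (hf : ∀ n, f n ∈ phi (charFun Y) e n) (n : ℕ) : seq h f n ∈ phi (join Y X) (L e) n := by
  cases n with
  | zero => rw [hh.phi_zero Y X e _ (hf 0)]; exact Part.mem_some _
  | succ n => rw [hh.phi_succ Y X e n _ (hf n)]; exact Part.mem_some _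

/-- At limits, inserting `0` and replacing `4 β_n` by `4 β_n + 1` leaves the supremum unchanged,
because `4 β_n + 1 ≤ 4 β_(n+1)`. -/
theorem isNotation (hh : IsNotationMap h L) {a : ℕ} {α : Ordinal.{0}}
    (ha : IsNotation (charFun Y) a α) : IsNotation (join Y X) (h a) (4 * α) := by
  induction ha with
  | one => rw [hh.one, mul_zero]; exact .one
  | succ a α h1 ih =>
    rw [hh.succ a h1.ne_zero]
    exact ih.four_succ
  | lim e f β h1 h2 h3 ih =>
    let β' : ℕ → Ordinal.{0} := fun n => Nat.casesOn n 0 fun n => 4 * β n + 1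
    have hlt : ∀ n, β n < β (n + 1) := fun n => (h3 n).lt (h3 (n + 1)) (h2 n)
    have hsup : 4 * (⨆ n, β n) = ⨆ n, β' n := by
      have h4 : (0 : Ordinal.{0}) < 4 := by norm_num
      rw [(Ordinal.isNormal_mul_right h4).map_iSup Ordinal.bddAbove_of_small]
      apply le_antisymm
      · refine Ordinal.iSup_le fun n => ?_
        exact (le_self_add : 4 * β n ≤ 4 * β n + 1).trans (Ordinal.le_iSup β' (n + 1))
      · refine Ordinal.iSup_le fun n => ?_
        cases n with
        | zero => exact zero_le
        | succ n =>
          refine le_trans ?_ (Ordinal.le_iSup (fun n => 4 * β n) (n + 1))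
          exact Order.add_one_le_of_lt ((mul_lt_mul_iff_right₀ h4).2 (hlt n))
    rw [hh.lim, hsup]
    refine .lim (L e) (seq h f) β' (hh.seq_mem h1) ?_ ?_
    · intro n
      cases n with
      | zero =>
        have h4 := NotationLT.succ (g := join Y X) _ (hh.ne_zero (f 0))
        rcases (ih 0).one_le with h5 | h5
        · rw [h5] at h4
          simpa only [seq, h5] using h4
        · exact h5.trans _ _ _ h4
      | succ n =>
        have h4 := NotationLT.succ (g := join Y X) _ (hh.ne_zero (f (n + 1)))
        rcases hh.notationLT (X := X) (h2 n) with h5 | h5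
        · rw [← h5] at h4
          simpa only [seq, ← h5] using h4
        · exact h5.trans _ _ _ h4
    · intro n
      cases n with
      | zero => exact .one
      | succ n => exact .succ _ _ (ih n)

end IsNotationMap

/-- The graph of `g`, which is the set `H_1^g`. -/
def graph (g : ℕ → ℕ) : Set ℕ := {x | g x.unpair.1 = x.unpair.2}

theorem pair_mem_graph {g : ℕ → ℕ} {n m : ℕ} : Nat.pair n m ∈ graph g ↔ g n = m := by
  simp [graph]

/-- The properties of a sequence of sets in which `T 0` is trivial apart from giving access to
`g`, and each `T (α + 1)` is reduced to the fourth jump of `T α` by `v`. -/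
structure IsJumpHierarchy (v : ℕ → ℕ) (g : ℕ → ℕ) (T : Ordinal.{0} → Set ℕ) : Prop where
  zero : ∀ z, z ∈ T 0 ↔ z % 2 = 1 ∧ z / 2 ∈ graph g
  succ : ∀ α z, z ∈ T (α + 1) ↔ v z ∈ jump (jump (jump (jump (T α))))
  lim : ∀ β : ℕ → Ordinal.{0}, StrictMono β → ∀ z, z ∈ T (⨆ n, β n) ↔ ∃ n, z ∈ T (β n)

/-- The uniform reductions along notations. -/
theorem exists_uniform_reduction {v : ℕ → ℕ} (hv : Computable v) {h L : ℕ → ℕ}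
    (hh : IsNotationMap h L) : ∃ u : ℕ → ℕ → ℕ,
      ∀ (Y : Set ℕ) (X : ℕ → ℕ) (T : Ordinal.{0} → Set ℕ), IsJumpHierarchy v (join Y X) T →
        ∀ (a : ℕ) (α : Ordinal.{0}), IsNotation (charFun Y) a α →
          ∃ A, IsHSet (join Y X) (h a) A ∧ ∀ z, z ∈ T α ↔ u a z ∈ jump A := by
  obtain ⟨J, hJ, hJ'⟩ := exists_jumpMap_four
  -- the base
  have hdiv : Computable fun w : ℕ => w.unpair.1 / 2 :=
    (Primrec.nat_div.comp (Primrec.fst.comp Primrec.unpair) (Primrec.const 2)).to_comp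
  have hbase' : Computable₂ fun w y : ℕ => if w.unpair.1 % 2 = 1 then 1 - y else 1 :=
    (Primrec.ite (Primrec.eq.comp (Primrec.nat_mod.comp
        (Primrec.fst.comp (Primrec.unpair.comp Primrec.fst)) (Primrec.const 2)) (Primrec.const 1))
      (Primrec.nat_sub.comp (Primrec.const 1) Primrec.snd) (Primrec.const 1)).to_comp
  obtain ⟨v₀, hv₀, hbase⟩ := (OComp.map₂ hbase' (OComp.of_computable Computable.id)
    (OComp.oracle.comp (OComp.of_computable hdiv))).exists_jump
  -- the limit step
  have hq' : Computable fun x : ℕ => Nat.pair 0 (Nat.pair (2 * x) 1) :=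
    (Primrec₂.natPair.comp (Primrec.const 0)
      (Primrec₂.natPair.comp Primrec.nat_double (Primrec.const 1))).to_comp
  obtain ⟨q, hq⟩ := OComp.oracle.comp (OComp.of_computable hq')
  obtain ⟨r, hr⟩ := OComp.of_computable
    (Primrec.nat_sub.comp (Primrec.const 1) (Primrec.id (α := ℕ))).to_comp
  -- On `⟨z, m⟩` this program asks column `m + 1` of the limit set about the reduction of `z` at the
  -- `m`-th term of the fundamental sequence. A positive answer is turned into `0`, so that an
  -- unbounded search detects it.
  let S : ℕ → ℕ → ℕ := fun i e => compNum r (compNum 4 (pairNum (compNum 1 3)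
    (compNum i (pairNum (compNum (substNum q e) 3) 2))))
  have hS : Primrec₂ S :=
    primrec_compNum.comp₂ (Primrec₂.const r) <| primrec_compNum.comp₂ (Primrec₂.const 4) <|
    primrec_pairNum.comp₂ (Primrec₂.const _) <| primrec_compNum.comp₂ Primrec₂.left <|
    primrec_pairNum.comp₂ (primrec_compNum.comp₂
      (primrec_substNum.comp₂ (Primrec₂.const q) Primrec₂.right) (Primrec₂.const 3))
      (Primrec₂.const 2)
  -- On `w = ⟨a, z⟩` this is the reduction for the notation `a`, built by cases on `a` from the
  -- reductions at smaller notations, which are reached through their index `curryNum i _`.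
  let F : ℕ → ℕ → ℕ := fun i w =>
    if w.unpair.1 = 2 ^ predExp w.unpair.1 ∧ predExp w.unpair.1 ≠ 0 then
      J (curryNum i (predExp w.unpair.1)) (v w.unpair.2)
    else if w.unpair.1 = 3 * 5 ^ limExp w.unpair.1 then
      compNum (rfindNum (S i (limExp w.unpair.1))) (constNum w.unpair.2)
    else v₀ w.unpair.2
  have hF : Computable₂ F := by
    have ha : Primrec fun p : ℕ × ℕ => p.2.unpair.1 :=
      Primrec.fst.comp (Primrec.unpair.comp Primrec.snd)
    have hz : Primrec fun p : ℕ × ℕ => p.2.unpair.2 :=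
      Primrec.snd.comp (Primrec.unpair.comp Primrec.snd)
    have hpe := primrec_predExp.comp ha
    have hle := primrec_limExp.comp ha
    exact computable_ite ((Primrec.eq.comp ha ((primrec_pow 2).comp hpe)).and
        (Primrec.eq.comp hpe (Primrec.const 0)).not)
      (hJ.comp (primrec_curryNum.comp Primrec.fst hpe).to_comp (hv.comp hz.to_comp)) <|
      computable_ite (Primrec.eq.comp ha (primrec_lim.comp hle))
      (primrec_compNum.comp (primrec_rfindNum.comp (hS.comp Primrec.fst hle))
        (primrec_constNum.comp hz)).to_comp (hv₀.comp hz.to_comp)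
  obtain ⟨i, hi⟩ := exists_fixed_index hF
  have hu : ∀ a g, IsIndex g (curryNum i a) fun z => F i (Nat.pair a z) :=
    fun a g => (hi g).curry a
  refine ⟨fun a z => F i (Nat.pair a z), fun Y X T hT a α ha => ?_⟩
  induction ha with
  | one =>
    rw [hh.one]
    refine ⟨_, .one, fun z => ?_⟩
    have h1 : F i (Nat.pair 1 z) = v₀ z := by
      have h2 : predExp 1 = 0 := predExp_two_pow 0
      simp [F, h2, one_ne_three_mul_five_pow]
    change _ ↔ F i (Nat.pair 1 z) ∈ _
    rw [h1, hbase, hT.zero]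
    by_cases hz : z % 2 = 1
    · simp only [hz, true_and, Nat.unpair_pair, id, if_true, one_sub_charFun, exists_const]
      rfl
    · simp [hz]
  | succ a α h1 ih =>
    obtain ⟨A, hA, hA'⟩ := ih
    rw [hh.succ a h1.ne_zero]
    refine ⟨_, .succ _ _ (.succ _ _ (.succ _ _ (.succ _ _ hA))), fun z => ?_⟩
    have h2 : F i (Nat.pair (2 ^ a) z) = J (curryNum i a) (v z) := by
      simp [F, predExp_two_pow, h1.ne_zero]
    change _ ↔ F i (Nat.pair (2 ^ a) z) ∈ _
    rw [h2, hT.succ]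
    -- The fourth jump of `jump A` is also the jump of the fourth jump of `A`, so the single extra
    -- jump is carried along and does not accumulate.
    exact hJ' (hu a) hA' _
  | lim e f β h1 h2 h3 ih =>
    choose A hA hA' using ih
    -- The columns of the limit set: column `0` is the oracle itself, from which the fundamental
    -- sequence of `e` can be recomputed; the others are the jumps that the earlier reductions map
    -- into.
    let B : ℕ → Set ℕ := fun n => Nat.casesOn n (graph (join Y X)) fun n => jump (A n)
    rw [hh.lim]
    refine ⟨{x | x.unpair.2 ∈ B x.unpair.1}, .lim (L e) (IsNotationMap.seq h f) B
      (hh.seq_mem h1) ?_ ?_, fun z => ?_⟩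
    · have := hh.isNotation (X := X) (IsNotation.lim e f β h1 h2 h3)
      rw [hh.lim] at this
      obtain ⟨f', _, hf', hlt, _⟩ := this.of_lim
      intro n
      rw [Part.mem_unique (hh.seq_mem h1 n) (hf' n),
        Part.mem_unique (hh.seq_mem h1 (n + 1)) (hf' (n + 1))]
      exact hlt n
    · intro n
      cases n with
      | zero => exact .one
      | succ n => exact .succ _ _ (hA n)
    · have h4 : F i (Nat.pair (3 * 5 ^ e) z)
          = compNum (rfindNum (S i e)) (constNum z) := by
        simp [F, predExp_lim, limExp_lim]
      set C : Set ℕ := {x | x.unpair.2 ∈ B x.unpair.1} with hC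
      have h5 : IsIndex (charFun C) q (charFun Y) := by
        intro x
        rw [hq]
        congr 1
        -- `Y` is read off column `0`, at the even places of `Y ⊕ X`.
        have : Nat.pair 0 (Nat.pair (2 * x) 1) ∈ C ↔ x ∈ Y := by
          simp only [hC, Set.mem_ofPred_eq, Nat.unpair_pair, B]
          change Nat.pair (2 * x) 1 ∈ graph (join Y X) ↔ _
          rw [pair_mem_graph, join_two_mul]
          simp [charFun]
        by_cases hx : x ∈ Y
        · simp [charFun, hx, this]
        · simp [charFun, hx, this]
      have h6 : IsIndex (charFun C) (compNum (substNum q e) 3) fun w => f w.unpair.2 := by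
        intro w
        rw [phi_compNum _ (isIndex_right _ w), phi_substNum h5]
        exact Part.eq_some_iff.2 (h1 _)
      have h7 : IsIndex (charFun C) (S i e) fun w => 1 - charFun C (Nat.pair (w.unpair.2 + 1)
          (F i (Nat.pair (f w.unpair.2) w.unpair.1))) :=
        (hr _).comp ((isIndex_oracle _).comp
          (((isIndex_succ _).comp (isIndex_right _)).pair
            ((hi _).comp (h6.pair (isIndex_left _)))))
      change _ ↔ F i (Nat.pair (3 * 5 ^ e) z) ∈ _
      rw [h4, mem_jump, jump_search_iff h7, hT.lim β (strictMono_nat_of_lt_succ fun n =>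
        (h3 n).lt (h3 (n + 1)) (h2 n))]
      refine exists_congr fun m => (hA' m z).trans ?_
      have h8 : Nat.pair (m + 1) (F i (Nat.pair (f m) z)) ∈ C ↔
          F i (Nat.pair (f m) z) ∈ jump (A m) := by
        simp only [hC, Set.mem_ofPred_eq, Nat.unpair_pair, B]
      rw [← h8]
      simp only [Nat.unpair_pair]
      exact one_sub_charFun.symm

/-- The reductions at finite levels. -/
theorem exists_finite_reduction {v : ℕ → ℕ} (hv : Computable v) (n : ℕ) :
    ∃ (a : ℕ) (u : ℕ → ℕ), Computable u ∧ ∀ g : ℕ → ℕ, g 0 ≤ 1 →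
      IsNotation g a (4 * (n : Ordinal.{0})) ∧
      ∀ T : Ordinal.{0} → Set ℕ, IsJumpHierarchy v g T →
        ∃ A, IsHSet g a A ∧ ∀ z, z ∈ T n ↔ u z ∈ A := by
  obtain ⟨J, hJ, hJ'⟩ := exists_jumpMap_four
  induction n with
  | zero =>
    -- Even numbers are not in `T 0` and must be sent outside the graph: since `g 0 ≤ 1`, the pair
    -- `(0, 2)` is never in it.
    refine ⟨1, fun z => if z % 2 = 1 then z / 2 else Nat.pair 0 2, ?_, fun g hg => ⟨?_, ?_⟩⟩
    · exact computable_ite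
        (Primrec.eq.comp (Primrec.nat_mod.comp Primrec.id (Primrec.const 2)) (Primrec.const 1))
        (Primrec.nat_div.comp Primrec.id (Primrec.const 2)).to_comp (Computable.const _)
    · rw [Nat.cast_zero, mul_zero]
      exact .one
    · intro T hT
      refine ⟨graph g, .one, fun z => ?_⟩
      rw [Nat.cast_zero, hT.zero]
      by_cases hz : z % 2 = 1
      · simp [hz]
      · have : ¬ g 0 = 2 := by omega
        simp [hz, pair_mem_graph, this]
  | succ n ih =>
    obtain ⟨a, u, hu, h⟩ := ih
    obtain ⟨j, hj⟩ := exists_index hu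
    refine ⟨2 ^ 2 ^ 2 ^ 2 ^ a, fun z => J j (v z), hJ.comp (Computable.const j) hv,
      fun g hg => ⟨?_, ?_⟩⟩
    · rw [Nat.cast_succ]
      exact (h g hg).1.four_succ
    · intro T hT
      obtain ⟨A, hA, hA'⟩ := (h g hg).2 T hT
      refine ⟨_, .succ _ _ (.succ _ _ (.succ _ _ (.succ _ _ hA))), fun z => ?_⟩
      rw [Nat.cast_succ, hT.succ]
      exact hJ' hj hA' _

/-- The split at `ω` mirrors the definition of `Σ^0_β`. Since `4α < ω` exactly when `α < ω`, finite
stages use the reduction to `H_a`, and infinite ones the reduction to its jump. -/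
theorem exists_index_of_isJumpHierarchy {v : ℕ → ℕ} (hv : Computable v) {Y : Set ℕ}
    {α : Ordinal.{0}} (hα : α < omegaOne Y) (z : ℕ) :
    ∃ e₀ a : ℕ, ∀ X : ℕ → ℕ, IsNotation (join Y X) a (4 * α) ∧
      ∀ T : Ordinal.{0} → Set ℕ, IsJumpHierarchy v (join Y X) T →
        (z ∈ T α ↔ e₀ ∈ HSet (join Y X) (if 4 * α < Ordinal.omega0 then a else 2 ^ a)) := by
  rcases lt_or_ge α Ordinal.omega0 with hfin | hinf
  · obtain ⟨n, rfl⟩ := Ordinal.lt_omega0.1 hfin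
    obtain ⟨a, u, -, h⟩ := exists_finite_reduction hv n
    have hlt : 4 * (n : Ordinal.{0}) < Ordinal.omega0 := by
      exact_mod_cast Ordinal.natCast_lt_omega0 (4 * n)
    refine ⟨u z, a, fun X => ?_⟩
    have hg : join Y X 0 ≤ 1 := by
      have := join_two_mul Y X 0
      rw [mul_zero] at this
      rw [this, charFun]
      split_ifs <;> simp
    refine ⟨(h _ hg).1, fun T hT => ?_⟩
    obtain ⟨A, hA, hA'⟩ := (h _ hg).2 T hT
    rw [if_pos hlt, hA.hSet_eq, hA']
  · obtain ⟨k, L, hh⟩ := exists_isNotationMap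
    obtain ⟨u, hu⟩ := exists_uniform_reduction hv hh
    obtain ⟨b, hb⟩ := exists_isNotation_of_lt_omegaOne hα
    have hle : ¬ 4 * α < Ordinal.omega0 :=
      not_lt.2 (hinf.trans (le_mul_of_one_le_left' (by norm_num)))
    refine ⟨u b z, k b, fun X => ⟨hh.isNotation hb, fun T hT => ?_⟩⟩
    obtain ⟨A, hA, hA'⟩ := hu Y X T hT b α hb
    rw [if_neg hle, (hA.succ _ _).hSet_eq, hA']

end OracleComp

/-! ## The arithmetical matrix of the derivation step -/

namespace Denjoy

open OracleComp

/-- The real number `(a - b) / (c + 1)` coded by a triple. -/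
noncomputable def ratVal (r : ℕ × ℕ × ℕ) : ℝ := ((r.1 : ℝ) - r.2.1) / (r.2.2 + 1)

/-- The triple coding `ratOfNat m`. -/
def ratCode (m : ℕ) : ℕ × ℕ × ℕ := (m.unpair.1.unpair.1, m.unpair.1.unpair.2, m.unpair.2)

/-- Addition on triples. -/
def ratAdd (r r' : ℕ × ℕ × ℕ) : ℕ × ℕ × ℕ :=
  (r.1 * (r'.2.2 + 1) + r'.1 * (r.2.2 + 1), r.2.1 * (r'.2.2 + 1) + r'.2.1 * (r.2.2 + 1),
    r.2.2 * r'.2.2 + r.2.2 + r'.2.2)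

/-- Negation on triples. -/
def ratNeg (r : ℕ × ℕ × ℕ) : ℕ × ℕ × ℕ := (r.2.1, r.1, r.2.2)

/-- The absolute value on triples. -/
def ratAbs (r : ℕ × ℕ × ℕ) : ℕ × ℕ × ℕ := (max r.1 r.2.1, min r.1 r.2.1, r.2.2)

/-- Multiplication of a triple by a natural number. -/
def ratScale (w : ℕ) (r : ℕ × ℕ × ℕ) : ℕ × ℕ × ℕ := (w * r.1, w * r.2.1, r.2.2)

/-- Sums of triples. -/
def ratSum (l : List (ℕ × ℕ × ℕ)) : ℕ × ℕ × ℕ := l.foldr ratAdd (0, 0, 0)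

theorem ratVal_ratCode (m : ℕ) : ratVal (ratCode m) = (ratOfNat m : ℝ) := by
  simp [ratVal, ratCode, ratOfNat]

theorem ratVal_ratAdd (r r' : ℕ × ℕ × ℕ) : ratVal (ratAdd r r') = ratVal r + ratVal r' := by
  have h1 : (r.2.2 : ℝ) + 1 ≠ 0 := by positivity
  have h2 : (r'.2.2 : ℝ) + 1 ≠ 0 := by positivity
  have h3 : (r.2.2 : ℝ) * r'.2.2 + r.2.2 + r'.2.2 + 1 = (r.2.2 + 1) * (r'.2.2 + 1) := by ring
  simp only [ratVal, ratAdd]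
  push_cast
  rw [h3]
  field_simp
  ring

theorem ratVal_ratNeg (r : ℕ × ℕ × ℕ) : ratVal (ratNeg r) = - ratVal r := by
  simp only [ratVal, ratNeg]
  ring

theorem ratVal_ratAbs (r : ℕ × ℕ × ℕ) : ratVal (ratAbs r) = |ratVal r| := by
  have h1 : (0 : ℝ) < (r.2.2 : ℝ) + 1 := by positivity
  simp only [ratVal, ratAbs]
  rw [abs_div, abs_of_pos h1]
  push_cast
  rw [max_sub_min_eq_abs']

theorem ratVal_ratScale (w : ℕ) (r : ℕ × ℕ × ℕ) : ratVal (ratScale w r) = w * ratVal r := by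
  simp only [ratVal, ratScale]
  push_cast
  ring

theorem ratVal_ratSum (l : List (ℕ × ℕ × ℕ)) : ratVal (ratSum l) = (l.map ratVal).sum := by
  induction l with
  | nil => simp [ratSum, ratVal]
  | cons r l ih =>
    rw [List.map_cons, List.sum_cons, ← ih, ← ratVal_ratAdd]
    rfl

/-- A triple coding `(n + 1) * idealPoint s (x / (n + 1))`. -/
def gridValue (s n x : ℕ) : ℕ × ℕ × ℕ :=
  ratSum ((List.range (Denumerable.ofNat (List ℕ) s).length).map fun k =>
    ratScale ((n + 1) - ((((Denumerable.ofNat (List ℕ) s).length - 1) * x - k * (n + 1)) +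
        (k * (n + 1) - ((Denumerable.ofNat (List ℕ) s).length - 1) * x)))
      (ratCode ((Denumerable.ofNat (List ℕ) s).getD k 0)))

/-- Equal indices, or indices whose cells are disjoint and in this order. -/
def Gap (u v : ℕ) : Prop := u = v ∨ u + 2 ≤ v

/-- The cell with index `i` at resolution `n` is contained in the one with index `j` at
resolution `M`. -/
def Inside (n i M j : ℕ) : Prop :=
  i * (M + 1) + (M + 1) ≤ j * (n + 1) + (n + 1) ∧ j * (n + 1) + (M + 1) ≤ i * (M + 1) + (n + 1)

/-- The cells with indices `i` at resolution `N` and `j` at resolution `M` are not too far from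
each other. -/
def Near (N i M j : ℕ) : Prop :=
  j * (N + 1) ≤ i * (M + 1) + ((N + 1) + (M + 1)) ∧
    i * (M + 1) ≤ j * (N + 1) + ((N + 1) + (M + 1))

/-- The requirements on a single grid interval `[i, j]` with witnesses `x, y`. -/
def QuadOK (star : Bool) (M c n : ℕ) (q : ℕ × ℕ × ℕ × ℕ) : Prop :=
  q.1 ≤ q.2.1 ∧ q.2.1 ≤ n + 1 ∧ Gap q.1 q.2.1 ∧ Inside n q.1 M c ∧ Inside n q.2.1 M c ∧
    if star then (q.1 ≤ q.2.2.1 ∧ q.2.2.1 ≤ q.2.1) ∧ (q.1 ≤ q.2.2.2 ∧ q.2.2.2 ≤ q.2.1)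
    else q.2.2.1 = q.1 ∧ q.2.2.2 = q.2.1

/-- Upper bound for the total length, in units of `1 / (n + 1)`. -/
def gridLength (L : List (ℕ × ℕ × ℕ × ℕ)) : ℕ := (L.map fun q => q.2.1 - q.1 + 2).sum

/-- A triple coding `n + 1` times the total variation of `idealPoint s` over the witnesses. -/
def gridVariation (s n : ℕ) (L : List (ℕ × ℕ × ℕ × ℕ)) : ℕ × ℕ × ℕ :=
  ratSum (L.map fun q =>
    ratAbs (ratAdd (gridValue s n q.2.2.2) (ratNeg (gridValue s n q.2.2.1))))

/-- `L` is a grid sequence of intervals inside the cell `c` at resolution `M`, of length less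
than `1 / (d + 1)` and with variation robustly larger than `1 / (e + 1)`, as seen by the `k`-th
approximation `s`. -/
def BadGrid (star : Bool) (M c e d : ℕ) (t : ℕ × ℕ × ℕ × List (ℕ × ℕ × ℕ × ℕ)) : Prop :=
  (∀ q ∈ t.2.2.2, QuadOK star M c t.1 q) ∧
  (∀ l < t.2.2.2.length, ∀ l' < t.2.2.2.length, l < l' →
    Gap (t.2.2.2.getD l (0, 0, 0, 0)).2.1 (t.2.2.2.getD l' (0, 0, 0, 0)).1) ∧
  (d + 1) * gridLength t.2.2.2 < t.1 + 1 ∧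
  4 * t.2.2.2.length * (e + 1) ≤ 2 ^ t.2.1 ∧
  4 * t.2.2.2.length * (e + 1) * (t.2.2.1 * t.2.2.1 * t.2.2.1) ≤ t.1 + 1 ∧
  (gridVariation t.2.2.1 t.1 t.2.2.2).2.1 * (e + 1) +
      2 * (t.1 + 1) * ((gridVariation t.2.2.1 t.1 t.2.2.2).2.2 + 1) <
    (gridVariation t.2.2.1 t.1 t.2.2.2).1 * (e + 1)

/-! ### Primitive recursiveness of the finite conditions -/

section Primrec

variable {α : Type*} [Primcodable α]

theorem primrec_ratAdd : Primrec₂ ratAdd := by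
  have h1 : Primrec fun p : (ℕ × ℕ × ℕ) × ℕ × ℕ × ℕ => p.1.1 := Primrec.fst.comp Primrec.fst
  have h2 : Primrec fun p : (ℕ × ℕ × ℕ) × ℕ × ℕ × ℕ => p.1.2.1 :=
    Primrec.fst.comp (Primrec.snd.comp Primrec.fst)
  have h3 : Primrec fun p : (ℕ × ℕ × ℕ) × ℕ × ℕ × ℕ => p.1.2.2 :=
    Primrec.snd.comp (Primrec.snd.comp Primrec.fst)
  have h4 : Primrec fun p : (ℕ × ℕ × ℕ) × ℕ × ℕ × ℕ => p.2.1 := Primrec.fst.comp Primrec.snd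
  have h5 : Primrec fun p : (ℕ × ℕ × ℕ) × ℕ × ℕ × ℕ => p.2.2.1 :=
    Primrec.fst.comp (Primrec.snd.comp Primrec.snd)
  have h6 : Primrec fun p : (ℕ × ℕ × ℕ) × ℕ × ℕ × ℕ => p.2.2.2 :=
    Primrec.snd.comp (Primrec.snd.comp Primrec.snd)
  have s3 := Primrec.succ.comp h3
  have s6 := Primrec.succ.comp h6
  exact ((Primrec.nat_add.comp (Primrec.nat_mul.comp h1 s6) (Primrec.nat_mul.comp h4 s3))).pair
    ((Primrec.nat_add.comp (Primrec.nat_mul.comp h2 s6) (Primrec.nat_mul.comp h5 s3)).pair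
      (Primrec.nat_add.comp (Primrec.nat_add.comp (Primrec.nat_mul.comp h3 h6) h3) h6))

theorem primrec_ratNeg : Primrec ratNeg :=
  (Primrec.fst.comp Primrec.snd).pair (Primrec.fst.pair (Primrec.snd.comp Primrec.snd))

theorem primrec_ratAbs : Primrec ratAbs :=
  (Primrec.nat_max.comp Primrec.fst (Primrec.fst.comp Primrec.snd)).pair
    ((Primrec.nat_min.comp Primrec.fst (Primrec.fst.comp Primrec.snd)).pair
      (Primrec.snd.comp Primrec.snd))

theorem primrec_ratScale : Primrec₂ ratScale :=
  (Primrec.nat_mul.comp Primrec.fst (Primrec.fst.comp Primrec.snd)).pair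
    ((Primrec.nat_mul.comp Primrec.fst (Primrec.fst.comp (Primrec.snd.comp Primrec.snd))).pair
      (Primrec.snd.comp (Primrec.snd.comp Primrec.snd)))

theorem primrec_ratCode : Primrec ratCode :=
  have h := Primrec.fst.comp Primrec.unpair
  (Primrec.fst.comp (Primrec.unpair.comp h)).pair
    ((Primrec.snd.comp (Primrec.unpair.comp h)).pair (Primrec.snd.comp Primrec.unpair))

theorem primrec_ratSum : Primrec ratSum :=
  Primrec.list_foldr Primrec.id (Primrec.const _)
    (primrec_ratAdd.comp (Primrec.fst.comp Primrec.snd) (Primrec.snd.comp Primrec.snd)).to₂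

theorem primrec_gridValue {s n x : α → ℕ} (hs : Primrec s) (hn : Primrec n) (hx : Primrec x) :
    Primrec fun a => gridValue (s a) (n a) (x a) := by
  have hv : Primrec fun a => Denumerable.ofNat (List ℕ) (s a) := (Primrec.ofNat _).comp hs
  have hlen := Primrec.list_length.comp hv
  have hk : Primrec fun p : α × ℕ => p.2 * (n p.1 + 1) :=
    Primrec.nat_mul.comp Primrec.snd (Primrec.succ.comp (hn.comp Primrec.fst))
  have hN : Primrec fun p : α × ℕ =>
      ((Denumerable.ofNat (List ℕ) (s p.1)).length - 1) * x p.1 :=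
    Primrec.nat_mul.comp (Primrec.nat_sub.comp (hlen.comp Primrec.fst) (Primrec.const 1))
      (hx.comp Primrec.fst)
  exact primrec_ratSum.comp <| Primrec.list_map (Primrec.list_range.comp hlen) <|
    primrec_ratScale.comp
      (Primrec.nat_sub.comp (Primrec.succ.comp (hn.comp Primrec.fst))
        (Primrec.nat_add.comp (Primrec.nat_sub.comp hN hk) (Primrec.nat_sub.comp hk hN)))
      (primrec_ratCode.comp ((Primrec.list_getD 0).comp (hv.comp Primrec.fst) Primrec.snd))

theorem primrec_gridVariation {s n : α → ℕ} {L : α → List (ℕ × ℕ × ℕ × ℕ)} (hs : Primrec s)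
    (hn : Primrec n) (hL : Primrec L) : Primrec fun a => gridVariation (s a) (n a) (L a) := by
  have hs' := hs.comp (Primrec.fst (α := α) (β := ℕ × ℕ × ℕ × ℕ))
  have hn' := hn.comp (Primrec.fst (α := α) (β := ℕ × ℕ × ℕ × ℕ))
  have h2 := Primrec.snd.comp (Primrec.snd.comp (Primrec.snd (α := α) (β := ℕ × ℕ × ℕ × ℕ)))
  exact primrec_ratSum.comp <| Primrec.list_map hL <| primrec_ratAbs.comp <|
    primrec_ratAdd.comp (primrec_gridValue hs' hn' (Primrec.snd.comp h2))
      (primrec_ratNeg.comp (primrec_gridValue hs' hn' (Primrec.fst.comp h2)))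

theorem primrec_gridLength : Primrec gridLength := by
  have h : Primrec fun p : List (ℕ × ℕ × ℕ × ℕ) × ℕ × ℕ × ℕ × ℕ => p.2.2.1 - p.2.1 + 2 :=
    Primrec.nat_add.comp (Primrec.nat_sub.comp
      (Primrec.fst.comp (Primrec.snd.comp Primrec.snd)) (Primrec.fst.comp Primrec.snd))
      (Primrec.const 2)
  exact (Primrec.list_foldr (Primrec.list_map Primrec.id h.to₂) (Primrec.const 0)
    (Primrec.nat_add.comp (Primrec.fst.comp Primrec.snd) (Primrec.snd.comp Primrec.snd)).to₂).of_eq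
    fun L => rfl

theorem primrecRel_gap : PrimrecRel Gap :=
  (Primrec.eq.comp Primrec.fst Primrec.snd).or
    (Primrec.nat_le.comp (Primrec.nat_add.comp Primrec.fst (Primrec.const 2)) Primrec.snd)

theorem primrecPred_inside {n i M j : α → ℕ} (hn : Primrec n) (hi : Primrec i)
    (hM : Primrec M) (hj : Primrec j) :
    PrimrecPred fun a => Inside (n a) (i a) (M a) (j a) := by
  have hn' := Primrec.succ.comp hn
  have hM' := Primrec.succ.comp hM
  have h1 := Primrec.nat_mul.comp hi hM'
  have h2 := Primrec.nat_mul.comp hj hn'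
  exact (Primrec.nat_le.comp (Primrec.nat_add.comp h1 hM') (Primrec.nat_add.comp h2 hn')).and
    (Primrec.nat_le.comp (Primrec.nat_add.comp h2 hM') (Primrec.nat_add.comp h1 hn'))

theorem primrecPred_near {N i M j : α → ℕ} (hN : Primrec N) (hi : Primrec i)
    (hM : Primrec M) (hj : Primrec j) :
    PrimrecPred fun a => Near (N a) (i a) (M a) (j a) := by
  have hN' := Primrec.succ.comp hN
  have hM' := Primrec.succ.comp hM
  have h1 := Primrec.nat_mul.comp hi hM'
  have h2 := Primrec.nat_mul.comp hj hN'
  have h3 := Primrec.nat_add.comp hN' hM'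
  exact (Primrec.nat_le.comp h2 (Primrec.nat_add.comp h1 h3)).and
    (Primrec.nat_le.comp h1 (Primrec.nat_add.comp h2 h3))

theorem primrecPred_quadOK (star : Bool) {M c n : α → ℕ} {q : α → ℕ × ℕ × ℕ × ℕ}
    (hM : Primrec M) (hc : Primrec c) (hn : Primrec n) (hq : Primrec q) :
    PrimrecPred fun a => QuadOK star (M a) (c a) (n a) (q a) := by
  have h1 := Primrec.fst.comp hq
  have h2 := Primrec.fst.comp (Primrec.snd.comp hq)
  have h3 := Primrec.fst.comp (Primrec.snd.comp (Primrec.snd.comp hq))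
  have h4 := Primrec.snd.comp (Primrec.snd.comp (Primrec.snd.comp hq))
  have hlast : PrimrecPred fun a =>
      if star then ((q a).1 ≤ (q a).2.2.1 ∧ (q a).2.2.1 ≤ (q a).2.1) ∧
        ((q a).1 ≤ (q a).2.2.2 ∧ (q a).2.2.2 ≤ (q a).2.1)
      else (q a).2.2.1 = (q a).1 ∧ (q a).2.2.2 = (q a).2.1 := by
    cases star with
    | true =>
      simp only [if_true]
      exact ((Primrec.nat_le.comp h1 h3).and (Primrec.nat_le.comp h3 h2)).and
        ((Primrec.nat_le.comp h1 h4).and (Primrec.nat_le.comp h4 h2))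
    | false =>
      simp only [Bool.false_eq_true, if_false]
      exact (Primrec.eq.comp h3 h1).and (Primrec.eq.comp h4 h2)
  exact (Primrec.nat_le.comp h1 h2).and <| (Primrec.nat_le.comp h2 (Primrec.succ.comp hn)).and <|
    (primrecRel_gap.comp h1 h2).and <| (primrecPred_inside hn h1 hM hc).and <|
    (primrecPred_inside hn h2 hM hc).and hlast

theorem primrecPred_badGrid (star : Bool) {M c e d : α → ℕ}
    {t : α → ℕ × ℕ × ℕ × List (ℕ × ℕ × ℕ × ℕ)} (hM : Primrec M) (hc : Primrec c)
    (he : Primrec e) (hd : Primrec d) (ht : Primrec t) :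
    PrimrecPred fun a => BadGrid star (M a) (c a) (e a) (d a) (t a) := by
  have hn := Primrec.fst.comp ht
  have hk := Primrec.fst.comp (Primrec.snd.comp ht)
  have hs := Primrec.fst.comp (Primrec.snd.comp (Primrec.snd.comp ht))
  have hL := Primrec.snd.comp (Primrec.snd.comp (Primrec.snd.comp ht))
  have hlen := Primrec.list_length.comp hL
  have hV := primrec_gridVariation hs hn hL
  have he' := Primrec.succ.comp he
  have hn' := Primrec.succ.comp hn
  have h4 := Primrec.nat_mul.comp (Primrec.nat_mul.comp (Primrec.const 4) hlen) he'
  have hall : PrimrecPred fun a => ∀ q ∈ (t a).2.2.2, QuadOK star (M a) (c a) (t a).1 q :=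
    (PrimrecRel.forall_mem_list (R := fun q a => QuadOK star (M a) (c a) (t a).1 q)
      (primrecPred_quadOK star (hM.comp Primrec.snd) (hc.comp Primrec.snd)
        (hn.comp Primrec.snd) Primrec.fst)).comp hL Primrec.id
  have hord : PrimrecPred fun a => ∀ l < (t a).2.2.2.length, ∀ l' < (t a).2.2.2.length, l < l' →
      Gap ((t a).2.2.2.getD l (0, 0, 0, 0)).2.1 ((t a).2.2.2.getD l' (0, 0, 0, 0)).1 := by
    have hgap : PrimrecRel fun (l' : ℕ) (p : ℕ × α) => ¬ p.1 < l' ∨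
        Gap ((t p.2).2.2.2.getD p.1 (0, 0, 0, 0)).2.1
          ((t p.2).2.2.2.getD l' (0, 0, 0, 0)).1 := by
      have hl := Primrec.fst.comp (Primrec.snd (α := ℕ) (β := ℕ × α))
      have hL' := hL.comp (Primrec.snd.comp (Primrec.snd (α := ℕ) (β := ℕ × α)))
      exact (Primrec.nat_lt.comp hl Primrec.fst).not.or
        (primrecRel_gap.comp
          (Primrec.fst.comp (Primrec.snd.comp ((Primrec.list_getD _).comp hL' hl)))
          (Primrec.fst.comp ((Primrec.list_getD _).comp hL' Primrec.fst)))
    have h1 := PrimrecRel.forall_mem_list hgap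
    have h2 : PrimrecRel fun (l : ℕ) (a : α) => ∀ l' ∈ List.range (t a).2.2.2.length, ¬ l < l' ∨
        Gap ((t a).2.2.2.getD l (0, 0, 0, 0)).2.1 ((t a).2.2.2.getD l' (0, 0, 0, 0)).1 :=
      h1.comp (Primrec.list_range.comp (hlen.comp Primrec.snd)) Primrec.id
    refine ((PrimrecRel.forall_mem_list h2).comp (Primrec.list_range.comp hlen)
      Primrec.id).of_eq fun a => ?_
    simp only [imp_iff_not_or, id, List.mem_range]
  have hpow : Primrec fun a => 2 ^ (t a).2.1 := (primrec_pow 2).comp hk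
  exact hall.and <| hord.and <|
    (Primrec.nat_lt.comp (Primrec.nat_mul.comp (Primrec.succ.comp hd)
      (primrec_gridLength.comp hL)) hn').and <|
    (Primrec.nat_le.comp h4 hpow).and <|
    (Primrec.nat_le.comp (Primrec.nat_mul.comp h4
      (Primrec.nat_mul.comp (Primrec.nat_mul.comp hs hs) hs)) hn').and <|
    Primrec.nat_lt.comp
      (Primrec.nat_add.comp (Primrec.nat_mul.comp (Primrec.fst.comp (Primrec.snd.comp hV)) he')
        (Primrec.nat_mul.comp (Primrec.nat_mul.comp (Primrec.const 2) hn')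
          (Primrec.succ.comp (Primrec.snd.comp (Primrec.snd.comp hV)))))
      (Primrec.nat_mul.comp (Primrec.fst.comp hV) he')

end Primrec

/-- A bad grid sequence for the cell `c` at resolution `M`, near the cell `i` at resolution `N`,
whose cells are confirmed by `T`. -/
def Violation (T : Set ℕ) (star : Bool) (N i M c e d : ℕ)
    (t : ℕ × ℕ × ℕ × List (ℕ × ℕ × ℕ × ℕ)) : Prop :=
  (c ≤ M + 1 ∧ Near N i M c ∧ BadGrid star M c e d t) ∧
    2 * Nat.pair (2 * t.2.1 + 1) t.2.2.1 + 1 ∈ T ∧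
      ∀ q ∈ t.2.2.2, 2 * Nat.pair t.1 q.1 ∉ T ∧ 2 * Nat.pair t.1 q.2.1 ∉ T

/-- Packs finitely many negative oracle answers into the vanishing of one computable sum. -/
theorem sum_charFun_eq_zero {T : Set ℕ} {L : List (ℕ × ℕ × ℕ × ℕ)}
    (f : ℕ × ℕ × ℕ × ℕ → ℕ) :
    ∑ l ∈ Finset.range L.length, charFun T (f (L.getD l (0, 0, 0, 0))) = 0 ↔
      ∀ q ∈ L, f q ∉ T := by
  have h0 : ∀ x, charFun T x = 0 ↔ x ∉ T := fun x => by
    by_cases h : x ∈ T <;> simp [charFun, h]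
  rw [Finset.sum_eq_zero_iff]
  simp only [h0, Finset.mem_range]
  constructor
  · intro h q hq
    obtain ⟨l, hl, rfl⟩ := List.mem_iff_getElem.1 hq
    have := h l hl
    rwa [List.getD_eq_getElem _ _ hl] at this
  · intro h l hl
    rw [List.getD_eq_getElem _ _ hl]
    exact h _ (List.getElem_mem hl)

/-- Decoding of the inputs `⟨⟨⟨⟨z, M⟩, ⟨c, e⟩⟩, d⟩, t⟩`. -/
def matrixInput (w : ℕ) :
    (ℕ × ℕ × ℕ × ℕ × ℕ) × ℕ × ℕ × ℕ × List (ℕ × ℕ × ℕ × ℕ) :=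
  ((w.unpair.1.unpair.1.unpair.1.unpair.1, w.unpair.1.unpair.1.unpair.1.unpair.2,
    w.unpair.1.unpair.1.unpair.2.unpair.1, w.unpair.1.unpair.1.unpair.2.unpair.2,
    w.unpair.1.unpair.2), Denumerable.ofNat _ w.unpair.2)

/-- The part of a violation that does not involve `T`. -/
def MatrixCond (star : Bool)
    (x : (ℕ × ℕ × ℕ × ℕ × ℕ) × ℕ × ℕ × ℕ × List (ℕ × ℕ × ℕ × ℕ)) : Prop :=
  x.1.2.2.1 ≤ x.1.2.1 + 1 ∧
    Near (x.1.1 / 2).unpair.1 (x.1.1 / 2).unpair.2 x.1.2.1 x.1.2.2.1 ∧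
    BadGrid star x.1.2.1 x.1.2.2.1 x.1.2.2.2.1 x.1.2.2.2.2 x.2

/-- The values of the oracle used by the matrix. -/
def matrixQuery (g : ℕ → ℕ) (t : ℕ × ℕ × ℕ × List (ℕ × ℕ × ℕ × ℕ)) : ℕ :=
  1 - g (2 * Nat.pair (2 * t.2.1 + 1) t.2.2.1 + 1) +
    ((∑ l ∈ Finset.range t.2.2.2.length,
      g (2 * Nat.pair t.1 (t.2.2.2.getD l (0, 0, 0, 0)).1)) +
    ∑ l ∈ Finset.range t.2.2.2.length,
      g (2 * Nat.pair t.1 (t.2.2.2.getD l (0, 0, 0, 0)).2.1))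

open Classical in
/-- The value of the matrix, which is `0` for a violation. -/
noncomputable def matrixValue (star : Bool)
    (x : (ℕ × ℕ × ℕ × ℕ × ℕ) × ℕ × ℕ × ℕ × List (ℕ × ℕ × ℕ × ℕ)) (y : ℕ) : ℕ :=
  if x.1.1 % 2 = 1 then y.unpair.1
  else if (x.1.1 / 2).unpair.1 + 1 < (x.1.1 / 2).unpair.2 then 0
  else if MatrixCond star x then y.unpair.2 else 1

theorem primrec_unpair_fst : Primrec fun w : ℕ => w.unpair.1 := Primrec.fst.comp Primrec.unpair

theorem primrec_unpair_snd : Primrec fun w : ℕ => w.unpair.2 := Primrec.snd.comp Primrec.unpair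

theorem primrec_matrixInput : Primrec matrixInput := by
  have u1 := primrec_unpair_fst
  have u2 := primrec_unpair_snd
  have h := u2.comp (u1.comp u1)
  exact ((u1.comp (u1.comp (u1.comp u1))).pair ((u2.comp (u1.comp (u1.comp u1))).pair
    ((u1.comp h).pair ((u2.comp h).pair (u2.comp u1))))).pair ((Primrec.ofNat _).comp u2)

theorem primrecPred_matrixCond (star : Bool) : PrimrecPred (MatrixCond star) := by
  have h1 := Primrec.fst (α := ℕ × ℕ × ℕ × ℕ × ℕ) (β := ℕ × ℕ × ℕ × List (ℕ × ℕ × ℕ × ℕ))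
  have hzz := Primrec.nat_div.comp (Primrec.fst.comp h1) (Primrec.const 2)
  have hM := Primrec.fst.comp (Primrec.snd.comp h1)
  have h2 := Primrec.snd.comp (Primrec.snd.comp h1)
  have hc := Primrec.fst.comp h2
  exact (Primrec.nat_le.comp hc (Primrec.succ.comp hM)).and <|
    (primrecPred_near (primrec_unpair_fst.comp hzz) (primrec_unpair_snd.comp hzz) hM hc).and <|
    primrecPred_badGrid star hM hc (Primrec.fst.comp (Primrec.snd.comp h2))
      (Primrec.snd.comp (Primrec.snd.comp h2)) Primrec.snd

theorem computable_matrixValue (star : Bool) :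
    Computable₂ fun w y => matrixValue star (matrixInput w) y := by
  classical
  have hz : Primrec fun p : ℕ × ℕ => (matrixInput p.1).1.1 :=
    Primrec.fst.comp (Primrec.fst.comp (primrec_matrixInput.comp Primrec.fst))
  have hzz := Primrec.nat_div.comp hz (Primrec.const 2)
  exact computable_ite (Primrec.eq.comp (Primrec.nat_mod.comp hz (Primrec.const 2))
      (Primrec.const 1)) (primrec_unpair_fst.comp Primrec.snd).to_comp <|
    computable_ite (Primrec.nat_lt.comp (Primrec.succ.comp (primrec_unpair_fst.comp hzz))
      (primrec_unpair_snd.comp hzz)) (Computable.const 0) <|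
    computable_ite ((primrecPred_matrixCond star).comp (primrec_matrixInput.comp Primrec.fst))
      (primrec_unpair_snd.comp Primrec.snd).to_comp (Computable.const 1)

theorem primrec_matrixInput_snd : Primrec fun w => (matrixInput w).2 :=
  Primrec.snd.comp primrec_matrixInput

theorem primrec_matrixInput_list : Primrec fun w => (matrixInput w).2.2.2.2 :=
  Primrec.snd.comp (Primrec.snd.comp (Primrec.snd.comp primrec_matrixInput_snd))

theorem oComp_cellQuery {k : ℕ × ℕ × ℕ × ℕ → ℕ} (hk : Primrec k) :
    OComp fun g w => ∑ l ∈ Finset.range (matrixInput w).2.2.2.2.length,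
      g (2 * Nat.pair (matrixInput w).2.1
        (k ((matrixInput w).2.2.2.2.getD l (0, 0, 0, 0)))) := by
  have h1 : Computable fun p : ℕ => 2 * Nat.pair (matrixInput p.unpair.1).2.1
      (k ((matrixInput p.unpair.1).2.2.2.2.getD p.unpair.2 (0, 0, 0, 0))) :=
    (Primrec.nat_double.comp (Primrec₂.natPair.comp
      (Primrec.fst.comp (primrec_matrixInput_snd.comp primrec_unpair_fst))
      (hk.comp ((Primrec.list_getD (0, 0, 0, 0)).comp
        (primrec_matrixInput_list.comp primrec_unpair_fst) primrec_unpair_snd)))).to_comp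
  have h := OComp.sum_range (OComp.oracle.comp (OComp.of_computable h1))
    (OComp.of_computable (Primrec.list_length.comp primrec_matrixInput_list).to_comp)
  simpa only [Nat.unpair_pair] using h

theorem oComp_matrixQuery : OComp fun g w => matrixQuery g (matrixInput w).2 := by
  have ht := primrec_matrixInput_snd
  have hquery : Computable fun w => 2 * Nat.pair (2 * (matrixInput w).2.2.1 + 1)
      (matrixInput w).2.2.2.1 + 1 :=
    (Primrec.nat_double_succ.comp (Primrec₂.natPair.comp
      (Primrec.nat_double_succ.comp (Primrec.fst.comp (Primrec.snd.comp ht)))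
      (Primrec.fst.comp (Primrec.snd.comp (Primrec.snd.comp ht))))).to_comp
  have h1 := OComp.map₂ Primrec.nat_sub.to_comp (OComp.of_computable (Computable.const 1))
      (OComp.oracle.comp (OComp.of_computable hquery))
  have h2 := OComp.map₂ Primrec.nat_add.to_comp (oComp_cellQuery Primrec.fst)
      (oComp_cellQuery (Primrec.fst.comp Primrec.snd))
  have h3 := OComp.map₂ Primrec.nat_add.to_comp h1 h2
  simpa only [matrixQuery] using h3

theorem violation_iff {T : Set ℕ} {star : Bool} {z M c e d : ℕ}
    {t : ℕ × ℕ × ℕ × List (ℕ × ℕ × ℕ × ℕ)} :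
    Violation T star (z / 2).unpair.1 (z / 2).unpair.2 M c e d t ↔
      MatrixCond star ((z, M, c, e, d), t) ∧ matrixQuery (charFun T) t = 0 := by
  have h1 := sum_charFun_eq_zero (T := T) (L := t.2.2.2) fun q => 2 * Nat.pair t.1 q.1
  have h2 := sum_charFun_eq_zero (T := T) (L := t.2.2.2) fun q => 2 * Nat.pair t.1 q.2.1
  rw [Violation, matrixQuery, Nat.add_eq_zero_iff, Nat.add_eq_zero_iff, one_sub_charFun, h1, h2,
    ← forall₂_and]
  rfl

theorem matrixValue_ne_zero_iff {T : Set ℕ} {star : Bool} {z M c e d : ℕ}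
    {t : ℕ × ℕ × ℕ × List (ℕ × ℕ × ℕ × ℕ)} :
    matrixValue star ((z, M, c, e, d), t) (Nat.pair (charFun T z) (matrixQuery (charFun T) t))
      ≠ 0 ↔ (z % 2 = 1 ∧ z ∈ T) ∨ (z % 2 = 0 ∧ (z / 2).unpair.2 ≤ (z / 2).unpair.1 + 1 ∧
        ¬ Violation T star (z / 2).unpair.1 (z / 2).unpair.2 M c e d t) := by
  have h0 : ∀ x, charFun T x ≠ 0 ↔ x ∈ T := fun x => by
    by_cases h : x ∈ T <;> simp [charFun, h]
  rw [violation_iff, matrixValue, Nat.unpair_pair]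
  by_cases hz : z % 2 = 1
  · simp [hz, h0]
  · have hz' : z % 2 = 0 := by omega
    by_cases hi : (z / 2).unpair.1 + 1 < (z / 2).unpair.2
    · simp [hz', hi]
    · by_cases hc : MatrixCond star ((z, M, c, e, d), t)
      · simp [hz', hi, hc, not_lt.1 hi]
      · simp [hz', hi, hc, not_lt.1 hi]

/-- A violation is decidable from `T`: a primitive recursive condition on `t` plus finitely many
membership questions. The four quantifiers in front cost four jumps. Odd numbers are copied, so
access to the name of `F` survives every step. -/
theorem exists_step_reduction (star : Bool) : ∃ v : ℕ → ℕ, Computable v ∧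
    ∀ (T : Set ℕ) (z : ℕ), v z ∈ jump (jump (jump (jump T))) ↔
      (z % 2 = 1 ∧ z ∈ T) ∨ (z % 2 = 0 ∧ (z / 2).unpair.2 ≤ (z / 2).unpair.1 + 1 ∧
        ∃ M, ∀ c e, ∃ d, ∀ t,
          ¬ Violation T star (z / 2).unpair.1 (z / 2).unpair.2 M c e d t) := by
  have hz : Primrec fun w => (matrixInput w).1.1 :=
    Primrec.fst.comp (Primrec.fst.comp primrec_matrixInput)
  obtain ⟨v, hv, h⟩ := (OComp.map₂ (computable_matrixValue star)
    (OComp.of_computable Computable.id) (OComp.map₂ Primrec₂.natPair.to_comp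
      (OComp.oracle.comp (OComp.of_computable hz.to_comp)) oComp_matrixQuery)).exists_jump_four
  refine ⟨v, hv, fun T z => (h T z).trans ?_⟩
  have hin : ∀ M b d p, matrixInput (Nat.pair (Nat.pair (Nat.pair (Nat.pair z M) b) d) p) =
      ((z, M, b.unpair.1, b.unpair.2, d), Denumerable.ofNat _ p) := by
    intro M b d p
    simp only [matrixInput, Nat.unpair_pair]
  simp only [id, hin, matrixValue_ne_zero_iff]
  rcases Nat.mod_two_eq_zero_or_one z with hx | hx
  · simp only [hx, zero_ne_one, false_and, false_or, true_and]
    by_cases hi : (z / 2).unpair.2 ≤ (z / 2).unpair.1 + 1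
    · simp only [hi, true_and]
      refine exists_congr fun m => ⟨fun h c e => ?_, fun h b => ?_⟩
      · obtain ⟨d, hd⟩ := h (Nat.pair c e)
        refine ⟨d, fun t => ?_⟩
        have := hd (Encodable.encode t)
        rwa [Nat.unpair_pair, Denumerable.ofNat_encode] at this
      · obtain ⟨d, hd⟩ := h b.unpair.1 b.unpair.2
        exact ⟨d, fun p => hd _⟩
    · simp [hi]
  · simp [hx]

end Denjoy

/-! ## Piecewise linear functions on a grid -/

namespace Denjoy

open OracleComp

theorem le_encode_of_mem {l : List ℕ} {m : ℕ} (h : m ∈ l) : m ≤ Encodable.encode l := by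
  induction l with
  | nil => simp at h
  | cons a l ih =>
    rw [Encodable.encode_list_cons]
    rcases List.mem_cons.1 h with rfl | h
    · exact (Nat.left_le_pair _ _).trans (Nat.le_succ _)
    · exact ((ih h).trans (Nat.right_le_pair _ _)).trans (Nat.le_succ _)

theorem abs_ratOfNat_le (m : ℕ) : |(ratOfNat m : ℝ)| ≤ m := by
  have h1 : (0 : ℝ) < (m.unpair.2 : ℝ) + 1 := by positivity
  have h2 : (m.unpair.1.unpair.1 : ℝ) ≤ m := by
    exact_mod_cast (Nat.unpair_left_le _).trans (Nat.unpair_left_le m)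
  have h3 : (m.unpair.1.unpair.2 : ℝ) ≤ m := by
    exact_mod_cast (Nat.unpair_right_le _).trans (Nat.unpair_left_le m)
  have h4 : |(m.unpair.1.unpair.1 : ℝ) - m.unpair.1.unpair.2| ≤ m := by
    rw [abs_le]
    constructor <;> linarith [Nat.cast_nonneg (α := ℝ) m.unpair.1.unpair.1,
      Nat.cast_nonneg (α := ℝ) m.unpair.1.unpair.2]
  rw [ratOfNat]
  push_cast
  rw [abs_div, abs_of_pos h1, div_le_iff₀ h1]
  nlinarith [Nat.cast_nonneg (α := ℝ) m.unpair.2, Nat.cast_nonneg (α := ℝ) m]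

theorem abs_hat_sub_hat_le (u v : ℝ) :
    |max 0 (1 - |u|) - max 0 (1 - |v|)| ≤ |u - v| := by
  rw [max_comm 0, max_comm 0]
  refine (abs_max_sub_max_le_abs _ _ _).trans ?_
  rw [show 1 - |u| - (1 - |v|) = -(|u| - |v|) by ring, abs_neg]
  exact abs_abs_sub_abs_le u v

/-- A Lipschitz constant that can be read off the code: the number of hats, the size of each
coefficient and the slope of each unscaled hat are all at most `s`. -/
theorem abs_idealPoint_sub_le (s : ℕ) (x y : unitInterval) :
    |idealPoint s x - idealPoint s y| ≤ (s * s * s : ℕ) * |(x : ℝ) - y| := by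
  set v : List ℕ := Denumerable.ofNat (List ℕ) s with hv
  have henc : Encodable.encode v = s := Denumerable.encode_ofNat s
  have hlen : v.length ≤ s := henc ▸ Encodable.length_le_encode v
  have hd : (0 : ℝ) ≤ |(x : ℝ) - y| := abs_nonneg _
  have hterm : ∀ k : Fin v.length,
      |(ratOfNat (v.get k) : ℝ) * max 0 (1 - |((v.length - 1 : ℕ) : ℝ) * (x : ℝ) - (k : ℕ)|) -
        (ratOfNat (v.get k) : ℝ) * max 0 (1 - |((v.length - 1 : ℕ) : ℝ) * (y : ℝ) - (k : ℕ)|)| ≤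
      s * (s * |(x : ℝ) - y|) := by
    intro k
    rw [← mul_sub, abs_mul]
    have h1 : |(ratOfNat (v.get k) : ℝ)| ≤ s :=
      (abs_ratOfNat_le _).trans (by exact_mod_cast henc ▸ le_encode_of_mem (v.get_mem k))
    refine mul_le_mul h1 ((abs_hat_sub_hat_le _ _).trans ?_) (abs_nonneg _) (Nat.cast_nonneg _)
    rw [sub_sub_sub_cancel_right, ← mul_sub, abs_mul, Nat.abs_cast]
    exact mul_le_mul_of_nonneg_right (by exact_mod_cast (Nat.sub_le _ _).trans hlen) hd
  calc |idealPoint s x - idealPoint s y|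
      = |∑ k : Fin v.length,
        ((ratOfNat (v.get k) : ℝ) * max 0 (1 - |((v.length - 1 : ℕ) : ℝ) * (x : ℝ) - (k : ℕ)|) -
        (ratOfNat (v.get k) : ℝ) *
          max 0 (1 - |((v.length - 1 : ℕ) : ℝ) * (y : ℝ) - (k : ℕ)|))| := by
        rw [Finset.sum_sub_distrib]
        rfl
    _ ≤ ∑ _k : Fin v.length, (s : ℝ) * (s * |(x : ℝ) - y|) :=
        (Finset.abs_sum_le_sum_abs _ _).trans (Finset.sum_le_sum fun k _ => hterm k)
    _ = v.length * (s * (s * |(x : ℝ) - y|)) := by simp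
    _ ≤ s * (s * (s * |(x : ℝ) - y|)) :=
        mul_le_mul_of_nonneg_right (by exact_mod_cast hlen) (by positivity)
    _ = (s * s * s : ℕ) * |(x : ℝ) - y| := by push_cast; ring

/-- The point `x / (n + 1)` of the unit interval. -/
noncomputable def gridPoint (n x : ℕ) : unitInterval :=
  Set.projIcc 0 1 zero_le_one ((x : ℝ) / (n + 1))

theorem coe_gridPoint {n x : ℕ} (h : x ≤ n + 1) : (gridPoint n x : ℝ) = x / (n + 1) := by
  have h1 : (0 : ℝ) < (n : ℝ) + 1 := by positivity
  have h2 : (x : ℝ) ≤ n + 1 := by exact_mod_cast h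
  rw [gridPoint, Set.projIcc_of_mem zero_le_one
    ⟨by positivity, (div_le_one h1).2 h2⟩]

theorem ratVal_gridValue (s : ℕ) {n x : ℕ} (h : x ≤ n + 1) :
    ratVal (gridValue s n x) = (n + 1) * idealPoint s (gridPoint n x) := by
  set v : List ℕ := Denumerable.ofNat (List ℕ) s with hv
  -- Truncated subtraction produces the hat function: the sum of the two opposite differences is the
  -- absolute value, and the outer difference takes the maximum with `0`.
  have hweight : ∀ k : ℕ, ((((n + 1) - (((v.length - 1) * x - k * (n + 1)) +
        (k * (n + 1) - (v.length - 1) * x)) : ℕ)) : ℝ) =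
      (n + 1) * max 0 (1 - |((v.length - 1 : ℕ) : ℝ) * (gridPoint n x : ℝ) - k|) := by
    intro k
    have h1 : (0 : ℝ) < (n : ℝ) + 1 := by positivity
    rw [mul_max_of_nonneg _ _ h1.le, mul_zero, mul_sub, mul_one]
    have h2 : ((n : ℝ) + 1) * |((v.length - 1 : ℕ) : ℝ) * (gridPoint n x : ℝ) - k| =
        |((v.length - 1 : ℕ) : ℝ) * x - k * (n + 1)| := by
      nth_rewrite 1 [← abs_of_pos h1]
      rw [← abs_mul, coe_gridPoint h]
      congr 1
      field_simp
    rw [h2]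
    generalize v.length - 1 = N
    have h3 : |(N : ℝ) * x - k * (n + 1)| =
        ((N * x - k * (n + 1) + (k * (n + 1) - N * x) : ℕ) : ℝ) := by
      rcases le_total (N * x) (k * (n + 1)) with h4 | h4
      · have h5 : (N : ℝ) * x ≤ k * (n + 1) := by exact_mod_cast h4
        rw [Nat.sub_eq_zero_of_le h4, zero_add, Nat.cast_sub h4, abs_of_nonpos (by linarith)]
        push_cast
        ring
      · have h5 : (k : ℝ) * (n + 1) ≤ N * x := by exact_mod_cast h4
        rw [Nat.sub_eq_zero_of_le h4, add_zero, Nat.cast_sub h4, abs_of_nonneg (by linarith)]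
        push_cast
        ring
    rw [h3]
    generalize N * x - k * (n + 1) + (k * (n + 1) - N * x) = D
    rcases le_total D (n + 1) with h4 | h4
    · have h5 : (D : ℝ) ≤ n + 1 := by exact_mod_cast h4
      rw [Nat.cast_sub h4, max_eq_right (by linarith)]
      push_cast
      ring
    · have h5 : (n : ℝ) + 1 ≤ D := by exact_mod_cast h4
      rw [Nat.sub_eq_zero_of_le h4, max_eq_left (by linarith), Nat.cast_zero]
  rw [gridValue, ratVal_ratSum, List.map_map]
  have hsum : ∀ (m : ℕ) (f : ℕ → ℝ), ((List.range m).map f).sum = ∑ k : Fin m, f k := by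
    intro m f
    rw [← Finset.sum_range]
    rfl
  rw [hsum]
  change _ = ((n : ℝ) + 1) * ∑ k : Fin v.length,
      (ratOfNat (v.get k) : ℝ) * max 0 (1 - |((v.length - 1 : ℕ) : ℝ) * _ - (k : ℕ)|)
  rw [Finset.mul_sum]
  refine Finset.sum_congr rfl fun k _ => ?_
  simp only [Function.comp]
  rw [ratVal_ratScale, ratVal_ratCode]
  refine (congrArg₂ (· * ·) (hweight k) (congrArg (fun m => (ratOfNat m : ℝ))
    (List.getD_eq_getElem v 0 k.2))).trans ?_
  rw [List.get_eq_getElem]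
  ring

theorem ratVal_gridVariation (s n : ℕ) {L : List (ℕ × ℕ × ℕ × ℕ)}
    (hL : ∀ q ∈ L, q.2.2.1 ≤ n + 1 ∧ q.2.2.2 ≤ n + 1) :
    ratVal (gridVariation s n L) = (n + 1) * (L.map fun q =>
      |idealPoint s (gridPoint n q.2.2.2) - idealPoint s (gridPoint n q.2.2.1)|).sum := by
  rw [gridVariation, ratVal_ratSum, List.map_map, ← List.sum_map_mul_left]
  congr 1
  refine List.map_congr_left fun q hq => ?_
  have h1 : (0 : ℝ) < (n : ℝ) + 1 := by positivity
  simp only [Function.comp]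
  rw [ratVal_ratAbs, ratVal_ratAdd, ratVal_ratNeg, ratVal_gridValue s (hL q hq).1,
    ratVal_gridValue s (hL q hq).2, ← sub_eq_add_neg, ← mul_sub, abs_mul, abs_of_pos h1]

theorem lt_ratVal_iff (r : ℕ × ℕ × ℕ) (n e : ℕ) :
    r.2.1 * (e + 1) + 2 * (n + 1) * (r.2.2 + 1) < r.1 * (e + 1) ↔
      2 * ((n : ℝ) + 1) / (e + 1) < ratVal r := by
  have h1 : (0 : ℝ) < (e : ℝ) + 1 := by positivity
  have h2 : (0 : ℝ) < (r.2.2 : ℝ) + 1 := by positivity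
  rw [ratVal, div_lt_div_iff₀ h1 h2, ← Nat.cast_lt (α := ℝ)]
  push_cast
  constructor <;> intro h <;> linarith

/-! ## Absolute continuity in terms of lists of intervals with witnesses -/

/-- `x` and `y` witness the variation on `[a, b]`: they are arbitrary points of `[a, b]` for
`AC_*`, and the end points for `AC`. -/
def Witness (star : Bool) (q : unitInterval × unitInterval × unitInterval × unitInterval) :
    Prop :=
  if star then (q.1 ≤ q.2.2.1 ∧ q.2.2.1 ≤ q.2.1) ∧ (q.1 ≤ q.2.2.2 ∧ q.2.2.2 ≤ q.2.1)
  else q.2.2.1 = q.1 ∧ q.2.2.2 = q.2.1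

/-- The common form of `AC` and `AC_*`. -/
def IsVar (star : Bool) (F : C(unitInterval, ℝ)) (E : Set unitInterval) : Prop :=
  ∀ ε : ℝ, 0 < ε → ∃ δ : ℝ, 0 < δ ∧
    ∀ L : List (unitInterval × unitInterval × unitInterval × unitInterval),
      (∀ q ∈ L, q.1 ∈ E ∧ q.2.1 ∈ E ∧ q.1 ≤ q.2.1 ∧ Witness star q) →
      L.Pairwise (fun q q' => q.2.1 ≤ q'.1) →
      (L.map fun q => (q.2.1 : ℝ) - q.1).sum < δ →
      (L.map fun q => |F q.2.2.2 - F q.2.2.1|).sum ≤ ε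

theorem IsVar.mono {star : Bool} {F : C(unitInterval, ℝ)} {E E' : Set unitInterval}
    (h : IsVar star F E) (hE : E' ⊆ E) : IsVar star F E' := by
  intro ε hε
  obtain ⟨δ, hδ, h⟩ := h ε hε
  exact ⟨δ, hδ, fun L hL => h L fun q hq =>
    ⟨hE (hL q hq).1, hE (hL q hq).2.1, (hL q hq).2.2⟩⟩

theorem osc_nonneg (F : C(unitInterval, ℝ)) (a b : unitInterval) : 0 ≤ osc F a b := by
  refine Real.sSup_nonneg ?_
  rintro r ⟨x, -, y, -, rfl⟩
  exact abs_nonneg _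

theorem bddAbove_osc (F : C(unitInterval, ℝ)) (a b : unitInterval) :
    BddAbove {r : ℝ | ∃ x ∈ Set.Ioo a b, ∃ y ∈ Set.Ioo a b, r = |F x - F y|} := by
  refine ⟨‖F‖ + ‖F‖, ?_⟩
  rintro r ⟨x, -, y, -, rfl⟩
  exact (abs_sub _ _).trans (add_le_add (F.norm_coe_le_norm x) (F.norm_coe_le_norm y))

/-- By continuity the bound over the open interval passes to its closure, so it makes no difference
that `osc` omits the end points. -/
theorem abs_sub_le_osc (F : C(unitInterval, ℝ)) {a b x y : unitInterval}
    (hx : x ∈ Set.Icc a b) (hy : y ∈ Set.Icc a b) : |F y - F x| ≤ osc F a b := by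
  rcases (hx.1.trans hx.2).eq_or_lt with rfl | hab
  · rw [le_antisymm hx.2 hx.1, le_antisymm hy.2 hy.1, sub_self, abs_zero]
    exact osc_nonneg F _ _
  · have hclosed : IsClosed {p : unitInterval × unitInterval | |F p.1 - F p.2| ≤ osc F a b} :=
      isClosed_le (by fun_prop) continuous_const
    have hsub : Set.Ioo a b ×ˢ Set.Ioo a b ⊆
        {p : unitInterval × unitInterval | |F p.1 - F p.2| ≤ osc F a b} := by
      rintro ⟨u, v⟩ ⟨hu, hv⟩
      exact le_csSup (bddAbove_osc F a b) ⟨u, hu, v, hv, rfl⟩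
    have h := hclosed.closure_subset_iff.2 hsub
    rw [closure_prod_eq, closure_Ioo hab.ne] at h
    exact h (Set.mk_mem_prod hy hx)

theorem exists_osc_le (F : C(unitInterval, ℝ)) {a b : unitInterval} (hab : a ≤ b) :
    ∃ x ∈ Set.Icc a b, ∃ y ∈ Set.Icc a b, osc F a b ≤ |F y - F x| := by
  have hcomp : IsCompact (Set.Icc a b ×ˢ Set.Icc a b) := isCompact_Icc.prod isCompact_Icc
  have hcont : Continuous fun p : unitInterval × unitInterval => |F p.1 - F p.2| := by fun_prop
  obtain ⟨⟨u, v⟩, ⟨hu, hv⟩, hmax⟩ := hcomp.exists_isMaxOn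
    ⟨(a, a), Set.mk_mem_prod (Set.left_mem_Icc.2 hab) (Set.left_mem_Icc.2 hab)⟩
    hcont.continuousOn
  refine ⟨v, hv, u, hu, Real.sSup_le ?_ (abs_nonneg _)⟩
  rintro r ⟨x, hx, y, hy, rfl⟩
  exact hmax (Set.mk_mem_prod (Set.Ioo_subset_Icc_self hx) (Set.Ioo_subset_Icc_self hy))

/-- Here `V` is `|F b - F a|` or the oscillation. Bounding it and, conversely, attaining it by
witnesses makes both notions instances of `IsVar`. -/
theorem isVar_of_forall {star : Bool} {F : C(unitInterval, ℝ)} {E : Set unitInterval}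
    {V : unitInterval → unitInterval → ℝ}
    (hV : ∀ q, q.1 ≤ q.2.1 → Witness star q → |F q.2.2.2 - F q.2.2.1| ≤ V q.1 q.2.1)
    (h : ∀ ε : ℝ, 0 < ε → ∃ δ : ℝ, 0 < δ ∧
      ∀ (k : ℕ) (a b : Fin (k + 1) → unitInterval), IsIntervalSeq E a b →
        ∑ i, |(b i : ℝ) - (a i : ℝ)| < δ → ∑ i, V (a i) (b i) < ε) : IsVar star F E := by
  intro ε hε
  obtain ⟨δ, hδ, h⟩ := h ε hε
  refine ⟨δ, hδ, fun L hL hord hsum => ?_⟩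
  obtain ⟨n, f, rfl⟩ : ∃ (n : ℕ) (f : Fin n → _), L = List.ofFn f :=
    ⟨L.length, L.get, (List.ofFn_get L).symm⟩
  rw [List.map_ofFn, List.sum_ofFn] at hsum ⊢
  rw [List.pairwise_ofFn] at hord
  have hf := fun i => hL (f i) (List.mem_ofFn.2 ⟨i, rfl⟩)
  cases n with
  | zero => simpa using hε.le
  | succ k =>
    have h1 := h k (fun i => (f i).1) (fun i => (f i).2.1)
      ⟨fun i => ⟨(hf i).1, (hf i).2.1⟩, fun i => (hf i).2.2.1, fun i j hij => hord hij⟩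
      (lt_of_le_of_lt (Finset.sum_le_sum fun i _ =>
        (abs_of_nonneg (sub_nonneg.2 (by exact_mod_cast (hf i).2.2.1))).le) hsum)
    exact (Finset.sum_le_sum fun i _ => hV (f i) (hf i).2.2.1 (hf i).2.2.2).trans h1.le

theorem forall_of_isVar {star : Bool} {F : C(unitInterval, ℝ)} {E : Set unitInterval}
    {V : unitInterval → unitInterval → ℝ}
    (hV : ∀ a b, a ≤ b → ∃ x y, Witness star (a, b, x, y) ∧ V a b ≤ |F y - F x|)
    (h : IsVar star F E) : ∀ ε : ℝ, 0 < ε → ∃ δ : ℝ, 0 < δ ∧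
      ∀ (k : ℕ) (a b : Fin (k + 1) → unitInterval), IsIntervalSeq E a b →
        ∑ i, |(b i : ℝ) - (a i : ℝ)| < δ → ∑ i, V (a i) (b i) < ε := by
  intro ε hε
  -- Halving turns the non-strict bound of `IsVar` into a strict one.
  obtain ⟨δ, hδ, h⟩ := h (ε / 2) (by positivity)
  refine ⟨δ, hδ, fun k a b hab hsum => ?_⟩
  choose x y hw hxy using fun i => hV (a i) (b i) (hab.2.1 i)
  have h1 := h (List.ofFn fun i => (a i, b i, x i, y i)) ?_ ?_ ?_
  · rw [List.map_ofFn, List.sum_ofFn] at h1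
    calc ∑ i, V (a i) (b i) ≤ ε / 2 := (Finset.sum_le_sum fun i _ => hxy i).trans h1
      _ < ε := by linarith
  · intro q hq
    obtain ⟨i, rfl⟩ := List.mem_ofFn.1 hq
    exact ⟨(hab.1 i).1, (hab.1 i).2, hab.2.1 i, hw i⟩
  · rw [List.pairwise_ofFn]
    exact fun i j hij => hab.2.2 i j hij
  · rw [List.map_ofFn, List.sum_ofFn]
    exact lt_of_le_of_lt (Finset.sum_le_sum fun i _ => le_abs_self _) hsum

theorem isAC_eq_isVar (F : C(unitInterval, ℝ)) : IsAC F = IsVar false F := by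
  funext E
  refine propext ⟨fun h => ?_, fun h => ?_⟩
  · refine isVar_of_forall (V := fun a b => |F b - F a|) (fun q _ hw => ?_) h
    simp only [Witness, Bool.false_eq_true, if_false] at hw
    rw [hw.1, hw.2]
  · exact forall_of_isVar (V := fun a b => |F b - F a|)
      (fun a b _ => ⟨a, b, by simp [Witness], le_rfl⟩) h

theorem isACStar_eq_isVar (F : C(unitInterval, ℝ)) : IsACStar F = IsVar true F := by
  funext E
  refine propext ⟨fun h => ?_, fun h => ?_⟩
  · refine isVar_of_forall (V := osc F) (fun q _ hw => ?_) h
    simp only [Witness, if_true] at hw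
    exact abs_sub_le_osc F hw.1 hw.2
  · refine forall_of_isVar (V := osc F) (fun a b hab => ?_) h
    obtain ⟨x, hx, y, hy, hxy⟩ := exists_osc_le F hab
    exact ⟨x, y, by simpa [Witness] using ⟨hx, hy⟩, hxy⟩

end Denjoy

/-! ## Discretization of absolute continuity -/

namespace Denjoy

open OracleComp

/-- The cell with index `i` at resolution `n`. -/
def cell (n i : ℕ) : Set unitInterval := {x | |(x : ℝ) * (n + 1) - i| ≤ 1}

/-- A cell meets `P`. -/
def Meets (P : Set unitInterval) (n i : ℕ) : Prop := ∃ x ∈ P, x ∈ cell n i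

/-- A bad grid sequence supported by the name `X` and the set `P`. -/
def Obstruction (star : Bool) (X : ℕ → ℕ) (P : Set unitInterval) (M c e d : ℕ)
    (t : ℕ × ℕ × ℕ × List (ℕ × ℕ × ℕ × ℕ)) : Prop :=
  BadGrid star M c e d t ∧ X t.2.1 = t.2.2.1 ∧
    ∀ q ∈ t.2.2.2, Meets P t.1 q.1 ∧ Meets P t.1 q.2.1

theorem abs_sub_gridPoint {n x : ℕ} {p : unitInterval} (hx : x ≤ n + 1)
    (h : |(p : ℝ) * (n + 1) - x| ≤ 1) : |(gridPoint n x : ℝ) - p| ≤ 1 / (n + 1) := by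
  have h1 : (0 : ℝ) < (n : ℝ) + 1 := by positivity
  rw [coe_gridPoint hx, le_div_iff₀ h1]
  nth_rewrite 2 [← abs_of_pos h1]
  rw [← abs_mul, sub_mul, div_mul_cancel₀ _ h1.ne', abs_sub_comm]
  exact h

theorem abs_idealPoint_sub_le_of_isName {X : ℕ → ℕ} {F : C(unitInterval, ℝ)} (hX : IsName X F)
    (k : ℕ) {n x : ℕ} {p : unitInterval} (hx : x ≤ n + 1) (h : |(p : ℝ) * (n + 1) - x| ≤ 1) :
    |idealPoint (X k) (gridPoint n x) - F p| ≤
      (X k * X k * X k : ℕ) / (n + 1) + (1 / 2 : ℝ) ^ k := by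
  have h1 : |idealPoint (X k) p - F p| ≤ (1 / 2 : ℝ) ^ k := by
    rw [← Real.dist_eq]
    exact (ContinuousMap.dist_apply_le_dist p).trans (hX k)
  have h2 := (abs_idealPoint_sub_le (X k) (gridPoint n x) p).trans
    (mul_le_mul_of_nonneg_left (abs_sub_gridPoint hx h) (Nat.cast_nonneg _))
  rw [mul_one_div] at h2
  calc |idealPoint (X k) (gridPoint n x) - F p|
      ≤ |idealPoint (X k) (gridPoint n x) - idealPoint (X k) p| + |idealPoint (X k) p - F p| :=
        abs_sub_le _ _ _
    _ ≤ _ := add_le_add h2 h1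

theorem abs_abs_sub_sub_abs_sub_le {u v u' v' r : ℝ} (hu : |u - u'| ≤ r) (hv : |v - v'| ≤ r) :
    |(|v - u| - |v' - u'|)| ≤ 2 * r := by
  refine (abs_abs_sub_abs_le _ _).trans ?_
  rw [show v - u - (v' - u') = (v - v') - (u - u') by ring]
  exact (abs_sub _ _).trans (by linarith)

/-- The total error of the approximation. -/
theorem slack_le {len e k n S : ℕ} (h1 : 4 * len * (e + 1) ≤ 2 ^ k)
    (h2 : 4 * len * (e + 1) * S ≤ n + 1) :
    (len : ℝ) * (2 * ((S : ℝ) / (n + 1) + (1 / 2) ^ k)) ≤ 1 / (e + 1) := by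
  have he : (0 : ℝ) < (e : ℝ) + 1 := by positivity
  have hn : (0 : ℝ) < (n : ℝ) + 1 := by positivity
  have hk : (0 : ℝ) < (2 : ℝ) ^ k := by positivity
  have h1' : (4 : ℝ) * len * (e + 1) ≤ 2 ^ k := by exact_mod_cast h1
  have h2' : (4 : ℝ) * len * (e + 1) * S ≤ n + 1 := by exact_mod_cast h2
  -- The name's error and the grid error each get half of the allowance. The constant 4 combines
  -- this halving with the two points per interval.
  have h3 : (len : ℝ) * (2 * (1 / 2) ^ k) ≤ 1 / (2 * (e + 1)) := by
    rw [one_div_pow, le_div_iff₀ (by positivity)]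
    rw [show (len : ℝ) * (2 * (1 / 2 ^ k)) * (2 * (e + 1)) = 4 * len * (e + 1) / 2 ^ k by
      field_simp; ring]
    exact (div_le_one hk).2 h1'
  have h4 : (len : ℝ) * (2 * ((S : ℝ) / (n + 1))) ≤ 1 / (2 * (e + 1)) := by
    rw [le_div_iff₀ (by positivity)]
    rw [show (len : ℝ) * (2 * ((S : ℝ) / (n + 1))) * (2 * (e + 1)) =
      4 * len * (e + 1) * S / (n + 1) by field_simp; ring]
    exact (div_le_one hn).2 h2'
  have h5 : (1 : ℝ) / (e + 1) = 1 / (2 * (e + 1)) + 1 / (2 * (e + 1)) := by field_simp; norm_num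
  rw [h5]
  linarith

/-- Absolute continuity rules out obstructions. -/
theorem not_obstruction_of_isVar {star : Bool} {X : ℕ → ℕ} {F : C(unitInterval, ℝ)}
    (hX : IsName X F) {P : Set unitInterval} {M c : ℕ}
    (h : IsVar star F {x | x ∈ P ∧ x ∈ cell M c}) (e : ℕ) :
    ∃ d, ∀ t, ¬ Obstruction star X P M c e d t := by
  have he : (0 : ℝ) < (e : ℝ) + 1 := by positivity
  obtain ⟨δ, hδ, h⟩ := h (1 / (e + 1)) (by positivity)
  obtain ⟨d, hd⟩ := exists_nat_one_div_lt hδ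
  refine ⟨d, ?_⟩
  rintro ⟨n, k, s, L⟩ ⟨⟨hq, hord, hlen, hs1, hs2, hvar⟩, hXk, hmeet⟩
  dsimp only at hq hord hlen hs1 hs2 hvar hXk hmeet
  have hn : (0 : ℝ) < (n : ℝ) + 1 := by positivity
  have hM : (0 : ℝ) < (M : ℝ) + 1 := by positivity
  have hd' : (0 : ℝ) < (d : ℝ) + 1 := by positivity
  -- points representing the cells
  obtain ⟨p, hp⟩ : ∃ p : ℕ → unitInterval, ∀ i, Meets P n i →
      p i ∈ P ∧ |(p i : ℝ) * (n + 1) - i| ≤ 1 := by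
    have : ∀ i, ∃ x : unitInterval, Meets P n i → x ∈ P ∧ |(x : ℝ) * (n + 1) - i| ≤ 1 := by
      intro i
      by_cases hi : Meets P n i
      · obtain ⟨x, hx, hx'⟩ := hi
        exact ⟨x, fun _ => ⟨hx, hx'⟩⟩
      · exact ⟨0, fun h => absurd h hi⟩
    choose p hp using this
    exact ⟨p, hp⟩
  -- Representatives are only known up to one cell radius. Indices at least two apart keep them in
  -- order, and equal indices share a representative.
  have hle : ∀ {u v}, Meets P n u → Meets P n v → Gap u v → p u ≤ p v := by
    rintro u v hu hv (rfl | huv)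
    · exact le_rfl
    · have h1 := (abs_le.1 (hp u hu).2).2
      have h2 := (abs_le.1 (hp v hv).2).1
      have h3 : (u : ℝ) + 2 ≤ v := by exact_mod_cast huv
      have h4 : (p u : ℝ) * (n + 1) ≤ p v * (n + 1) := by linarith
      exact_mod_cast le_of_mul_le_mul_right h4 hn
  have hin : ∀ {i}, Meets P n i → Inside n i M c → p i ∈ cell M c := by
    rintro i hi ⟨h1, h2⟩
    have h3 := abs_le.1 (hp i hi).2
    have h1' : (i : ℝ) * (M + 1) + (M + 1) ≤ c * (n + 1) + (n + 1) := by exact_mod_cast h1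
    have h2' : (c : ℝ) * (n + 1) + (M + 1) ≤ i * (M + 1) + (n + 1) := by exact_mod_cast h2
    have h4 := mul_le_mul_of_nonneg_right h3.1 hM.le
    have h5 := mul_le_mul_of_nonneg_right h3.2 hM.le
    change |(p i : ℝ) * (M + 1) - c| ≤ 1
    refine abs_le.2 ⟨?_, ?_⟩
    · have : (-1 : ℝ) * (n + 1) ≤ (p i * (M + 1) - c) * (n + 1) := by linarith
      exact le_of_mul_le_mul_right this hn
    · have : ((p i : ℝ) * (M + 1) - c) * (n + 1) ≤ 1 * (n + 1) := by linarith
      exact le_of_mul_le_mul_right this hn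
  -- the witnesses
  have hwit : ∀ q ∈ L, ∃ x y : unitInterval, Witness star (p q.1, p q.2.1, x, y) ∧
      (q.2.2.1 ≤ n + 1 ∧ |(x : ℝ) * (n + 1) - q.2.2.1| ≤ 1) ∧
      (q.2.2.2 ≤ n + 1 ∧ |(y : ℝ) * (n + 1) - q.2.2.2| ≤ 1) := by
    intro q hqL
    obtain ⟨h1, h2, h3, -, -, h6⟩ := hq q hqL
    obtain ⟨m1, m2⟩ := hmeet q hqL
    have hab := hle m1 m2 h3
    cases star with
    | false =>
      simp only [Bool.false_eq_true, if_false] at h6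
      refine ⟨p q.1, p q.2.1, by simp [Witness], ?_, ?_⟩
      · rw [h6.1]; exact ⟨h1.trans h2, (hp _ m1).2⟩
      · rw [h6.2]; exact ⟨h2, (hp _ m2).2⟩
    | true =>
      simp only [if_true] at h6
      -- The grid point may fall outside the interval between the representatives, so it is clamped
      -- to it; this moves it by at most one grid width.
      have key : ∀ x : ℕ, q.1 ≤ x → x ≤ q.2.1 → ∃ x' : unitInterval,
          (p q.1 ≤ x' ∧ x' ≤ p q.2.1) ∧ x ≤ n + 1 ∧ |(x' : ℝ) * (n + 1) - x| ≤ 1 := by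
        intro x hx1 hx2
        have hx3 := hx2.trans h2
        have g := coe_gridPoint hx3
        have g' : (gridPoint n x : ℝ) * (n + 1) = x := by rw [g, div_mul_cancel₀ _ hn.ne']
        have a1 := (abs_le.1 (hp _ m1).2).2
        have a2 := (abs_le.1 (hp _ m2).2).1
        have a3 : (q.1 : ℝ) ≤ x := by exact_mod_cast hx1
        have a4 : (x : ℝ) ≤ q.2.1 := by exact_mod_cast hx2
        rcases le_total (gridPoint n x) (p q.1) with b1 | b1
        · refine ⟨p q.1, ⟨le_rfl, hab⟩, hx3, abs_le.2 ⟨?_, by linarith⟩⟩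
          have : (gridPoint n x : ℝ) * (n + 1) ≤ p q.1 * (n + 1) :=
            mul_le_mul_of_nonneg_right (by exact_mod_cast b1) hn.le
          linarith
        · rcases le_total (p q.2.1) (gridPoint n x) with b2 | b2
          · refine ⟨p q.2.1, ⟨hab, le_rfl⟩, hx3, abs_le.2 ⟨by linarith, ?_⟩⟩
            have : (p q.2.1 : ℝ) * (n + 1) ≤ gridPoint n x * (n + 1) :=
              mul_le_mul_of_nonneg_right (by exact_mod_cast b2) hn.le
            linarith
          · exact ⟨gridPoint n x, ⟨b1, b2⟩, hx3, by rw [g']; simp⟩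
      obtain ⟨x, hx, hx'⟩ := key _ h6.1.1 h6.1.2
      obtain ⟨y, hy, hy'⟩ := key _ h6.2.1 h6.2.2
      exact ⟨x, y, by simpa [Witness] using ⟨hx, hy⟩, hx', hy'⟩
  obtain ⟨f, hf⟩ : ∃ f : ℕ × ℕ × ℕ × ℕ → unitInterval × unitInterval, ∀ q ∈ L,
      Witness star (p q.1, p q.2.1, (f q).1, (f q).2) ∧
      (q.2.2.1 ≤ n + 1 ∧ |((f q).1 : ℝ) * (n + 1) - q.2.2.1| ≤ 1) ∧
      (q.2.2.2 ≤ n + 1 ∧ |((f q).2 : ℝ) * (n + 1) - q.2.2.2| ≤ 1) := by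
    choose! x y hxy using hwit
    exact ⟨fun q => (x q, y q), hxy⟩
  have hsum := h (L.map fun q => (p q.1, p q.2.1, f q)) ?_ ?_ ?_
  · rw [List.map_map] at hsum
    rw [lt_ratVal_iff, ratVal_gridVariation s n fun q hqL =>
      ⟨(hf q hqL).2.1.1, (hf q hqL).2.2.1⟩, mul_comm 2, mul_div_assoc,
      mul_lt_mul_iff_right₀ hn] at hvar
    have hcmp : (L.map fun q => |idealPoint s (gridPoint n q.2.2.2) -
        idealPoint s (gridPoint n q.2.2.1)|).sum ≤
        (L.map fun q => |F (f q).2 - F (f q).1| +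
          2 * (((s * s * s : ℕ) : ℝ) / (n + 1) + (1 / 2) ^ k)).sum := by
      refine List.sum_le_sum fun q hqL => ?_
      obtain ⟨-, ⟨a1, a2⟩, b1, b2⟩ := hf q hqL
      have h1 := abs_idealPoint_sub_le_of_isName hX k a1 a2
      have h2 := abs_idealPoint_sub_le_of_isName hX k b1 b2
      rw [hXk] at h1 h2
      have h3 := (abs_le.1 (abs_abs_sub_sub_abs_sub_le h1 h2)).2
      linarith
    rw [List.sum_map_add, List.map_const', List.sum_replicate, nsmul_eq_mul] at hcmp
    have hsl := slack_le hs1 hs2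
    have h1 : (2 : ℝ) / (e + 1) = 1 / (e + 1) + 1 / (e + 1) := by ring
    have h2 : (L.map fun q => |F (f q).2 - F (f q).1|).sum ≤ 1 / ((e : ℝ) + 1) := hsum
    linarith
  · intro q' hq'
    obtain ⟨q, hqL, rfl⟩ := List.mem_map.1 hq'
    obtain ⟨-, -, h3, h4, h5, -⟩ := hq q hqL
    obtain ⟨m1, m2⟩ := hmeet q hqL
    exact ⟨⟨(hp _ m1).1, hin m1 h4⟩, ⟨(hp _ m2).1, hin m2 h5⟩, hle m1 m2 h3, (hf q hqL).1⟩
  · rw [List.pairwise_map, List.pairwise_iff_getElem]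
    intro i j hi hj hij
    have h1 := hord i hi j hj hij
    rw [List.getD_eq_getElem _ _ hi, List.getD_eq_getElem _ _ hj] at h1
    exact hle (hmeet _ (List.getElem_mem hi)).2 (hmeet _ (List.getElem_mem hj)).1 h1
  · rw [List.map_map]
    -- Each end point is off by at most one grid width, which is the `+ 2` in `gridLength`.
    have hcmp : ((n : ℝ) + 1) * (L.map fun q => (p q.2.1 : ℝ) - p q.1).sum ≤
        (gridLength L : ℝ) := by
      rw [gridLength, ← List.sum_map_mul_left, Nat.cast_list_sum, List.map_map]
      refine List.sum_le_sum fun q hqL => ?_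
      obtain ⟨m1, m2⟩ := hmeet q hqL
      have a1 := (abs_le.1 (hp _ m1).2).1
      have a2 := (abs_le.1 (hp _ m2).2).2
      simp only [Function.comp]
      rw [Nat.cast_add, Nat.cast_sub (hq q hqL).1]
      push_cast
      linarith
    have hlen' : ((d : ℝ) + 1) * gridLength L < n + 1 := by exact_mod_cast hlen
    have h1 : ((n : ℝ) + 1) * (L.map fun q => (p q.2.1 : ℝ) - p q.1).sum <
        (n + 1) * (1 / (d + 1)) := by
      rw [mul_one_div, lt_div_iff₀ hd']
      nlinarith
    exact (lt_of_mul_lt_mul_left h1 hn.le).trans hd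

theorem eventually_le_mul (K : ℝ) {a : ℝ} (ha : 0 < a) :
    ∀ᶠ n : ℕ in Filter.atTop, K ≤ a * ((n : ℝ) + 1) := by
  have : Filter.Tendsto (fun n : ℕ => a * ((n : ℝ) + 1)) Filter.atTop Filter.atTop :=
    (Filter.tendsto_atTop_add_const_right _ _ tendsto_natCast_atTop_atTop).const_mul_atTop ha
  exact this.eventually_ge_atTop K

/-- The index of a cell containing `x`. -/
noncomputable def index (n : ℕ) (x : unitInterval) : ℕ := ⌊(x : ℝ) * (n + 1)⌋₊

theorem index_le_mul (n : ℕ) (x : unitInterval) : (index n x : ℝ) ≤ x * (n + 1) :=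
  Nat.floor_le (mul_nonneg x.2.1 (by positivity))

theorem mul_lt_index (n : ℕ) (x : unitInterval) : (x : ℝ) * (n + 1) < index n x + 1 :=
  Nat.lt_floor_add_one _

theorem abs_mul_sub_index (n : ℕ) (x : unitInterval) : |(x : ℝ) * (n + 1) - index n x| ≤ 1 :=
  abs_le.2 ⟨by linarith [index_le_mul n x], by linarith [mul_lt_index n x]⟩

theorem index_le (n : ℕ) (x : unitInterval) : index n x ≤ n + 1 := by
  have h1 := index_le_mul n x
  have h2 : (x : ℝ) * (n + 1) ≤ 1 * (n + 1) :=
    mul_le_mul_of_nonneg_right x.2.2 (by positivity)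
  have h3 : (index n x : ℝ) ≤ (n + 1 : ℕ) := by push_cast; linarith
  exact_mod_cast h3

theorem index_mono (n : ℕ) {x y : unitInterval} (h : x ≤ y) : index n x ≤ index n y :=
  Nat.floor_mono (mul_le_mul_of_nonneg_right (by exact_mod_cast h) (by positivity))

theorem gap_index {n : ℕ} {x y : unitInterval} (h : x ≤ y)
    (h' : x < y → 3 ≤ ((y : ℝ) - x) * (n + 1)) : Gap (index n x) (index n y) := by
  rcases h.eq_or_lt with rfl | h
  · exact Or.inl rfl
  · right
    have h1 := index_le_mul n x
    have h2 := mul_lt_index n y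
    have h3 := h' h
    have h4 : ((index n x + 2 : ℕ) : ℝ) < (index n y + 1 : ℕ) := by push_cast; linarith
    have := Nat.cast_lt.1 h4
    omega

/-- The quarter of margin between radius `3 / 4` and the full cell absorbs two grid widths of the
finer resolution; this is where the factor 8 comes from. -/
theorem inside_index {n M c : ℕ} {x : unitInterval} (hx : |(x : ℝ) * (M + 1) - c| ≤ 3 / 4)
    (hn : 8 * (M + 1) ≤ n + 1) : Inside n (index n x) M c := by
  have hn' : (8 : ℝ) * (M + 1) ≤ n + 1 := by exact_mod_cast hn
  have hn0 : (0 : ℝ) < (n : ℝ) + 1 := by positivity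
  have hM : (0 : ℝ) < (M : ℝ) + 1 := by positivity
  have h1 := mul_le_mul_of_nonneg_right (index_le_mul n x) hM.le
  have h2 := mul_le_mul_of_nonneg_right (mul_lt_index n x).le hM.le
  have h3 := mul_le_mul_of_nonneg_right (abs_le.1 hx).1 hn0.le
  have h4 := mul_le_mul_of_nonneg_right (abs_le.1 hx).2 hn0.le
  constructor
  · have : ((index n x * (M + 1) + (M + 1) : ℕ) : ℝ) ≤ (c * (n + 1) + (n + 1) : ℕ) := by
      push_cast
      linarith
    exact_mod_cast this
  · have : ((c * (n + 1) + (M + 1) : ℕ) : ℝ) ≤ (index n x * (M + 1) + (n + 1) : ℕ) := by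
      push_cast
      linarith
    exact_mod_cast this

/-- The absence of obstructions implies absolute continuity. -/
theorem isVar_of_not_obstruction {star : Bool} {X : ℕ → ℕ} {F : C(unitInterval, ℝ)}
    (hX : IsName X F) {P : Set unitInterval} {M c : ℕ}
    (h : ∀ e, ∃ d, ∀ t, ¬ Obstruction star X P M c e d t) :
    IsVar star F {x | x ∈ P ∧ |(x : ℝ) * (M + 1) - c| ≤ 3 / 4} := by
  intro ε hε
  -- An obstruction needs polygon variation above `2 / (e + 1)` and the approximation loses at most
  -- `1 / (e + 1)`, so `3 / (e + 1) < ε` is enough.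
  obtain ⟨e, he⟩ := exists_nat_one_div_lt (show 0 < ε / 4 by positivity)
  obtain ⟨d, hd⟩ := h e
  have hd' : (0 : ℝ) < (d : ℝ) + 1 := by positivity
  refine ⟨1 / (d + 1), by positivity, fun L hL hord hsum => ?_⟩
  by_contra! hbad
  set k := 4 * L.length * (e + 1) with hk
  set S := (L.map fun q => (q.2.1 : ℝ) - q.1).sum with hS
  -- The length bound is strict. For large `n` the remaining room takes in the rounding: at most 3
  -- grid widths per interval, two from `gridLength` and one from the floors.
  have hgap : 0 < 1 - (d + 1) * S := by
    rw [lt_div_iff₀ hd'] at hsum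
    linarith
  have hfin : {q | q ∈ L}.Finite := L.finite_toSet
  have hsep : ∀ x y : unitInterval, ∀ᶠ n : ℕ in Filter.atTop,
      x < y → 3 ≤ ((y : ℝ) - x) * (n + 1) := by
    intro x y
    by_cases hxy : x < y
    · filter_upwards [eventually_le_mul 3 (show 0 < (y : ℝ) - x from
        sub_pos.2 (by exact_mod_cast hxy))] with n hn _ using hn
    · exact Filter.Eventually.of_forall fun n hn => absurd hn hxy
  have ev1 : ∀ᶠ n : ℕ in Filter.atTop, ∀ q ∈ {q | q ∈ L},
      q.1 < q.2.1 → 3 ≤ ((q.2.1 : ℝ) - q.1) * (n + 1) :=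
    (Filter.eventually_all_finite hfin).2 fun q _ => hsep _ _
  have ev2 : ∀ᶠ n : ℕ in Filter.atTop, ∀ q ∈ {q | q ∈ L}, ∀ q' ∈ {q | q ∈ L},
      q.2.1 < q'.1 → 3 ≤ ((q'.1 : ℝ) - q.2.1) * (n + 1) :=
    (Filter.eventually_all_finite hfin).2 fun q _ =>
      (Filter.eventually_all_finite hfin).2 fun q' _ => hsep _ _
  -- The precision `k` is fixed before `n`, since the grid must be fine relative to the Lipschitz
  -- constant of the polygon `X k`.
  obtain ⟨n, h1, h2, h3, h4, h5⟩ := (ev1.and <| ev2.and <|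
    (Filter.eventually_ge_atTop (8 * (M + 1))).and <|
    (Filter.eventually_ge_atTop (k * (X k * X k * X k))).and <|
    eventually_le_mul ((d + 1) * (3 * L.length) + 1) hgap).exists
  have hn : (0 : ℝ) < (n : ℝ) + 1 := by positivity
  let f : unitInterval × unitInterval × unitInterval × unitInterval → ℕ × ℕ × ℕ × ℕ :=
    fun q => (index n q.1, index n q.2.1, index n q.2.2.1, index n q.2.2.2)
  have hs1 : 4 * (L.map f).length * (e + 1) ≤ 2 ^ k := by
    rw [List.length_map, ← hk]
    exact Nat.lt_two_pow_self.le
  have hs2 : 4 * (L.map f).length * (e + 1) * (X k * X k * X k) ≤ n + 1 := by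
    rw [List.length_map, ← hk]
    exact h4.trans (Nat.le_succ n)
  refine hd (n, k, X k, L.map f) ⟨⟨?_, ?_, ?_, hs1, hs2, ?_⟩, rfl, ?_⟩
  · intro q' hq'
    obtain ⟨q, hq, rfl⟩ := List.mem_map.1 hq'
    obtain ⟨⟨-, a1⟩, ⟨-, a2⟩, a3, a4⟩ := hL q hq
    refine ⟨index_mono n a3, index_le n _, gap_index a3 (h1 q hq), inside_index a1 (by omega),
      inside_index a2 (by omega), ?_⟩
    cases star with
    | false =>
      simp only [Witness, Bool.false_eq_true, if_false] at a4 ⊢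
      simp only [f, a4.1, a4.2, and_self]
    | true =>
      simp only [Witness, if_true] at a4 ⊢
      exact ⟨⟨index_mono n a4.1.1, index_mono n a4.1.2⟩,
        index_mono n a4.2.1, index_mono n a4.2.2⟩
  · intro l hl l' hl' hll
    dsimp only at hl hl' ⊢
    rw [List.getD_eq_getElem _ _ hl, List.getD_eq_getElem _ _ hl', List.getElem_map,
      List.getElem_map]
    rw [List.length_map] at hl hl'
    exact gap_index (List.pairwise_iff_getElem.1 hord l l' hl hl' hll)
      (h2 _ (List.getElem_mem hl) _ (List.getElem_mem hl'))
  · have hcmp : (gridLength (L.map f) : ℝ) ≤ (n + 1) * S + 3 * L.length := by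
      rw [gridLength, Nat.cast_list_sum, List.map_map, List.map_map, hS,
        ← List.sum_map_mul_left]
      have : (3 : ℝ) * L.length = (L.map fun _ => (3 : ℝ)).sum := by
        rw [List.map_const', List.sum_replicate, nsmul_eq_mul, mul_comm]
      rw [this, ← List.sum_map_add]
      refine List.sum_le_sum fun q hq => ?_
      have b1 := index_le_mul n q.2.1
      have b2 := mul_lt_index n q.1
      simp only [Function.comp, f]
      rw [Nat.cast_add, Nat.cast_sub (index_mono n (hL q hq).2.2.1)]
      push_cast
      linarith
    have : (((d + 1) * gridLength (L.map f) : ℕ) : ℝ) < (n + 1 : ℕ) := by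
      push_cast
      have := mul_le_mul_of_nonneg_left hcmp hd'.le
      linarith
    exact_mod_cast this
  · rw [lt_ratVal_iff, ratVal_gridVariation _ n, mul_comm 2, mul_div_assoc,
      mul_lt_mul_iff_right₀ hn, List.map_map]
    · have hcmp : (L.map fun q => |F q.2.2.2 - F q.2.2.1|).sum ≤
          (L.map fun q => |idealPoint (X k) (gridPoint n (index n q.2.2.2)) -
            idealPoint (X k) (gridPoint n (index n q.2.2.1))| +
          2 * (((X k * X k * X k : ℕ) : ℝ) / (n + 1) + (1 / 2) ^ k)).sum := by
        refine List.sum_le_sum fun q hqL => ?_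
        have b1 := abs_idealPoint_sub_le_of_isName hX k (index_le n q.2.2.1)
          (abs_mul_sub_index n _)
        have b2 := abs_idealPoint_sub_le_of_isName hX k (index_le n q.2.2.2)
          (abs_mul_sub_index n _)
        have b3 := (abs_le.1 (abs_abs_sub_sub_abs_sub_le b1 b2)).1
        linarith
      rw [List.sum_map_add, List.map_const', List.sum_replicate, nsmul_eq_mul] at hcmp
      have hsl := slack_le hs1 hs2
      rw [List.length_map] at hsl
      have e1 : (2 : ℝ) / (e + 1) = 2 * (1 / (e + 1)) := by ring
      change _ < (L.map fun q => |idealPoint (X k) (gridPoint n (index n q.2.2.2)) -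
            idealPoint (X k) (gridPoint n (index n q.2.2.1))|).sum
      rw [e1]
      have he0 : (0 : ℝ) < 1 / ((e : ℝ) + 1) := by positivity
      linarith
    · intro q' hq'
      obtain ⟨q, hq, rfl⟩ := List.mem_map.1 hq'
      exact ⟨index_le n _, index_le n _⟩
  · intro q' hq'
    obtain ⟨q, hq, rfl⟩ := List.mem_map.1 hq'
    exact ⟨⟨q.1, (hL q hq).1.1, abs_mul_sub_index n _⟩,
      ⟨q.2.1, (hL q hq).2.1.1, abs_mul_sub_index n _⟩⟩

end Denjoy

/-! ## The derivation process -/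

namespace Denjoy

open OracleComp

theorem near_of_mem_cell {N i M c : ℕ} {x : unitInterval} (hi : x ∈ cell N i)
    (hc : x ∈ cell M c) : Near N i M c := by
  have hN : (0 : ℝ) < (N : ℝ) + 1 := by positivity
  have hM : (0 : ℝ) < (M : ℝ) + 1 := by positivity
  replace hi : |(x : ℝ) * (N + 1) - i| ≤ 1 := hi
  replace hc : |(x : ℝ) * (M + 1) - c| ≤ 1 := hc
  have h1 := mul_le_mul_of_nonneg_right (abs_le.1 hi).1 hM.le
  have h2 := mul_le_mul_of_nonneg_right (abs_le.1 hi).2 hM.le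
  have h3 := mul_le_mul_of_nonneg_right (abs_le.1 hc).1 hN.le
  have h4 := mul_le_mul_of_nonneg_right (abs_le.1 hc).2 hN.le
  constructor
  · have : ((c * (N + 1) : ℕ) : ℝ) ≤ (i * (M + 1) + ((N + 1) + (M + 1)) : ℕ) := by
      push_cast
      linarith
    exact_mod_cast this
  · have : ((i * (M + 1) : ℕ) : ℝ) ≤ (c * (N + 1) + ((N + 1) + (M + 1)) : ℕ) := by
      push_cast
      linarith
    exact_mod_cast this

/-- `Near` compares the distance of the centres with the sum of the radii. A common point is the
second centre, projected to the first interval; it lies between the two centres and hence in `I`. -/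
theorem exists_mem_cell_of_near {N i M c : ℕ} (hi : i ≤ N + 1) (hc : c ≤ M + 1)
    (h : Near N i M c) : ∃ y : unitInterval, y ∈ cell N i ∧ y ∈ cell M c := by
  have hN : (0 : ℝ) < (N : ℝ) + 1 := by positivity
  have hM : (0 : ℝ) < (M : ℝ) + 1 := by positivity
  set u : ℝ := i / (N + 1) with hu
  set w : ℝ := c / (M + 1) with hw
  have hi' : (i : ℝ) ≤ N + 1 := by exact_mod_cast hi
  have hc' : (c : ℝ) ≤ M + 1 := by exact_mod_cast hc
  have hu0 : 0 ≤ u := by positivity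
  have hw0 : 0 ≤ w := by positivity
  have hu1 : u ≤ 1 := (div_le_one hN).2 hi'
  have hw1 : w ≤ 1 := (div_le_one hM).2 hc'
  have hui : u * (N + 1) = i := div_mul_cancel₀ _ hN.ne'
  have hwc : w * (M + 1) = c := div_mul_cancel₀ _ hM.ne'
  set r : ℝ := 1 / (N + 1) with hr
  set r' : ℝ := 1 / (M + 1) with hr'
  have hrN : r * (N + 1) = 1 := div_mul_cancel₀ _ hN.ne'
  have hrM : r' * (M + 1) = 1 := div_mul_cancel₀ _ hM.ne'
  have hr0 : 0 < r := by positivity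
  have hr0' : 0 < r' := by positivity
  have h1 : w ≤ u + (r + r') := by
    have : (c : ℝ) * (N + 1) ≤ i * (M + 1) + ((N + 1) + (M + 1)) := by exact_mod_cast h.1
    rw [← hui, ← hwc] at this
    have h2 : w * ((M + 1) * (N + 1)) ≤ (u + (r + r')) * ((M + 1) * (N + 1)) := by
      have e1 : (u + (r + r')) * (((M : ℝ) + 1) * (N + 1)) = u * (N + 1) * (M + 1) +
        ((r' * (M + 1)) * (N + 1) + (r * (N + 1)) * (M + 1)) := by ring
      rw [e1, hrN, hrM]
      linarith
    exact le_of_mul_le_mul_right h2 (by positivity)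
  have h2 : u ≤ w + (r + r') := by
    have : (i : ℝ) * (M + 1) ≤ c * (N + 1) + ((N + 1) + (M + 1)) := by exact_mod_cast h.2
    rw [← hui, ← hwc] at this
    have h2 : u * ((M + 1) * (N + 1)) ≤ (w + (r + r')) * ((M + 1) * (N + 1)) := by
      have e1 : (w + (r + r')) * (((M : ℝ) + 1) * (N + 1)) = w * (M + 1) * (N + 1) +
        ((r' * (M + 1)) * (N + 1) + (r * (N + 1)) * (M + 1)) := by ring
      rw [e1, hrN, hrM]
      linarith
    exact le_of_mul_le_mul_right h2 (by positivity)
  obtain ⟨y, hy0, hy1, hy2, hy3⟩ : ∃ y : ℝ, 0 ≤ y ∧ y ≤ 1 ∧ |y - u| ≤ r ∧ |y - w| ≤ r' := by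
    rcases le_total w (u - r) with h3 | h3
    · exact ⟨u - r, by linarith, by linarith, abs_le.2 ⟨by linarith, by linarith⟩,
        abs_le.2 ⟨by linarith, by linarith⟩⟩
    · rcases le_total w (u + r) with h4 | h4
      · exact ⟨w, hw0, hw1, abs_le.2 ⟨by linarith, by linarith⟩, by simpa using hr0'.le⟩
      · exact ⟨u + r, by linarith, by linarith, abs_le.2 ⟨by linarith, by linarith⟩,
          abs_le.2 ⟨by linarith, by linarith⟩⟩
  refine ⟨⟨y, hy0, hy1⟩, ?_, ?_⟩
  · change |y * (N + 1) - i| ≤ 1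
    rw [← hui, ← sub_mul, abs_mul, abs_of_pos hN]
    exact (mul_le_mul_of_nonneg_right hy2 hN.le).trans_eq hrN
  · change |y * (M + 1) - c| ≤ 1
    rw [← hwc, ← sub_mul, abs_mul, abs_of_pos hM]
    exact (mul_le_mul_of_nonneg_right hy3 hM.le).trans_eq hrM

theorem dist_le_of_mem_cell {M c : ℕ} {x y : unitInterval} (hx : x ∈ cell M c)
    (hy : y ∈ cell M c) : |(x : ℝ) - y| ≤ 2 / (M + 1) := by
  have hM : (0 : ℝ) < (M : ℝ) + 1 := by positivity
  have h1 := abs_le.1 (show |(x : ℝ) * (M + 1) - c| ≤ 1 from hx)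
  have h2 := abs_le.1 (show |(y : ℝ) * (M + 1) - c| ≤ 1 from hy)
  rw [le_div_iff₀ hM, show |(x : ℝ) - y| * (M + 1) = |((x : ℝ) - y) * (M + 1)| by
    rw [abs_mul, abs_of_pos hM], abs_le]
  constructor <;> linarith [h1.1, h1.2, h2.1, h2.2]

theorem isClosed_cell (N i : ℕ) : IsClosed (cell N i) :=
  isClosed_le (by fun_prop) continuous_const

/-- The step of the derivation in arithmetical form. -/
theorem derive_disjoint_cell_iff {star : Bool} {X : ℕ → ℕ} {F : C(unitInterval, ℝ)}
    (hX : IsName X F) {P : Set unitInterval} (hP : IsClosed P) {N i : ℕ} (hi : i ≤ N + 1) :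
    (∀ x ∈ derive (IsVar star F) P, x ∉ cell N i) ↔
      ∃ M, ∀ c e, ∃ d, ∀ t, ¬ ((c ≤ M + 1 ∧ Near N i M c) ∧ Obstruction star X P M c e d t) := by
  constructor
  · intro h
    -- The good intervals cover the cell: points of `P` are covered because the derivation removes
    -- them, and points off `P` because a small interval about them does not meet `P`.
    let ι := {p : ℝ × ℝ // IsVar star F {y | y ∈ P ∧ p.1 ≤ y ∧ (y : ℝ) ≤ p.2}}
    have hcover : cell N i ⊆ ⋃ p : ι, {x : unitInterval | p.1.1 < x ∧ (x : ℝ) < p.1.2} := by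
      intro x hx
      have hxd : x ∉ derive (IsVar star F) P := fun hxd => h x hxd hx
      by_cases hxP : x ∈ P
      · obtain ⟨a, b, ha, hb, hab⟩ : ∃ a b : ℝ, a < x ∧ (x : ℝ) < b ∧
            IsVar star F {y | y ∈ P ∧ a ≤ y ∧ (y : ℝ) ≤ b} := by
          by_contra hne
          exact hxd ⟨hxP, hne⟩
        exact Set.mem_iUnion.2 ⟨⟨(a, b), hab⟩, ha, hb⟩
      · obtain ⟨r, hr, hball⟩ := Metric.isOpen_iff.1 hP.isOpen_compl x hxP
        refine Set.mem_iUnion.2 ⟨⟨((x : ℝ) - r / 2, (x : ℝ) + r / 2), ?_⟩, ?_, ?_⟩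
        · have hempty : {y : unitInterval | y ∈ P ∧ (x : ℝ) - r / 2 ≤ y ∧ (y : ℝ) ≤ x + r / 2}
              = ∅ := by
            refine Set.eq_empty_of_forall_notMem ?_
            rintro y ⟨hyP, hy1, hy2⟩
            refine (show y ∈ Metric.ball x r → False from fun hy => hball hy hyP) ?_
            rw [Metric.mem_ball, Subtype.dist_eq, Real.dist_eq]
            exact lt_of_le_of_lt (abs_le.2 ⟨by linarith, by linarith⟩) (half_lt_self hr)
          intro ε hε
          refine ⟨1, one_pos, fun L hL _ _ => ?_⟩
          cases L with
          | nil => simpa using hε.le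
          | cons q L =>
            have := (hL q List.mem_cons_self).1
            rw [hempty] at this
            exact absurd this (Set.notMem_empty _)
        · change (x : ℝ) - r / 2 < x
          linarith
        · change (x : ℝ) < x + r / 2
          linarith
    obtain ⟨δ, hδ, hleb⟩ := lebesgue_number_lemma_of_metric (isClosed_cell N i).isCompact
      (fun p : ι => (isOpen_lt continuous_const continuous_subtype_val).inter
        (isOpen_lt continuous_subtype_val continuous_const)) hcover
    -- With this `M` the cells have diameter below the Lebesgue number, so each one meeting the
    -- given cell lies in a single good interval.
    obtain ⟨M, hM⟩ := exists_nat_one_div_lt (show 0 < δ / 2 by positivity)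
    refine ⟨M, fun c e => ?_⟩
    by_cases hc : c ≤ M + 1 ∧ Near N i M c
    · obtain ⟨y, hy, hyc⟩ := exists_mem_cell_of_near hi hc.1 hc.2
      obtain ⟨p, hp⟩ := hleb y hy
      have hvar : IsVar star F {x | x ∈ P ∧ x ∈ cell M c} := by
        refine p.2.mono ?_
        rintro x ⟨hxP, hx⟩
        have : x ∈ Metric.ball y δ := by
          rw [Metric.mem_ball, Subtype.dist_eq, Real.dist_eq]
          refine lt_of_le_of_lt (dist_le_of_mem_cell hx hyc) ?_
          have e1 : (2 : ℝ) / (M + 1) = 2 * (1 / (M + 1)) := by ring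
          rw [e1]
          linarith
        have hx' := hp this
        exact ⟨hxP, hx'.1.le, hx'.2.le⟩
      obtain ⟨d, hd⟩ := not_obstruction_of_isVar hX hvar e
      exact ⟨d, fun t ht => hd t ht.2⟩
    · exact ⟨0, fun t ht => hc ht.1⟩
  · rintro ⟨M, h⟩ x ⟨hxP, hx⟩ hxi
    have hM : (0 : ℝ) < (M : ℝ) + 1 := by positivity
    have hx0 : 0 ≤ (x : ℝ) * (M + 1) := mul_nonneg x.2.1 hM.le
    -- Rounding to the nearest index puts `x` within `1 / 2` of the centre, hence in the interior of
    -- the part of radius `3 / 4` on which absolute continuity is recovered.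
    set c : ℕ := ⌊(x : ℝ) * (M + 1) + 1 / 2⌋₊ with hc
    have h1 : (c : ℝ) ≤ x * (M + 1) + 1 / 2 := Nat.floor_le (by positivity)
    have h2 : (x : ℝ) * (M + 1) + 1 / 2 < c + 1 := Nat.lt_floor_add_one _
    have hcM : c ≤ M + 1 := by
      have h3 : (x : ℝ) * (M + 1) ≤ 1 * (M + 1) := mul_le_mul_of_nonneg_right x.2.2 hM.le
      have h4 : (c : ℝ) < (M + 2 : ℕ) := by push_cast; linarith
      have := Nat.cast_lt.1 h4
      omega
    have hxc : |(x : ℝ) * (M + 1) - c| ≤ 1 := abs_le.2 ⟨by linarith, by linarith⟩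
    have hnear := near_of_mem_cell hxi hxc
    have hvar : IsVar star F {x | x ∈ P ∧ |(x : ℝ) * (M + 1) - c| ≤ 3 / 4} := by
      refine isVar_of_not_obstruction hX fun e => ?_
      obtain ⟨d, hd⟩ := h c e
      exact ⟨d, fun t ht => hd t ⟨⟨hcM, hnear⟩, ht⟩⟩
    refine hx ⟨(c - 3 / 4) / (M + 1), (c + 3 / 4) / (M + 1), ?_, ?_, hvar.mono ?_⟩
    · rw [div_lt_iff₀ hM]
      linarith
    · rw [lt_div_iff₀ hM]
      linarith
    · rintro y ⟨hyP, hy1, hy2⟩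
      rw [div_le_iff₀ hM] at hy1
      rw [le_div_iff₀ hM] at hy2
      exact ⟨hyP, abs_le.2 ⟨by linarith, by linarith⟩⟩

theorem isClosed_derive (Q : Set unitInterval → Prop) {P : Set unitInterval} (hP : IsClosed P) :
    IsClosed (derive Q P) := by
  refine hP.sdiff ?_
  have : {x : unitInterval | ∃ a b : ℝ, a < x ∧ (x : ℝ) < b ∧ Q {y | y ∈ P ∧ a ≤ y ∧ (y : ℝ) ≤ b}}
      = ⋃ p : {p : ℝ × ℝ // Q {y | y ∈ P ∧ p.1 ≤ y ∧ (y : ℝ) ≤ p.2}},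
        ({x : unitInterval | p.1.1 < x} ∩ {x : unitInterval | (x : ℝ) < p.1.2}) := by
    ext x
    simp only [Set.mem_iUnion]
    constructor
    · rintro ⟨a, b, ha, hb, hQ⟩
      exact ⟨⟨(a, b), hQ⟩, ha, hb⟩
    · rintro ⟨⟨⟨a, b⟩, hQ⟩, ha, hb⟩
      exact ⟨a, b, ha, hb, hQ⟩
  rw [this]
  exact isOpen_iUnion fun p => (isOpen_lt continuous_const continuous_subtype_val).inter
    (isOpen_lt continuous_subtype_val continuous_const)

/-! ### Transfinite iteration of the derivation -/

variable (Q : Set unitInterval → Prop)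

theorem derived_zero : derived Q 0 = Set.univ := Ordinal.limitRecOn_zero _ _ _

theorem derived_add_one (α : Ordinal.{0}) : derived Q (α + 1) = derive Q (derived Q α) :=
  Ordinal.limitRecOn_add_one _ _ _ _

theorem derived_limit {α : Ordinal.{0}} (h : Order.IsSuccLimit α) :
    derived Q α = ⋂ (β : Ordinal.{0}) (_ : β < α), derived Q β :=
  Ordinal.limitRecOn_limit _ _ _ _ h

theorem derived_anti : Antitone (derived Q) := by
  intro β α hβ
  induction α using Ordinal.limitRecOn with
  | zero => rw [nonpos_iff_eq_zero.1 hβ]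
  | add_one α ih =>
    rcases hβ.eq_or_lt with rfl | h
    · exact le_rfl
    · rw [derived_add_one]
      exact Set.sdiff_subset.trans (ih (Order.lt_add_one_iff.1 h))
  | limit α hα ih =>
    rcases hβ.eq_or_lt with rfl | h
    · exact le_rfl
    · rw [derived_limit Q hα]
      exact Set.iInter₂_subset β h

theorem isClosed_derived (α : Ordinal.{0}) : IsClosed (derived Q α) := by
  induction α using Ordinal.limitRecOn with
  | zero => rw [derived_zero]; exact isClosed_univ
  | add_one α ih => rw [derived_add_one]; exact isClosed_derive Q ih
  | limit α hα ih =>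
    rw [derived_limit Q hα]
    exact isClosed_biInter fun β hβ => ih β hβ

theorem rank_le_iff (α : Ordinal.{0}) : rank Q ≤ (α : WithTop Ordinal.{0}) ↔ derived Q α = ∅ := by
  rw [rank]
  split_ifs with h
  · have hmem : derived Q (sInf {α | derived Q α = ∅}) = ∅ := csInf_mem (s := {α | derived Q α = ∅}) h
    rw [WithTop.coe_le_coe]
    constructor
    · intro hle
      exact Set.subset_eq_empty (derived_anti Q hle) hmem
    · exact fun h => csInf_le' h
  · simp only [WithTop.top_le_iff, WithTop.coe_ne_top, false_iff]
    exact fun h' => h ⟨α, h'⟩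

theorem derived_iSup {β : ℕ → Ordinal.{0}} (hβ : StrictMono β) :
    derived Q (⨆ n, β n) = ⋂ n, derived Q (β n) := by
  apply subset_antisymm
  · exact Set.subset_iInter fun n => derived_anti Q (Ordinal.le_iSup β n)
  · have hlim : Order.IsSuccLimit (⨆ n, β n) := by
      refine ⟨?_, ?_⟩
      · intro hmin
        have := (hβ Nat.zero_lt_one).trans_le (Ordinal.le_iSup β 1)
        exact absurd (hmin (zero_le : (0 : Ordinal.{0}) ≤ _)) (not_le.2 ((zero_le : (0 : Ordinal.{0}) ≤ β 0).trans_lt this))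
      · intro γ hγ
        obtain ⟨n, hn⟩ := Ordinal.lt_iSup_iff.1 hγ.1
        exact hγ.2 hn ((hβ n.lt_succ_self).trans_le (Ordinal.le_iSup β (n + 1)))
    rw [derived_limit Q hlim]
    refine Set.subset_iInter₂ fun γ hγ => ?_
    obtain ⟨n, hn⟩ := Ordinal.lt_iSup_iff.1 hγ
    exact (Set.iInter_subset _ n).trans (derived_anti Q hn.le)

/-! ## The hierarchy of sets of disjoint cells -/

/-- The set coding the cells disjoint from `P`, and the graph of `g`. -/
def cellSet (g : ℕ → ℕ) (P : Set unitInterval) : Set ℕ :=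
  {z | (z % 2 = 1 ∧ z / 2 ∈ graph g) ∨ (z % 2 = 0 ∧ (z / 2).unpair.2 ≤ (z / 2).unpair.1 + 1 ∧
    ∀ x ∈ P, x ∉ cell (z / 2).unpair.1 (z / 2).unpair.2)}

theorem mem_cellSet {g : ℕ → ℕ} {P : Set unitInterval} {z : ℕ} : z ∈ cellSet g P ↔
    (z % 2 = 1 ∧ z / 2 ∈ graph g) ∨ (z % 2 = 0 ∧ (z / 2).unpair.2 ≤ (z / 2).unpair.1 + 1 ∧
    ∀ x ∈ P, x ∉ cell (z / 2).unpair.1 (z / 2).unpair.2) := Iff.rfl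

theorem two_mul_pair_mem_cellSet {g : ℕ → ℕ} {P : Set unitInterval} {n i : ℕ} :
    2 * Nat.pair n i ∈ cellSet g P ↔ i ≤ n + 1 ∧ ¬ Meets P n i := by
  have h2 : 2 * Nat.pair n i / 2 = Nat.pair n i := by omega
  simp [mem_cellSet, h2, Meets]

theorem two_mul_add_one_mem_cellSet {g : ℕ → ℕ} {P : Set unitInterval} {x : ℕ} :
    2 * x + 1 ∈ cellSet g P ↔ x ∈ graph g := by
  have h1 : (2 * x + 1) % 2 = 1 := by omega
  have h2 : (2 * x + 1) / 2 = x := by omega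
  simp [mem_cellSet, h1, h2]

/-- The odd query asks for the value of `Y ⊕ X` at `2k + 1`, that is for `X k`. The even ones ask
whether cells meet `P`; `QuadOK` keeps their indices in range, so non-membership really means
meeting. -/
theorem violation_cellSet_iff {star : Bool} {Y : Set ℕ} {X : ℕ → ℕ} {P : Set unitInterval}
    {N i M c e d : ℕ} {t : ℕ × ℕ × ℕ × List (ℕ × ℕ × ℕ × ℕ)} :
    Violation (cellSet (join Y X) P) star N i M c e d t ↔
      (c ≤ M + 1 ∧ Near N i M c) ∧ Obstruction star X P M c e d t := by
  rw [Violation, Obstruction, two_mul_add_one_mem_cellSet, pair_mem_graph,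
    join_two_mul_add_one]
  constructor
  · rintro ⟨⟨h1, h2, h3⟩, h4, h5⟩
    refine ⟨⟨h1, h2⟩, h3, h4, fun q hq => ?_⟩
    obtain ⟨a1, a2, -⟩ := h3.1 q hq
    have h6 := h5 q hq
    simp only [two_mul_pair_mem_cellSet, not_and, not_not] at h6
    exact ⟨h6.1 (a1.trans a2), h6.2 a2⟩
  · rintro ⟨⟨h1, h2⟩, h3, h4, h5⟩
    refine ⟨⟨h1, h2, h3⟩, h4, fun q hq => ?_⟩
    simp only [two_mul_pair_mem_cellSet, not_and, not_not]
    exact ⟨fun _ => (h5 q hq).1, fun _ => (h5 q hq).2⟩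

theorem exists_isJumpHierarchy (star : Bool) : ∃ v : ℕ → ℕ, Computable v ∧
    ∀ (Y : Set ℕ) (X : ℕ → ℕ) (F : C(unitInterval, ℝ)), IsName X F →
      IsJumpHierarchy v (join Y X) fun α => cellSet (join Y X) (derived (IsVar star F) α) := by
  obtain ⟨v, hv, h⟩ := exists_step_reduction star
  refine ⟨v, hv, fun Y X F hX => ⟨fun z => ?_, fun α z => ?_, fun β hβ z => ?_⟩⟩
  · rw [mem_cellSet, derived_zero, or_iff_left]
    rintro ⟨-, hi, hdis⟩
    -- Every cell with index in range contains its grid point, so at stage `0` no cell is listed.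
    refine hdis (gridPoint (z / 2).unpair.1 (z / 2).unpair.2) (Set.mem_univ _) ?_
    have h1 : ((z / 2).unpair.1 : ℝ) + 1 ≠ 0 := by positivity
    change |(gridPoint _ _ : ℝ) * _ - _| ≤ 1
    rw [coe_gridPoint hi, div_mul_cancel₀ _ h1]
    simp
  · rw [h, mem_cellSet, derived_add_one]
    refine or_congr ?_ (and_congr_right fun _ => and_congr_right fun hi => ?_)
    · refine and_congr_right fun hz => ?_
      rw [mem_cellSet]
      simp [hz]
    · rw [derive_disjoint_cell_iff hX (isClosed_derived _ α) hi]
      simp only [violation_cellSet_iff]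
  · simp only [mem_cellSet]
    rcases Nat.mod_two_eq_zero_or_one z with hz | hz
    · simp only [hz, zero_ne_one, false_and, false_or, true_and, exists_and_left]
      refine and_congr_right fun _ => ?_
      rw [derived_iSup _ hβ]
      constructor
      · intro hdis
        -- If the cell met every `P^(β_n)`, the decreasing compact intersections would have a common
        -- point in the limit set.
        by_contra! hne
        have hcompact : ∀ n, IsCompact (derived (IsVar star F) (β n) ∩
            cell (z / 2).unpair.1 (z / 2).unpair.2) := fun n =>
          ((isClosed_derived _ _).inter (isClosed_cell _ _)).isCompact
        obtain ⟨x, hx⟩ := IsCompact.nonempty_iInter_of_sequence_nonempty_isCompact_isClosed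
          (fun n => derived (IsVar star F) (β n) ∩ cell (z / 2).unpair.1 (z / 2).unpair.2)
          (fun n => Set.inter_subset_inter_left _ (derived_anti _ (hβ n.lt_succ_self).le))
          (fun n => (hne n).imp fun x hx => ⟨hx.1, by simpa using hx.2⟩) (hcompact 0)
          (fun n => (hcompact n).isClosed)
        rw [Set.mem_iInter] at hx
        exact hdis x (Set.mem_iInter.2 fun n => (hx n).1) (hx 0).2
      · rintro ⟨n, hn⟩ x hx
        exact hn x (Set.mem_iInter.1 hx n)
    · simp [hz]

/-- The functions whose derivation process ends by stage `α` form a `Σ^0_{4α}(Y)` class. -/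
theorem isSigmaZeroCI_of_isVar (star : Bool) {Y : Set ℕ} {α : Ordinal.{0}}
    (hα : α < omegaOne Y) : IsSigmaZeroCI Y (4 * α)
      {F | rank (IsVar star F) ≤ (α : WithTop Ordinal.{0})} := by
  obtain ⟨v, hv, h⟩ := exists_isJumpHierarchy star
  -- The number `2 * Nat.pair 0 0` codes the cell that is all of `I`; its membership in the stage
  -- `α` set says that the derived set is empty.
  obtain ⟨e₀, a, hea⟩ := exists_index_of_isJumpHierarchy hv hα (2 * Nat.pair 0 0)
  classical
  refine ⟨{X | e₀ ∈ HSet (join Y X) (if 4 * α < Ordinal.omega0 then a else 2 ^ a)},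
    ⟨e₀, a, fun X => ⟨(hea X).1, Iff.rfl⟩⟩, fun X F hX => ?_⟩
  have h1 := (hea X).2 _ (h Y X F hX)
  rw [two_mul_pair_mem_cellSet] at h1
  change rank (IsVar star F) ≤ _ ↔ e₀ ∈ HSet (join Y X) _
  rw [rank_le_iff]
  refine Iff.trans ?_ h1
  rw [Set.eq_empty_iff_forall_notMem]
  constructor
  · rintro hne
    exact ⟨Nat.zero_le _, fun ⟨x, hx, _⟩ => hne x hx⟩
  · rintro ⟨-, hne⟩ x hx
    refine hne ⟨x, hx, ?_⟩
    change |(x : ℝ) * ((0 : ℕ) + 1) - (0 : ℕ)| ≤ 1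
    rw [Nat.cast_zero, zero_add, mul_one, sub_zero, abs_of_nonneg x.2.1]
    exact x.2.2

end Denjoy

theorem mainTheorem5 (Y : Set ℕ) (α : Ordinal.{0}) (hα : α < OracleComp.omegaOne Y) :
    OracleComp.IsSigmaZeroCI Y (4 * α) (Denjoy.ACGStar α) ∧
      OracleComp.IsSigmaZeroCI Y (4 * α) (Denjoy.ACG α) := by
  constructor
  · have h := Denjoy.isSigmaZeroCI_of_isVar true hα
    simp only [← Denjoy.isACStar_eq_isVar] at h
    exact h
  · have h := Denjoy.isSigmaZeroCI_of_isVar false hα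
    simp only [← Denjoy.isAC_eq_isVar] at h
    exact h
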